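/- Let $G$ be a graph on a vertex set $V$ whose vertices are coloured red or blue, $R_0$ being the set of red vertices and $B_0 = V \setminus R_0$ the set of blue ones. In one step of majority dynamics all vertices simultaneously adopt the colour held by the strict majority of their neighbours, a vertex keeping its colour in the case of a tie; $R_1$ denotes the set of vertices that are red after one step. Fix any initial colouring $R_0, B_0$ of $n$ vertices and, independently of it, sample the random graph $G_{n,p}$, in which each potential edge is present independently with probability $p$. Let $\Delta = \big||R_0| - |B_0|\big|$, $\sigma = \sqrt{np(1-p)}$, and $$\mu = \mathbb{P}\big(\mathrm{Bin}(|R_0|,p) \ge \mathrm{Bin}(|B_0|,p)\big) \cdot \mathbb{P}\big(\mathrm{Bin}(|R_0|,p) \le \mathrm{Bin}(|B_0|,p)\big),$$ where the two binomial random variables are independent. (i) There is an absolute constant $C > 0$ such that for every $n$, every initial colouring and every $p \in (0,1)$, $$\big|\mathrm{Var}(|R_1|) - n\mu\big| \le C\,(\Delta + n/\sigma).$$ (ii) Consider any sequence of instances, consisting of a number of vertices $n$, a colouring $R_0, B_0$ and a probability $p \in [0,1]$, along which $\sigma \to \infty$ (so that $n \to \infty$), and suppose that $\log(1/\mu) =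 o(\log \sigma)$. Then $\mathrm{Var}(|R_1|) \sim n\mu$, and for all fixed reals $a < b$, $$\lim \mathbb{P}\left( \frac{|R_1| - \mathbb{E}|R_1|}{\sqrt{n\mu}} \in [a,b] \right) = \frac{1}{\sqrt{2\pi}} \int_a^b e^{-x^2/2}\,dx = \Phi(b) - \Phi(a),$$ where $\Phi(t) = (2\pi)^{-1/2}\int_{-\infty}^t e^{-x^2/2}\,dx$. In particular, along any sequence of instances with $\sigma \to \infty$ and $\Delta p = O(\sigma)$, one has $\log(1/\mu) = o(\log\sigma)$, and hence both conclusions of (ii) hold. -/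

import Mathlib

open MeasureTheory ProbabilityTheory Filter Asymptotics
open scoped Topology Finset

noncomputable section

namespace MajorityDynamics

open Classical in
/-- The number of neighbours of `v` in `G` that lie in `S`. -/
def degreeInto {V : Type*} (G : SimpleGraph V) (v : V) (S : Finset V) : ℕ :=
  #{w ∈ S | G.Adj v w}

/-- One step of majority dynamics on `G`: given the set `R` of red vertices (all other vertices
being blue), the set of vertices that are red after the step. A vertex takes the colour held by the
strict majority of its neighbours and keeps its own colour in the case of a tie. -/
def redAfterStep {V : Type*} [Fintype V] [DecidableEq V] (G : SimpleGraph V) (R : Finset V) :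
    Finset V :=
  {v | degreeInto G v Rᶜ < degreeInto G v R ∨ (degreeInto G v Rᶜ = degreeInto G v R ∧ v ∈ R)}

/-- The number `|R₁|` of red vertices after one step from the initial red set `R`, as a random
variable on the space of graphs. -/
def numRed {V : Type*} [Fintype V] [DecidableEq V] (R : Finset V) (G : SimpleGraph V) : ℝ :=
  (#(redAfterStep G R) : ℝ)

/-- The initial imbalance `Δ = ||R₀| - |B₀||`. -/
def imbalance {n : ℕ} (R : Finset (Fin n)) : ℝ :=
  |(#R : ℝ) - (#Rᶜ : ℝ)|

/-- `σ = √(n p (1 - p))`. -/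
def sigma (n : ℕ) (p : unitInterval) : ℝ :=
  √((n : ℝ) * (p : ℝ) * (1 - (p : ℝ)))

/-- `μ = P(Bin(|R₀|, p) ≥ Bin(|B₀|, p)) · P(Bin(|R₀|, p) ≤ Bin(|B₀|, p))`, where the two binomial
random variables are independent. -/
def mu {n : ℕ} (R : Finset (Fin n)) (p : unitInterval) : ℝ :=
  ((binomial (#R) p).prod (binomial (#Rᶜ) p)).real {x : ℕ × ℕ | x.1 ≥ x.2} *
    ((binomial (#R) p).prod (binomial (#Rᶜ) p)).real {x : ℕ × ℕ | x.1 ≤ x.2}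

/-- The law of the random graph `G_{n,p}` on the vertex set `Fin n`. -/
abbrev gnp (n : ℕ) (p : unitInterval) : Measure (SimpleGraph (Fin n)) :=
  SimpleGraph.binomialRandom (Fin n) p

/-- `E|R₁|` for the random graph `G_{n,p}`. -/
def meanRed {n : ℕ} (R : Finset (Fin n)) (p : unitInterval) : ℝ :=
  ∫ G, numRed R G ∂(gnp n p)

/-- `Var|R₁|` for the random graph `G_{n,p}`. -/
def varRed {n : ℕ} (R : Finset (Fin n)) (p : unitInterval) : ℝ :=
  variance (numRed R) (gnp n p)

/-- The standard normal distribution function `Φ`. -/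
def stdNormalCDF (t : ℝ) : ℝ :=
  (√(2 * Real.pi))⁻¹ * ∫ x in Set.Iic t, Real.exp (-x ^ 2 / 2)

/-- The central limit law for `|R₁|`, along a sequence of instances: the probability that
`(|R₁| - E|R₁|) / √(n μ)` lies in `[a, b]` tends to the standard normal measure of `[a, b]`. -/
def CentralLimitLaw (n : ℕ → ℕ) (p : ℕ → unitInterval) (R : ∀ k, Finset (Fin (n k))) : Prop :=
  ∀ a b : ℝ, a < b →
    Tendsto
      (fun k ↦ (gnp (n k) (p k)).real
        {G | (numRed (R k) G - meanRed (R k) (p k)) / √((n k : ℝ) * mu (R k) (p k)) ∈ Set.Icc a b})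
      atTop
      (𝓝 ((√(2 * Real.pi))⁻¹ * ∫ x in a..b, Real.exp (-x ^ 2 / 2))) ∧
    (√(2 * Real.pi))⁻¹ * ∫ x in a..b, Real.exp (-x ^ 2 / 2) = stdNormalCDF b - stdNormalCDF a

end MajorityDynamics

end

/-!
Let a red neighbour count `1` and a blue one `-1` (`eps`). Then a vertex turns red when the signed number of its neighbours reaches its threshold, `0` or `1`. If a pair `uv` is
altered, the decision of `u` changes only when the pair is pivotal for `u`: the signed number of the
other neighbours equals one specific value. This has probability `O(1/σ)` (`pointProb_le`), and by
Fourier inversion neighbouring values have probabilities that differ by `O(1/σ²)`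
(`abs_pointProb_sub_le`), so that up to this error all pairs have the same pivotality probability.

*Variance.* Two vertices `u`, `v` share only the pair `uv`. Hence the covariance of their decisions
is exactly `p (1 - p)`, times the signs of the two colours, times the probabilities that `uv` is
pivotal for `u` and for `v` (`ex_dec_mul_dec`). As these probabilities nearly agree, the covariances
cancel between monochromatic and bichromatic pairs, up to `O(Δ + n/σ)` (`abs_pairSum_le`). The
diagonal terms add up to `n μ + O(n/σ)` (`abs_sum_decProb_sub_le`).

*Central limit theorem.* Let every pair carry two Bernoulli bits, one seen by each of its ends,
which coincide with probability `θ` and are independent otherwise (`tie`). At `θ = 1` this is the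
random graph, at `θ = 0` the decisions of all vertices are independent. The derivative in `θ` of the
characteristic function of the number of red vertices is a signed sum over pairs of
`p (1 - p) (exp (i τ) - 1) ^ 2 E[1{uv pivotal for u and v} exp (i τ W)]`, where `W` counts the red vertices other
than `u` and `v` (`hasDerivAt_countCharFun`). The pivotality of `uv` for `u` is almost independent
of `W`: replacing the bits with which the other vertices see `u` by an independent copy changes `W`
by a sum whose terms have almost uncorrelated signs, and which is of bounded second moment
(`ex_piv_mul_pivots_mul_sq_le`, `norm_ex_piv_mul_pivots_sub_le`). Thus the expectation factors up to
a small error, and the main terms cancel as in the variance (`norm_countCharFun_sub_le`). For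
independent decisions the characteristic function is a product, close to a Gaussian one, and Lévy's
continuity theorem applies.

*Size of `μ`.* If `log (1/μ) = o(log σ)`, then `μ` exceeds any fixed negative power of `σ`, while
Chebyshev's inequality gives `Δ² p² μ ≤ σ²` (`imbalance_sq_mul_mu_le`); so all errors are negligible
against `n μ` (`rates`). If `Δ p = O(σ)`, then `μ` is bounded below by the central limit theorem for
the signed number of neighbours (`exists_le_mu`).
-/

namespace MajorityDynamics

/-! ### Expectations over finite product spaces -/

/-- The expectation of `g` on the finite product space `ι → α`, each coordinate having law `w`. The
weight `w` need not be a probability weight; see `IsProbWeight`. -/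
noncomputable def ex {ι α E : Type*} [Fintype ι] [DecidableEq ι] [Fintype α] [AddCommMonoid E]
    [Module ℝ E] (w : α → ℝ) (g : (ι → α) → E) : E :=
  ∑ ω : ι → α, (∏ i, w (ω i)) • g ω

/-- The weight `w` on a finite type is a probability mass function. -/
structure IsProbWeight {α : Type*} [Fintype α] (w : α → ℝ) : Prop where
  nonneg : ∀ a, 0 ≤ w a
  sum_eq_one : ∑ a, w a = 1

section Ex

variable {ι κ α β E : Type*} [Fintype ι] [DecidableEq ι] [Fintype κ] [DecidableEq κ]
  [Fintype α] [Fintype β]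

section Module

variable [AddCommGroup E] [Module ℝ E]

theorem ex_add (w : α → ℝ) (g h : (ι → α) → E) :
    ex w (fun ω ↦ g ω + h ω) = ex w g + ex w h := by
  simp [ex, smul_add, Finset.sum_add_distrib]

theorem ex_sub (w : α → ℝ) (g h : (ι → α) → E) :
    ex w (fun ω ↦ g ω - h ω) = ex w g - ex w h := by
  simp [ex, smul_sub, Finset.sum_sub_distrib]

theorem ex_sum {J : Type*} (s : Finset J) (w : α → ℝ) (g : J → (ι → α) → E) :
    ex w (fun ω ↦ ∑ j ∈ s, g j ω) = ∑ j ∈ s, ex w (g j) := by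
  simp only [ex, Finset.smul_sum]
  exact Finset.sum_comm

theorem ex_smul_const (w : α → ℝ) (x : E) (g : (ι → α) → ℝ) :
    ex w (fun ω ↦ g ω • x) = ex w g • x := by
  simp only [ex, Finset.sum_smul, smul_assoc]

theorem sum_prod_weight {w : α → ℝ} (hw : IsProbWeight w) : ∑ ω : ι → α, ∏ i, w (ω i) = 1 := by
  rw [← Fintype.prod_sum (fun _ a ↦ w a)]
  simp [hw.sum_eq_one]

theorem ex_const {w : α → ℝ} (hw : IsProbWeight w) (c : E) :
    ex w (fun _ : ι → α ↦ c) = c := by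
  rw [ex, ← Finset.sum_smul, sum_prod_weight hw, one_smul]

/-- Functions that agree on the configurations of non-zero weight have the same expectation. -/
theorem ex_congr_support {w : α → ℝ} {g h : (ι → α) → E}
    (hgh : ∀ ω, (∀ i, w (ω i) ≠ 0) → g ω = h ω) : ex w g = ex w h := by
  refine Finset.sum_congr rfl fun ω _ ↦ ?_
  by_cases h0 : ∀ i, w (ω i) ≠ 0
  · rw [hgh ω h0]
  · push Not at h0
    obtain ⟨i, hi⟩ := h0
    rw [Finset.prod_eq_zero (Finset.mem_univ i) hi, zero_smul, zero_smul]

/-- Fubini: the coordinates in `A` may be replaced by those of an independent copy. Exchanging the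
coordinates in `A` between the two copies preserves the product weight. -/
theorem ex_swap {w : α → ℝ} (hw : IsProbWeight w) (A : Set ι) (H : (ι → α) → (ι → α) → E)
    (h₁ : ∀ ω ω₁ ω₂, (∀ i ∈ A, ω₁ i = ω₂ i) → H ω₁ ω = H ω₂ ω)
    (h₂ : ∀ ω ω₁ ω₂, (∀ i ∉ A, ω₁ i = ω₂ i) → H ω ω₁ = H ω ω₂) :
    ex w (fun ω ↦ H ω ω) = ex w (fun ω ↦ ex w (fun ω' ↦ H ω' ω)) := by
  classical
  have hR : ex w (fun ω ↦ ex w (fun ω' ↦ H ω' ω)) =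
      ∑ x : (ι → α) × (ι → α), ((∏ i, w (x.1 i)) * ∏ i, w (x.2 i)) • H x.2 x.1 := by
    rw [Fintype.sum_prod_type]
    simp only [ex, Finset.smul_sum, mul_smul]
  have hL : ex w (fun ω ↦ H ω ω) =
      ∑ x : (ι → α) × (ι → α), ((∏ i, w (x.1 i)) * ∏ i, w (x.2 i)) • H x.1 x.1 := by
    rw [Fintype.sum_prod_type]
    refine Finset.sum_congr rfl fun ω _ ↦ ?_
    dsimp only
    rw [← Finset.sum_smul, ← Finset.mul_sum, sum_prod_weight hw, mul_one]
  rw [hL, hR]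
  let e : (ι → α) × (ι → α) → (ι → α) × (ι → α) := fun x ↦
    (fun i ↦ if i ∈ A then x.2 i else x.1 i, fun i ↦ if i ∈ A then x.1 i else x.2 i)
  have he : Function.Involutive e := by
    intro x
    ext i <;> by_cases hi : i ∈ A <;> simp [e, hi]
  refine Fintype.sum_equiv he.toPerm _ _ fun x ↦ ?_
  simp only [Function.Involutive.coe_toPerm]
  congr 1
  · rw [← Finset.prod_mul_distrib, ← Finset.prod_mul_distrib]
    refine Finset.prod_congr rfl fun i _ ↦ ?_
    by_cases hi : i ∈ A <;> simp [e, hi, mul_comm]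
  · exact (h₁ x.1 x.1 (e x).2 fun i hi ↦ by simp [e, hi]).trans
      (h₂ (e x).2 x.1 (e x).1 fun i hi ↦ by simp [e, hi])

/-- Summing a weight `v` over the coordinate `i` in place of the law `w`. -/
theorem ex_sum_update {w : α → ℝ} (hw : IsProbWeight w) (v : α → ℝ) (i : ι) (h : (ι → α) → E) :
    ex w (fun ω ↦ ∑ a, v a • h (Function.update ω i a)) =
      ∑ ω : ι → α, ((∏ j ∈ Finset.univ.erase i, w (ω j)) * v (ω i)) • h ω := by
  have hL : ex w (fun ω ↦ ∑ a, v a • h (Function.update ω i a)) =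
      ∑ x : (ι → α) × α, ((∏ j, w (x.1 j)) * v x.2) • h (Function.update x.1 i x.2) := by
    rw [Fintype.sum_prod_type]
    simp only [ex, Finset.smul_sum, mul_smul]
  have hR : ∑ ω : ι → α, ((∏ j ∈ Finset.univ.erase i, w (ω j)) * v (ω i)) • h ω =
      ∑ x : (ι → α) × α, (((∏ j ∈ Finset.univ.erase i, w (x.1 j)) * v (x.1 i)) * w x.2) •
        h x.1 := by
    rw [Fintype.sum_prod_type]
    refine Finset.sum_congr rfl fun ω _ ↦ ?_
    dsimp only
    rw [← Finset.sum_smul, ← Finset.mul_sum, hw.sum_eq_one, mul_one]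
  rw [hL, hR]
  let e : (ι → α) × α → (ι → α) × α := fun x ↦ (Function.update x.1 i x.2, x.1 i)
  have he : Function.Involutive e := fun x ↦ by simp [e]
  refine Fintype.sum_equiv he.toPerm _ _ fun x ↦ ?_
  simp only [Function.Involutive.coe_toPerm, e, Function.update_self]
  rw [← Finset.mul_prod_erase Finset.univ _ (Finset.mem_univ i)]
  congr 1
  have : ∏ j ∈ Finset.univ.erase i, w (Function.update x.1 i x.2 j) =
      ∏ j ∈ Finset.univ.erase i, w (x.1 j) :=
    Finset.prod_congr rfl fun j hj ↦ by
      rw [Function.update_of_ne (Finset.ne_of_mem_erase hj)]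
  rw [this]
  ring

/-- Averaging over the coordinate `i` first. -/
theorem ex_update {w : α → ℝ} (hw : IsProbWeight w) (i : ι) (h : (ι → α) → E) :
    ex w h = ex w (fun ω ↦ ∑ a, w a • h (Function.update ω i a)) := by
  rw [ex_sum_update hw]
  refine Finset.sum_congr rfl fun ω _ ↦ ?_
  rw [Finset.prod_erase_mul _ _ (Finset.mem_univ i)]

/-- Reindexing: if `φ` is injective and `T k` carries the law `w` to the law `w'`, then the
coordinates `T k (ω (φ k))` are independent with law `w'`. -/
theorem ex_map [DecidableEq β] {w : α → ℝ} (hw : IsProbWeight w) {w' : β → ℝ} {φ : κ → ι}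
    (hφ : Function.Injective φ) (T : κ → α → β)
    (hT : ∀ k b, ∑ a, (if T k a = b then w a else 0) = w' b) (h : (κ → β) → E) :
    ex w (fun ω : ι → α ↦ h (fun k ↦ T k (ω (φ k)))) = ex w' h := by
  have h1 : ∀ ω : ι → α, (∏ i, w (ω i)) • h (fun k ↦ T k (ω (φ k))) =
      ∑ b : κ → β, ((∏ i, w (ω i)) * ∏ k, (if T k (ω (φ k)) = b k then 1 else 0 : ℝ)) • h b := by
    intro ω
    rw [Finset.sum_eq_single fun k ↦ T k (ω (φ k))]
    · simp
    · intro b _ hb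
      obtain ⟨k, hk⟩ := Function.ne_iff.mp hb
      rw [Finset.prod_eq_zero (Finset.mem_univ k) (if_neg fun h ↦ hk h.symm), mul_zero, zero_smul]
    · simp
  rw [ex, Finset.sum_congr rfl fun ω _ ↦ h1 ω, Finset.sum_comm, ex]
  refine Finset.sum_congr rfl fun b _ ↦ ?_
  rw [← Finset.sum_smul]
  congr 1
  let F : ι → α → ℝ := fun i a ↦
    w a * ∏ k, (if φ k = i then (if T k a = b k then 1 else 0) else 1 : ℝ)
  have h2 : ∀ ω : ι → α, (∏ i, w (ω i)) * ∏ k, (if T k (ω (φ k)) = b k then 1 else 0 : ℝ) =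
      ∏ i, F i (ω i) := by
    intro ω
    simp only [F, Finset.prod_mul_distrib]
    congr 1
    rw [Finset.prod_comm]
    refine Finset.prod_congr rfl fun k _ ↦ ?_
    rw [Finset.prod_ite_eq Finset.univ (φ k)]
    simp
  rw [Finset.sum_congr rfl fun ω _ ↦ h2 ω, ← Fintype.prod_sum]
  symm
  refine Fintype.prod_of_injective φ hφ _ _ (fun i hi ↦ ?_) (fun k ↦ ?_)
  · rw [← hw.sum_eq_one]
    refine Finset.sum_congr rfl fun a _ ↦ ?_
    simp only [F]
    rw [Finset.prod_eq_one, mul_one]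
    intro k _
    rw [if_neg fun h ↦ hi ⟨k, h⟩]
  · rw [← hT k (b k)]
    refine Finset.sum_congr rfl fun a _ ↦ ?_
    simp only [F, hφ.eq_iff]
    rw [Finset.prod_ite_eq' Finset.univ k]
    simp

/-- The law of a single coordinate. -/
theorem ex_apply {w : α → ℝ} (hw : IsProbWeight w) (i : ι) (h : α → E) :
    ex w (fun ω : ι → α ↦ h (ω i)) = ∑ a, w a • h a := by
  rw [ex_update hw i]
  simp only [Function.update_self]
  exact ex_const hw _

end Module

theorem ex_mono {w : α → ℝ} (hw : IsProbWeight w) {g h : (ι → α) → ℝ} (hgh : ∀ ω, g ω ≤ h ω) :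
    ex w g ≤ ex w h :=
  Finset.sum_le_sum fun ω _ ↦ mul_le_mul_of_nonneg_left (hgh ω)
    (Finset.prod_nonneg fun _ _ ↦ hw.nonneg _)

theorem ex_nonneg {w : α → ℝ} (hw : IsProbWeight w) {g : (ι → α) → ℝ} (hg : ∀ ω, 0 ≤ g ω) :
    0 ≤ ex w g :=
  Finset.sum_nonneg fun ω _ ↦ mul_nonneg (Finset.prod_nonneg fun _ _ ↦ hw.nonneg _) (hg ω)

theorem norm_ex_le [NormedAddCommGroup E] [NormedSpace ℝ E] {w : α → ℝ} (hw : IsProbWeight w)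
    (g : (ι → α) → E) : ‖ex w g‖ ≤ ex w (fun ω ↦ ‖g ω‖) := by
  refine (norm_sum_le _ _).trans (Finset.sum_le_sum fun ω _ ↦ ?_)
  rw [norm_smul, Real.norm_of_nonneg (Finset.prod_nonneg fun _ _ ↦ hw.nonneg _), smul_eq_mul]

theorem ex_mul_left {𝔸 : Type*} [Ring 𝔸] [Algebra ℝ 𝔸] (w : α → ℝ) (c : 𝔸) (g : (ι → α) → 𝔸) :
    ex w (fun ω ↦ c * g ω) = c * ex w g := by
  simp only [ex, Finset.mul_sum, mul_smul_comm]

theorem ex_ofReal (w : α → ℝ) (g : (ι → α) → ℝ) :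
    ex w (fun ω ↦ (g ω : ℂ)) = ((ex w g : ℝ) : ℂ) := by
  simp [ex]

/-- Functions of disjoint sets of coordinates are independent. -/
theorem ex_mul_of_disjoint {𝔸 : Type*} [Ring 𝔸] [Algebra ℝ 𝔸] {w : α → ℝ} (hw : IsProbWeight w)
    (A : Set ι) {f g : (ι → α) → 𝔸} (hf : ∀ ω₁ ω₂, (∀ i ∈ A, ω₁ i = ω₂ i) → f ω₁ = f ω₂)
    (hg : ∀ ω₁ ω₂, (∀ i ∉ A, ω₁ i = ω₂ i) → g ω₁ = g ω₂) :
    ex w (fun ω ↦ f ω * g ω) = ex w f * ex w g := by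
  rw [ex_swap hw A (fun ω' ω ↦ f ω' * g ω) (fun ω ω₁ ω₂ h ↦ by simp only [hf _ _ h])
    (fun ω ω₁ ω₂ h ↦ by simp only [hg _ _ h])]
  simp only [ex, Finset.mul_sum, Finset.sum_mul, smul_mul_assoc, mul_smul_comm, Finset.smul_sum]

theorem ex_prod {𝔸 : Type*} [CommRing 𝔸] [Algebra ℝ 𝔸] (w : α → ℝ) (h : ι → α → 𝔸) :
    ex w (fun ω : ι → α ↦ ∏ i, h i (ω i)) = ∏ i, ∑ a, w a • h i a := by
  rw [Fintype.prod_sum]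
  refine Finset.sum_congr rfl fun ω _ ↦ ?_
  rw [← Finset.prod_smul]

end Ex

/-! ### Point probabilities of signed binomial sums -/

/-- The Bernoulli weight with parameter `p`. -/
noncomputable def bern (p : ℝ) (b : Bool) : ℝ := if b then p else 1 - p

theorem isProbWeight_bern {p : ℝ} (h0 : 0 ≤ p) (h1 : p ≤ 1) : IsProbWeight (bern p) where
  nonneg b := by cases b <;> simp [bern, h0, h1]
  sum_eq_one := by simp [bern]

/-- The numerical value of a bit. -/
def bit (b : Bool) : ℝ := if b then 1 else 0

@[simp] theorem bit_true : bit true = 1 := rfl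
@[simp] theorem bit_false : bit false = 0 := rfl

variable {n : ℕ}

/-- The sign of a colour: `1` for red vertices, `-1` for blue ones. -/
def eps (R : Finset (Fin n)) (z : Fin n) : ℤ := if z ∈ R then 1 else -1

theorem eps_eq_or (R : Finset (Fin n)) (z : Fin n) : eps R z = 1 ∨ eps R z = -1 := by
  unfold eps; split_ifs <;> simp

theorem eps_mul_self (R : Finset (Fin n)) (z : Fin n) : (eps R z : ℝ) * eps R z = 1 := by
  rcases eps_eq_or R z with h | h <;> simp [h]

/-- The red neighbours minus the blue neighbours within `Z`, when `y` is the indicator function of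
the set of neighbours. -/
def signedSum (R Z : Finset (Fin n)) (y : Fin n → Bool) : ℤ := ∑ z ∈ Z, if y z then eps R z else 0

theorem signedSum_congr (R : Finset (Fin n)) {Z : Finset (Fin n)} {y y' : Fin n → Bool}
    (h : ∀ z ∈ Z, y z = y' z) : signedSum R Z y = signedSum R Z y' :=
  Finset.sum_congr rfl fun z hz ↦ by rw [h z hz]

theorem signedSum_insert (R : Finset (Fin n)) {Z : Finset (Fin n)} {z : Fin n} (hz : z ∉ Z)
    (y : Fin n → Bool) :
    signedSum R (insert z Z) y = (if y z then eps R z else 0) + signedSum R Z y :=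
  Finset.sum_insert hz

theorem signedSum_update (R : Finset (Fin n)) {Z : Finset (Fin n)} {z : Fin n} (hz : z ∉ Z)
    (y : Fin n → Bool) (b : Bool) :
    signedSum R Z (Function.update y z b) = signedSum R Z y :=
  signedSum_congr R fun x hx ↦ Function.update_of_ne (fun h : x = z ↦ hz (h ▸ hx)) _ _

/-- The probability that the signed sum over `Z` of independent Bernoulli variables is `c`. -/
noncomputable def pointProb (R : Finset (Fin n)) (p : ℝ) (Z : Finset (Fin n)) (c : ℤ) : ℝ :=
  ex (bern p) fun y ↦ if signedSum R Z y = c then (1 : ℝ) else 0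

theorem pointProb_nonneg (R : Finset (Fin n)) {p : ℝ} (h0 : 0 ≤ p) (h1 : p ≤ 1)
    (Z : Finset (Fin n)) (c : ℤ) : 0 ≤ pointProb R p Z c :=
  ex_nonneg (isProbWeight_bern h0 h1) fun _ ↦ by split_ifs <;> simp

theorem pointProb_le_one (R : Finset (Fin n)) {p : ℝ} (h0 : 0 ≤ p) (h1 : p ≤ 1)
    (Z : Finset (Fin n)) (c : ℤ) : pointProb R p Z c ≤ 1 := by
  rw [← ex_const (ι := Fin n) (isProbWeight_bern h0 h1) (1 : ℝ)]
  exact ex_mono (isProbWeight_bern h0 h1) fun _ ↦ by split_ifs <;> simp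

/-- The characteristic function of the signed sum over `Z`. -/
noncomputable def signedCharFun (R : Finset (Fin n)) (p : ℝ) (Z : Finset (Fin n)) (t : ℝ) : ℂ :=
  ex (bern p) fun y ↦ Complex.exp (Complex.I * (t * signedSum R Z y : ℝ))

theorem continuous_signedCharFun (R : Finset (Fin n)) (p : ℝ) (Z : Finset (Fin n)) :
    Continuous (signedCharFun R p Z) := by
  unfold signedCharFun ex
  fun_prop

theorem norm_bernoulli_charFun_le {p : ℝ} (h0 : 0 ≤ p) (h1 : p ≤ 1) {x : ℝ} (hx : |x| ≤ Real.pi) :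
    ‖(1 - p : ℂ) + p * Complex.exp (Complex.I * x)‖ ≤
      Real.exp (-(2 * (p * (1 - p)) / Real.pi ^ 2) * x ^ 2) := by
  have hcos := Real.cos_le_one_sub_mul_cos_sq hx
  have hpq : 0 ≤ p * (1 - p) := mul_nonneg h0 (by linarith)
  have hsq : ‖(1 - p : ℂ) + p * Complex.exp (Complex.I * x)‖ ^ 2 =
      1 - 2 * (p * (1 - p)) * (1 - Real.cos x) := by
    rw [Complex.sq_norm, Complex.normSq_apply, mul_comm Complex.I, Complex.exp_mul_I]
    simp [← Complex.ofReal_cos, ← Complex.ofReal_sin]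
    nlinarith [Real.sin_sq_add_cos_sq x]
  refine abs_le_of_sq_le_sq' ?_ (Real.exp_pos _).le |>.2
  rw [hsq, ← Real.exp_nat_mul]
  refine le_trans ?_ (Real.add_one_le_exp _)
  have : p * (1 - p) * (2 / Real.pi ^ 2 * x ^ 2) ≤ p * (1 - p) * (1 - Real.cos x) :=
    mul_le_mul_of_nonneg_left (by linarith) hpq
  have h2 : ((2 : ℕ) : ℝ) * (-(2 * (p * (1 - p)) / Real.pi ^ 2) * x ^ 2) =
    -2 * (p * (1 - p) * (2 / Real.pi ^ 2 * x ^ 2)) := by push_cast; ring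
  rw [h2]
  linarith

theorem norm_signedCharFun_le (R : Finset (Fin n)) {p : ℝ} (h0 : 0 ≤ p) (h1 : p ≤ 1)
    (Z : Finset (Fin n)) {t : ℝ} (ht : |t| ≤ Real.pi) :
    ‖signedCharFun R p Z t‖ ≤ Real.exp (-(2 * (#Z * (p * (1 - p))) / Real.pi ^ 2) * t ^ 2) := by
  have h : ∀ y : Fin n → Bool, Complex.exp (Complex.I * (t * signedSum R Z y : ℝ)) =
      ∏ z, if z ∈ Z then Complex.exp (Complex.I * (bit (y z) * (eps R z * t) : ℝ)) else 1 := by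
    intro y
    rw [Finset.prod_ite_mem, Finset.univ_inter, ← Complex.exp_sum, ← Finset.mul_sum,
      ← Complex.ofReal_sum]
    congr 3
    rw [signedSum, Int.cast_sum, Finset.mul_sum]
    refine Finset.sum_congr rfl fun z _ ↦ ?_
    cases y z <;> simp [mul_comm]
  rw [signedCharFun]
  simp only [h]
  rw [ex_prod (bern p)
    (fun z b ↦ if z ∈ Z then Complex.exp (Complex.I * (bit b * (eps R z * t) : ℝ)) else 1),
    norm_prod]
  calc _ ≤ ∏ z : Fin n, if z ∈ Z then
          Real.exp (-(2 * (p * (1 - p)) / Real.pi ^ 2) * t ^ 2) else 1 := by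
        refine Finset.prod_le_prod (fun _ _ ↦ norm_nonneg _) fun z _ ↦ ?_
        by_cases hz : z ∈ Z
        · have ha : |(eps R z : ℝ) * t| = |t| := by
            rcases eps_eq_or R z with h | h <;> simp [h]
          have := norm_bernoulli_charFun_le h0 h1 (x := eps R z * t) (by rwa [ha])
          rw [← sq_abs (eps R z * t : ℝ), ha, sq_abs] at this
          simpa [hz, bern, add_comm] using this
        · simp [hz, bern]
    _ = _ := by
        rw [Finset.prod_ite_mem, Finset.univ_inter, Finset.prod_const, ← Real.exp_nat_mul]
        congr 1
        ring

theorem integral_exp_int_mul_I (m : ℤ) :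
    ∫ t in -Real.pi..Real.pi, Complex.exp (Complex.I * (t * m : ℝ)) =
      if m = 0 then 2 * (Real.pi : ℂ) else 0 := by
  split_ifs with h
  · simp [h]; ring
  · have hc : (Complex.I * m : ℂ) ≠ 0 := by simp [h]
    have h1 : ∀ t : ℝ, Complex.exp (Complex.I * (t * m : ℝ)) = Complex.exp (Complex.I * m * t) := by
      intro t; congr 1; push_cast; ring
    simp only [h1]
    rw [integral_exp_mul_complex hc, div_eq_zero_iff]
    left
    rw [sub_eq_zero, Complex.exp_eq_exp_iff_exists_int]
    exact ⟨m, by push_cast; ring⟩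

/-- Fourier inversion for the signed sum. -/
theorem pointProb_eq_integral (R : Finset (Fin n)) (p : ℝ) (Z : Finset (Fin n)) (c : ℤ) :
    (pointProb R p Z c : ℂ) = (2 * Real.pi : ℂ)⁻¹ *
      ∫ t in -Real.pi..Real.pi,
        Complex.exp (-(Complex.I * (t * c : ℝ))) * signedCharFun R p Z t := by
  have hpi : (2 * Real.pi : ℂ) ≠ 0 := by simp [Real.pi_ne_zero]
  have h : ∀ t : ℝ, Complex.exp (-(Complex.I * (t * c : ℝ))) * signedCharFun R p Z t =
      ∑ y : Fin n → Bool, (∏ i, bern p (y i)) •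
        Complex.exp (Complex.I * (t * (signedSum R Z y - c : ℤ) : ℝ)) := by
    intro t
    rw [signedCharFun, ← ex_mul_left]
    refine Finset.sum_congr rfl fun y _ ↦ ?_
    dsimp only
    rw [← Complex.exp_add]
    congr 2
    push_cast; ring
  simp only [h]
  rw [intervalIntegral.integral_finsetSum fun y _ ↦
    (by fun_prop : Continuous _).intervalIntegrable _ _]
  simp only [intervalIntegral.integral_smul, integral_exp_int_mul_I]
  rw [Finset.mul_sum, pointProb, ← ex_ofReal]
  refine Finset.sum_congr rfl fun y _ ↦ ?_
  rw [mul_smul_comm]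
  congr 1
  by_cases hy : signedSum R Z y = c <;> simp [hy, sub_eq_zero]
  field_simp

theorem integral_gaussian_Icc_le {b : ℝ} (hb : 0 < b) (a : ℝ) (ha : 0 ≤ a) :
    ∫ t in -a..a, Real.exp (-b * t ^ 2) ≤ √(Real.pi / b) := by
  rw [intervalIntegral.integral_of_le (by linarith), ← integral_gaussian b]
  exact setIntegral_le_integral (integrable_exp_neg_mul_sq hb)
    (Eventually.of_forall fun _ ↦ (Real.exp_pos _).le)

theorem pointProb_le_of_card_pos (R : Finset (Fin n)) {p : ℝ} (h0 : 0 ≤ p) (h1 : p ≤ 1)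
    (Z : Finset (Fin n)) (hpos : 0 < #Z * (p * (1 - p))) (c : ℤ) :
    pointProb R p Z c ≤ 1 / √(#Z * (p * (1 - p))) := by
  set m : ℝ := #Z * (p * (1 - p)) with hm
  have hpi := Real.pi_pos
  have hb : 0 < 2 * m / Real.pi ^ 2 := by positivity
  have hnorm : pointProb R p Z c ≤ (2 * Real.pi)⁻¹ * √(Real.pi / (2 * m / Real.pi ^ 2)) := by
    calc pointProb R p Z c ≤ ‖(pointProb R p Z c : ℂ)‖ := by
          rw [Complex.norm_real]; exact le_abs_self _
      _ ≤ (2 * Real.pi)⁻¹ *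
            ∫ t in -Real.pi..Real.pi, Real.exp (-(2 * m / Real.pi ^ 2) * t ^ 2) := by
          rw [pointProb_eq_integral, norm_mul]
          have : ‖(2 * Real.pi : ℂ)⁻¹‖ = (2 * Real.pi)⁻¹ := by simp [hpi.le]
          rw [this]
          gcongr
          refine intervalIntegral.norm_integral_le_of_norm_le (by linarith) ?_
            ((by fun_prop : Continuous _).intervalIntegrable _ _)
          refine Eventually.of_forall fun t ht ↦ ?_
          have hexp : ‖Complex.exp (-(Complex.I * (t * c : ℝ)))‖ = 1 := by
            rw [Complex.norm_exp]; simp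
          rw [norm_mul, hexp, one_mul]
          exact norm_signedCharFun_le R h0 h1 Z (abs_le.mpr ⟨ht.1.le, ht.2⟩)
      _ ≤ _ := by
          gcongr
          exact integral_gaussian_Icc_le hb _ hpi.le
  refine hnorm.trans ?_
  rw [inv_mul_le_iff₀ (by positivity), mul_one_div, le_div_iff₀ (by positivity),
    ← Real.sqrt_mul (by positivity), Real.sqrt_le_left (by positivity)]
  field_simp
  nlinarith [Real.pi_lt_four, hpi]

theorem abs_pointProb_sub_le_of_card_pos (R : Finset (Fin n)) {p : ℝ} (h0 : 0 ≤ p) (h1 : p ≤ 1)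
    (Z : Finset (Fin n)) (hpos : 0 < #Z * (p * (1 - p))) (c : ℤ) :
    |pointProb R p Z c - pointProb R p Z (c + 1)| ≤ 2 / (#Z * (p * (1 - p))) := by
  set m : ℝ := #Z * (p * (1 - p)) with hm
  have hpi := Real.pi_pos
  set b := 2 * m / Real.pi ^ 2 with hbd
  have hb : 0 < b := by positivity
  have hnorm : |pointProb R p Z c - pointProb R p Z (c + 1)| ≤
      (2 * Real.pi)⁻¹ * (1 / √b * √(Real.pi / (b / 2))) := by
    calc _ = ‖((pointProb R p Z c : ℂ) - pointProb R p Z (c + 1))‖ := by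
          rw [← Complex.ofReal_sub, Complex.norm_real, Real.norm_eq_abs]
      _ ≤ (2 * Real.pi)⁻¹ * ∫ t in -Real.pi..Real.pi, 1 / √b * Real.exp (-(b / 2) * t ^ 2) := by
          have hc := continuous_signedCharFun R p Z
          rw [pointProb_eq_integral, pointProb_eq_integral, ← mul_sub, norm_mul,
            ← intervalIntegral.integral_sub
              ((by fun_prop : Continuous _).intervalIntegrable _ _)
              ((by fun_prop : Continuous _).intervalIntegrable _ _)]
          have : ‖(2 * Real.pi : ℂ)⁻¹‖ = (2 * Real.pi)⁻¹ := by simp [hpi.le]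
          rw [this]
          gcongr
          refine intervalIntegral.norm_integral_le_of_norm_le (by linarith) ?_
            ((by fun_prop : Continuous _).intervalIntegrable _ _)
          refine Eventually.of_forall fun t ht ↦ ?_
          have hfac : Complex.exp (-(Complex.I * (t * c : ℝ))) * signedCharFun R p Z t -
              Complex.exp (-(Complex.I * (t * (c + 1 : ℤ) : ℝ))) * signedCharFun R p Z t =
              Complex.exp (-(Complex.I * (t * (c + 1 : ℤ) : ℝ))) *
                ((Complex.exp (Complex.I * t) - 1) * signedCharFun R p Z t) := by
            have : Complex.exp (-(Complex.I * (t * c : ℝ))) =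
                Complex.exp (-(Complex.I * (t * (c + 1 : ℤ) : ℝ))) *
                  Complex.exp (Complex.I * t) := by
              rw [← Complex.exp_add]; congr 1; push_cast; ring
            rw [this]; ring
          have hexp : ‖Complex.exp (-(Complex.I * (t * (c + 1 : ℤ) : ℝ)))‖ = 1 := by
            rw [Complex.norm_exp]; simp
          rw [hfac, norm_mul, norm_mul, hexp, one_mul]
          -- The factor `|exp (i t) - 1| ≤ |t|` is absorbed by half of the Gaussian exponent.
          have hx : |t| ≤ 1 / √b * Real.exp (b / 2 * t ^ 2) := by
            rw [one_div, le_inv_mul_iff₀ (by positivity)]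
            refine le_trans ?_ (Real.add_one_le_exp _)
            have : b / 2 * t ^ 2 = (√b * |t|) ^ 2 / 2 := by
              rw [mul_pow, Real.sq_sqrt hb.le, sq_abs]; ring
            rw [this]
            nlinarith [sq_nonneg (√b * |t| - 1)]
          calc _ ≤ |t| * Real.exp (-b * t ^ 2) := by
                refine mul_le_mul ?_ (norm_signedCharFun_le R h0 h1 Z (abs_le.mpr ⟨ht.1.le, ht.2⟩))
                  (norm_nonneg _) (abs_nonneg _)
                have := Real.norm_exp_I_mul_ofReal_sub_one_le (x := t)
                rwa [Real.norm_eq_abs] at this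
            _ ≤ (1 / √b * Real.exp (b / 2 * t ^ 2)) * Real.exp (-b * t ^ 2) := by gcongr
            _ = _ := by
                rw [mul_assoc, ← Real.exp_add]
                congr 2
                ring
      _ ≤ _ := by
          rw [intervalIntegral.integral_const_mul]
          gcongr
          exact integral_gaussian_Icc_le (by positivity) _ hpi.le
  refine hnorm.trans ?_
  have h3 : 1 / √b * √(Real.pi / (b / 2)) = √(2 * Real.pi) / b := by
    rw [show Real.pi / (b / 2) = 2 * Real.pi / b by field_simp,
      Real.sqrt_div (x := 2 * Real.pi) (by positivity), div_mul_div_comm,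
      Real.mul_self_sqrt hb.le, one_mul]
  rw [h3]
  have h4 : √(2 * Real.pi) ≤ 8 / Real.pi := by
    rw [Real.sqrt_le_left (by positivity), div_pow, le_div_iff₀ (by positivity)]
    have : Real.pi < 3.1416 := Real.pi_lt_d4
    nlinarith [pow_le_pow_left₀ hpi.le this.le 3]
  calc (2 * Real.pi)⁻¹ * (√(2 * Real.pi) / b) ≤ (2 * Real.pi)⁻¹ * (8 / Real.pi / b) := by gcongr
    _ = 2 / m := by
        rw [hbd]; field_simp; norm_num

/-- Anticoncentration: omitting at most four vertices, point probabilities are `O(1/σ)`. -/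
theorem pointProb_le (R : Finset (Fin n)) {p : ℝ} (h0 : 0 ≤ p) (h1 : p ≤ 1) {s : ℝ} (hs : 0 < s)
    (hsn : s ^ 2 = n * (p * (1 - p))) (Z : Finset (Fin n)) (hZ : n ≤ #Z + 4) (c : ℤ) :
    pointProb R p Z c ≤ 2 / s := by
  -- For `s < 2` the bound exceeds one; otherwise at least a quarter of the variance is left.
  by_cases hs2 : s < 2
  · exact (pointProb_le_one R h0 h1 Z c).trans (by rw [le_div_iff₀ hs]; linarith)
  · push Not at hs2
    have hn : (n : ℝ) ≤ #Z + 4 := by exact_mod_cast hZ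
    have hpq : p * (1 - p) ≤ 1 / 4 := by nlinarith [sq_nonneg (2 * p - 1)]
    have hpq0 : 0 ≤ p * (1 - p) := mul_nonneg h0 (by linarith)
    have hm : s ^ 2 / 4 ≤ #Z * (p * (1 - p)) := by nlinarith
    refine (pointProb_le_of_card_pos R h0 h1 Z (lt_of_lt_of_le (by positivity) hm) c).trans ?_
    have h2 : s / 2 ≤ √(#Z * (p * (1 - p))) := by
      refine Real.le_sqrt_of_sq_le ?_
      rw [div_pow]; linarith
    calc 1 / √(#Z * (p * (1 - p))) ≤ 1 / (s / 2) := by gcongr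
      _ = 2 / s := by field_simp

/-- Smoothness: omitting at most four vertices, consecutive point probabilities differ by
`O(1/σ²)`. -/
theorem abs_pointProb_sub_le (R : Finset (Fin n)) {p : ℝ} (h0 : 0 ≤ p) (h1 : p ≤ 1) {s : ℝ}
    (hs : 0 < s) (hsn : s ^ 2 = n * (p * (1 - p))) (Z : Finset (Fin n)) (hZ : n ≤ #Z + 4) (c : ℤ) :
    |pointProb R p Z c - pointProb R p Z (c + 1)| ≤ 4 / s ^ 2 := by
  -- For `s < 2` the bound exceeds one; otherwise at least half of the variance is left.
  by_cases hs2 : s ^ 2 < 4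
  · have := pointProb_le_one R h0 h1 Z c
    have := pointProb_le_one R h0 h1 Z (c + 1)
    have := pointProb_nonneg R h0 h1 Z c
    have := pointProb_nonneg R h0 h1 Z (c + 1)
    have h1 : (1 : ℝ) ≤ 4 / s ^ 2 := by rw [le_div_iff₀ (by positivity)]; linarith
    exact le_trans (abs_le.mpr ⟨by linarith, by linarith⟩) h1
  · push Not at hs2
    have hn : (n : ℝ) ≤ #Z + 4 := by exact_mod_cast hZ
    have hpq : p * (1 - p) ≤ 1 / 4 := by nlinarith [sq_nonneg (2 * p - 1)]
    have hpq0 : 0 ≤ p * (1 - p) := mul_nonneg h0 (by linarith)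
    have hpq8 : 4 * (p * (1 - p)) ≤ s ^ 2 / 2 := by linarith
    have hm : s ^ 2 / 2 ≤ #Z * (p * (1 - p)) := by nlinarith
    refine (abs_pointProb_sub_le_of_card_pos R h0 h1 Z
      (lt_of_lt_of_le (by positivity) hm) c).trans ?_
    calc 2 / (#Z * (p * (1 - p))) ≤ 2 / (s ^ 2 / 2) := by gcongr
      _ = 4 / s ^ 2 := by field_simp; norm_num

variable {n : ℕ}

/-! ### The decision of one vertex and its pivotal edges -/

/-- A vertex turns red precisely when its signed neighbour count reaches this threshold. -/
def thr (R : Finset (Fin n)) (u : Fin n) : ℤ := if u ∈ R then 0 else 1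

/-- The indicator that `u` is red after one step, as a function of the indicator function `y` of
its neighbourhood (the value `y u` is ignored). -/
noncomputable def dec (R : Finset (Fin n)) (u : Fin n) (y : Fin n → Bool) : ℝ :=
  if thr R u ≤ signedSum R (Finset.univ.erase u) y then 1 else 0

/-- The value of the signed count of the other neighbours of `u` for which the pair `uv` decides the
new colour of `u`. -/
def pivLevel (R : Finset (Fin n)) (u v : Fin n) : ℤ := thr R u - if v ∈ R then 1 else 0

/-- The indicator that the pair `uv` is pivotal for `u`, as a function of the neighbourhood of `u`;
it depends neither on `y u` nor on `y v`. -/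
noncomputable def piv (R : Finset (Fin n)) (u v : Fin n) (y : Fin n → Bool) : ℝ :=
  if signedSum R ((Finset.univ.erase u).erase v) y = pivLevel R u v then 1 else 0

theorem dec_eq_zero_or_one (R : Finset (Fin n)) (u : Fin n) (y : Fin n → Bool) :
    dec R u y = 0 ∨ dec R u y = 1 := by
  unfold dec; split_ifs <;> simp

theorem piv_nonneg (R : Finset (Fin n)) (u v : Fin n) (y : Fin n → Bool) : 0 ≤ piv R u v y := by
  unfold piv; split_ifs <;> simp

theorem dec_congr (R : Finset (Fin n)) (u : Fin n) {y y' : Fin n → Bool}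
    (h : ∀ z, z ≠ u → y z = y' z) : dec R u y = dec R u y' := by
  unfold dec
  rw [signedSum_congr R fun z hz ↦ h z (Finset.ne_of_mem_erase hz)]

theorem piv_congr (R : Finset (Fin n)) (u v : Fin n) {y y' : Fin n → Bool}
    (h : ∀ z, z ≠ u → z ≠ v → y z = y' z) : piv R u v y = piv R u v y' := by
  unfold piv
  rw [signedSum_congr R fun z hz ↦ h z (Finset.ne_of_mem_erase (Finset.mem_of_mem_erase hz))
    (Finset.ne_of_mem_erase hz)]

theorem piv_update (R : Finset (Fin n)) (u v : Fin n) (y : Fin n → Bool) (b : Bool) :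
    piv R u v (Function.update y v b) = piv R u v y :=
  piv_congr R u v fun _ _ hz ↦ Function.update_of_ne hz _ _

/-- Altering the pair `uv` changes the decision of `u` only if the pair is pivotal, and then in the
direction given by the colour of `v`. -/
theorem dec_sub_dec_update (R : Finset (Fin n)) {u v : Fin n} (huv : u ≠ v) (y : Fin n → Bool)
    (b : Bool) :
    dec R u y - dec R u (Function.update y v b) = (bit (y v) - bit b) * eps R v * piv R u v y := by
  have hv : v ∉ (Finset.univ.erase u).erase v := Finset.notMem_erase _ _
  have hins : insert v ((Finset.univ.erase u).erase v) = Finset.univ.erase u :=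
    Finset.insert_erase (by simp [huv.symm])
  unfold dec piv
  rw [← hins, signedSum_insert R hv, signedSum_insert R hv, hins, signedSum_update R hv]
  simp only [Function.update_self]
  unfold pivLevel
  have key : ∀ S θ : ℤ, ∀ a b : Bool, ((if θ ≤ (if a = true then eps R v else 0) + S then (1 : ℝ)
      else 0) - if θ ≤ (if b = true then eps R v else 0) + S then 1 else 0) =
      (bit a - bit b) * eps R v * if S = θ - (if v ∈ R then 1 else 0) then 1 else 0 := by
    intro S θ a b
    by_cases hR : v ∈ R
    · cases a <;> cases b <;> simp only [eps, hR, if_true, bit] <;> split_ifs <;>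
        first | omega | norm_num
    · cases a <;> cases b <;> simp only [eps, hR, if_false, bit] <;> split_ifs <;>
        first | omega | norm_num
  exact key _ _ _ _

/-- Conditioning on one bit of the signed sum. -/
theorem ex_signedSum_insert (R : Finset (Fin n)) {p : ℝ} (h0 : 0 ≤ p) (h1 : p ≤ 1)
    {Z : Finset (Fin n)} {z : Fin n} (hz : z ∉ Z) (φ : ℤ → ℝ) :
    ex (bern p) (fun y ↦ φ (signedSum R (insert z Z) y)) =
      p * ex (bern p) (fun y ↦ φ (eps R z + signedSum R Z y)) +
        (1 - p) * ex (bern p) (fun y ↦ φ (signedSum R Z y)) := by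
  rw [ex_update (isProbWeight_bern h0 h1) z, ← ex_mul_left, ← ex_mul_left, ← ex_add]
  congr 1
  ext y
  simp [signedSum_insert R hz, signedSum_update R hz, bern]

/-- The probability that the signed sum over `Z` is at least `c`. -/
noncomputable def tailProb (R : Finset (Fin n)) (p : ℝ) (Z : Finset (Fin n)) (c : ℤ) : ℝ :=
  ex (bern p) fun y ↦ if c ≤ signedSum R Z y then (1 : ℝ) else 0

theorem tailProb_nonneg (R : Finset (Fin n)) {p : ℝ} (h0 : 0 ≤ p) (h1 : p ≤ 1)
    (Z : Finset (Fin n)) (c : ℤ) : 0 ≤ tailProb R p Z c :=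
  ex_nonneg (isProbWeight_bern h0 h1) fun _ ↦ by split_ifs <;> simp

theorem tailProb_le_one (R : Finset (Fin n)) {p : ℝ} (h0 : 0 ≤ p) (h1 : p ≤ 1)
    (Z : Finset (Fin n)) (c : ℤ) : tailProb R p Z c ≤ 1 := by
  rw [← ex_const (ι := Fin n) (isProbWeight_bern h0 h1) (1 : ℝ)]
  exact ex_mono (isProbWeight_bern h0 h1) fun _ ↦ by split_ifs <;> simp

theorem tailProb_eq_add (R : Finset (Fin n)) (p : ℝ) (Z : Finset (Fin n)) (c : ℤ) :
    tailProb R p Z c = tailProb R p Z (c + 1) + pointProb R p Z c := by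
  rw [tailProb, tailProb, pointProb, ← ex_add]
  congr 1
  ext y
  split_ifs <;> first | omega | norm_num

theorem pointProb_insert (R : Finset (Fin n)) {p : ℝ} (h0 : 0 ≤ p) (h1 : p ≤ 1)
    {Z : Finset (Fin n)} {z : Fin n} (hz : z ∉ Z) (c : ℤ) :
    pointProb R p (insert z Z) c =
      p * pointProb R p Z (c - eps R z) + (1 - p) * pointProb R p Z c := by
  have := ex_signedSum_insert R h0 h1 hz fun S ↦ if S = c then 1 else 0
  simp only [pointProb, this]
  simp only [add_comm (eps R z), ← eq_sub_iff_add_eq]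

theorem tailProb_insert (R : Finset (Fin n)) {p : ℝ} (h0 : 0 ≤ p) (h1 : p ≤ 1)
    {Z : Finset (Fin n)} {z : Fin n} (hz : z ∉ Z) (c : ℤ) :
    tailProb R p (insert z Z) c =
      p * tailProb R p Z (c - eps R z) + (1 - p) * tailProb R p Z c := by
  have := ex_signedSum_insert R h0 h1 hz fun S ↦ if c ≤ S then 1 else 0
  simp only [tailProb, this]
  simp only [add_comm (eps R z), ← sub_le_iff_le_add]

/-! ### Interpolating between the random graph and independent neighbourhoods -/

/-- The joint law of the two directed copies of a pair: with probability `θ` they are a single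
Bernoulli variable, with probability `1 - θ` two independent ones. -/
noncomputable def tie (p θ : ℝ) (b c : Bool) : ℝ :=
  θ * (if b = c then bern p b else 0) + (1 - θ) * (bern p b * bern p c)

theorem tie_comm (p θ : ℝ) (b c : Bool) : tie p θ b c = tie p θ c b := by
  cases b <;> cases c <;> simp [tie, mul_comm]

/-- The weight `tie` as a weight on functions `Bool → Bool`. -/
noncomputable def tieWeight (p θ : ℝ) (a : Bool → Bool) : ℝ := tie p θ (a false) (a true)

theorem sum_boolArrow {E : Type*} [AddCommMonoid E] (s : Bool) (F : (Bool → Bool) → E) :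
    ∑ a, F a = ∑ b, ∑ c, F (fun d ↦ if d = s then b else c) := by
  rw [← Fintype.sum_prod_type']
  refine Fintype.sum_equiv ⟨fun a ↦ (a s, a (!s)), fun x d ↦ if d = s then x.1 else x.2, ?_, ?_⟩
    _ _ fun a ↦ ?_
  · intro a; ext d; cases d <;> cases s <;> simp
  · rintro ⟨b, c⟩; cases s <;> simp
  · congr 1; ext d; cases d <;> cases s <;> simp

theorem isProbWeight_tieWeight {p θ : ℝ} (h0 : 0 ≤ p) (h1 : p ≤ 1) (hθ0 : 0 ≤ θ) (hθ1 : θ ≤ 1) :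
    IsProbWeight (tieWeight p θ) where
  nonneg a := by
    have h1' : 0 ≤ 1 - p := by linarith
    have hθ' : 0 ≤ 1 - θ := by linarith
    unfold tieWeight tie bern
    cases a false <;> cases a true <;> simp <;> positivity
  sum_eq_one := by
    rw [sum_boolArrow false]
    simp [tieWeight, tie, bern]
    ring

/-- The unordered pair `{u, v}`, encoded as an increasing ordered pair. The coordinates indexed by
decreasing ordered pairs play no role. -/
def pairIdx (u v : Fin n) : Fin n × Fin n := (min u v, max u v)

theorem pairIdx_comm (u v : Fin n) : pairIdx u v = pairIdx v u := by
  simp [pairIdx, min_comm, max_comm]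

theorem pairIdx_eq_iff {u v x y : Fin n} :
    pairIdx u v = pairIdx x y ↔ (u = x ∧ v = y) ∨ (u = y ∧ v = x) := by
  simp only [pairIdx, Prod.mk.injEq]
  constructor
  · rintro ⟨h1, h2⟩
    rcases le_total u v with h | h <;> rcases le_total x y with h' | h' <;> simp_all
  · rintro (⟨rfl, rfl⟩ | ⟨rfl, rfl⟩) <;> simp [min_comm, max_comm]

/-- `entry ω u v` is the bit for the pair `uv` that the vertex `u` sees; the vertex `v` sees
`entry ω v u`. -/
def entry (ω : Fin n × Fin n → Bool → Bool) (u v : Fin n) : Bool :=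
  ω (pairIdx u v) (decide (v < u))

/-- The coordinates that belong to pairs containing `u`. -/
def star (u : Fin n) : Set (Fin n × Fin n) := {i | i.1 = u ∨ i.2 = u}

theorem pairIdx_mem_star {u x y : Fin n} : pairIdx x y ∈ star u ↔ x = u ∨ y = u := by
  rcases le_total x y with h | h <;> simp [pairIdx, star, h, or_comm]

theorem entry_congr {ω₁ ω₂ : Fin n × Fin n → Bool → Bool} {u v : Fin n}
    (h : ω₁ (pairIdx u v) = ω₂ (pairIdx u v)) : entry ω₁ u v = entry ω₂ u v := by
  simp [entry, h]

theorem entry_congr_of_star {ω₁ ω₂ : Fin n × Fin n → Bool → Bool} {u : Fin n}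
    (h : ∀ i ∈ star u, ω₁ i = ω₂ i) : entry ω₁ u = entry ω₂ u :=
  funext fun _ ↦ entry_congr (h _ (pairIdx_mem_star.mpr (Or.inl rfl)))

theorem entry_congr_of_star' {ω₁ ω₂ : Fin n × Fin n → Bool → Bool} {u : Fin n}
    (h : ∀ i ∈ star u, ω₁ i = ω₂ i) (w : Fin n) : entry ω₁ w u = entry ω₂ w u :=
  entry_congr (h _ (pairIdx_mem_star.mpr (Or.inr rfl)))

theorem entry_congr_of_not_star {ω₁ ω₂ : Fin n × Fin n → Bool → Bool} {u : Fin n}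
    (h : ∀ i ∉ star u, ω₁ i = ω₂ i) {x y : Fin n} (hx : x ≠ u) (hy : y ≠ u) :
    entry ω₁ x y = entry ω₂ x y :=
  entry_congr (h _ fun hm ↦ (pairIdx_mem_star.mp hm).elim hx hy)

/-- Pivotality of `uk` for `k` is a function of the pairs that avoid `u`. -/
theorem piv_congr_of_not_star (R : Finset (Fin n)) {ω₁ ω₂ : Fin n × Fin n → Bool → Bool}
    {u : Fin n} (h : ∀ i ∉ star u, ω₁ i = ω₂ i) {k : Fin n} (hk : k ≠ u) :
    piv R k u (entry ω₁ k) = piv R k u (entry ω₂ k) :=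
  piv_congr R k u fun _ _ hz ↦ entry_congr_of_not_star h hk hz

theorem sum_tieWeight_ite {p θ : ℝ} (s b : Bool) :
    ∑ a : Bool → Bool, (if a s = b then tieWeight p θ a else 0) = bern p b := by
  rw [sum_boolArrow false]
  cases s <;> cases b <;> simp [tieWeight, tie, bern] <;> ring

section Model

variable {p θ : ℝ} (h0 : 0 ≤ p) (h1 : p ≤ 1) (hθ0 : 0 ≤ θ) (hθ1 : θ ≤ 1)
variable {E : Type*} [AddCommGroup E] [Module ℝ E]

include h0 h1 hθ0 hθ1

/-- Whatever `θ`, each vertex sees independent Bernoulli bits. -/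
theorem ex_row (u : Fin n) (h : (Fin n → Bool) → E) :
    ex (tieWeight p θ) (fun ω ↦ h (entry ω u)) = ex (bern p) h :=
  ex_map (isProbWeight_tieWeight h0 h1 hθ0 hθ1) (φ := pairIdx u)
    (fun x y hxy ↦ by rcases pairIdx_eq_iff.mp hxy with h | h <;> grind)
    (fun v a ↦ a (decide (v < u))) (fun _ _ ↦ sum_tieWeight_ite _ _) h

/-- The bits with which the other vertices see `u` are independent Bernoulli bits. -/
theorem ex_col (u : Fin n) (h : (Fin n → Bool) → E) :
    ex (tieWeight p θ) (fun ω ↦ h (fun w ↦ entry ω w u)) = ex (bern p) h :=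
  ex_map (isProbWeight_tieWeight h0 h1 hθ0 hθ1) (φ := fun w ↦ pairIdx w u)
    (fun x y hxy ↦ by rcases pairIdx_eq_iff.mp hxy with h | h <;> grind)
    (fun v a ↦ a (decide (u < v))) (fun _ _ ↦ sum_tieWeight_ite _ _) h

end Model

/-- The configuration `ω` with the bit of `uv` seen by `u` set to `b`, and the one seen by `v` set
to `c`. -/
def setPair (ω : Fin n × Fin n → Bool → Bool) (u v : Fin n) (b c : Bool) :
    Fin n × Fin n → Bool → Bool :=
  Function.update ω (pairIdx u v) fun d ↦ if d = decide (v < u) then b else c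

theorem entry_setPair_left (ω : Fin n × Fin n → Bool → Bool) (u v : Fin n) (b c : Bool) :
    entry (setPair ω u v b c) u = Function.update (entry ω u) v b := by
  ext z
  by_cases hz : z = v
  · subst hz; simp [entry, setPair]
  · rw [Function.update_of_ne hz]
    refine entry_congr (Function.update_of_ne (fun h ↦ ?_) _ _)
    rcases pairIdx_eq_iff.mp h with h | h <;> grind

theorem entry_setPair_right (ω : Fin n × Fin n → Bool → Bool) {u v : Fin n} (huv : u ≠ v)
    (b c : Bool) : entry (setPair ω u v b c) v = Function.update (entry ω v) u c := by
  ext z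
  by_cases hz : z = u
  · subst hz
    rcases lt_or_gt_of_ne huv with h | h
    · simp [entry, setPair, pairIdx_comm v, h, h.not_gt]
    · simp [entry, setPair, pairIdx_comm v, h, h.not_gt]
  · rw [Function.update_of_ne hz]
    refine entry_congr (Function.update_of_ne (fun h ↦ ?_) _ _)
    rcases pairIdx_eq_iff.mp h with h | h <;> grind

theorem entry_setPair_of_ne (ω : Fin n × Fin n → Bool → Bool) {u v w : Fin n} (hu : w ≠ u)
    (hv : w ≠ v) (b c : Bool) : entry (setPair ω u v b c) w = entry ω w := by
  ext z
  rw [entry_congr]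
  refine Function.update_of_ne (fun h ↦ ?_) _ _
  rcases pairIdx_eq_iff.mp h with h | h <;> grind

theorem sum_tieWeight_update {E : Type*} [AddCommGroup E] [Module ℝ E] (W : Bool → Bool → ℝ)
    (hW : ∀ b c, W b c = W c b) (u v : Fin n)
    (h : (Fin n × Fin n → Bool → Bool) → E) (ω : Fin n × Fin n → Bool → Bool) :
    ∑ a : Bool → Bool, W (a false) (a true) • h (Function.update ω (pairIdx u v) a) =
      ∑ b, ∑ c, W b c • h (setPair ω u v b c) := by
  rw [sum_boolArrow (decide (v < u))]
  refine Finset.sum_congr rfl fun b _ ↦ Finset.sum_congr rfl fun c _ ↦ ?_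
  unfold setPair
  congr 1
  cases decide (v < u) <;> simp [hW b c]

section Model

variable {p θ : ℝ} (h0 : 0 ≤ p) (h1 : p ≤ 1) (hθ0 : 0 ≤ θ) (hθ1 : θ ≤ 1)

include h0 h1 hθ0 hθ1

theorem ex_setPair {E : Type*} [AddCommGroup E] [Module ℝ E] (u v : Fin n)
    (h : (Fin n × Fin n → Bool → Bool) → E) :
    ex (tieWeight p θ) h =
      ex (tieWeight p θ) fun ω ↦ ∑ b, ∑ c, tie p θ b c • h (setPair ω u v b c) := by
  rw [ex_update (isProbWeight_tieWeight h0 h1 hθ0 hθ1) (pairIdx u v)]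
  congr 1
  ext ω
  exact sum_tieWeight_update (tie p θ) (tie_comm p θ) u v h ω

/-- Correlating with the centred bit `entry ω w u` amounts to differentiating in `entry ω u w`. -/
theorem ex_mul_centred {u w : Fin n} (huw : u ≠ w) (h : (Fin n → Bool) → ℝ)
    (G : (Fin n × Fin n → Bool → Bool) → ℝ) (hG : ∀ ω b c, G (setPair ω u w b c) = G ω) :
    ex (tieWeight p θ) (fun ω ↦ h (entry ω u) * (bit (entry ω w u) - p) * G ω) =
      θ * (p * (1 - p)) * ex (tieWeight p θ) (fun ω ↦
        (h (Function.update (entry ω u) w true) - h (Function.update (entry ω u) w false)) *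
          G ω) := by
  rw [ex_setPair h0 h1 hθ0 hθ1 u w, ← ex_mul_left]
  congr 1
  ext ω
  simp only [entry_setPair_left, entry_setPair_right ω huw, hG, Function.update_self,
    Fintype.sum_bool, tie, bern, smul_eq_mul, bit]
  simp
  ring

theorem ex_bit_sub (u w : Fin n) :
    ex (tieWeight p θ) (fun ω : Fin n × Fin n → Bool → Bool ↦ bit (entry ω w u) - p) = 0 := by
  rw [ex_col h0 h1 hθ0 hθ1 u (fun y ↦ bit (y w) - p),
    ex_apply (isProbWeight_bern h0 h1) w (fun b ↦ bit b - p)]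
  simp [bern]
  ring

end Model

/-- The probability that the pair `uv` is pivotal for `u`. -/
noncomputable def pivProb (R : Finset (Fin n)) (p : ℝ) (u v : Fin n) : ℝ := ex (bern p) (piv R u v)

/-- The probability that `u` is red after one step. -/
noncomputable def decProb (R : Finset (Fin n)) (p : ℝ) (u : Fin n) : ℝ := ex (bern p) (dec R u)

section Model

variable {p θ : ℝ} (h0 : 0 ≤ p) (h1 : p ≤ 1) (hθ0 : 0 ≤ θ) (hθ1 : θ ≤ 1)

include h0 h1 hθ0 hθ1

/-- Two vertices see a single common pair, so their decisions are correlated only through the event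
that this pair is pivotal for both. -/
theorem ex_dec_mul_dec (R : Finset (Fin n)) {u v : Fin n} (huv : u ≠ v) :
    ex (tieWeight p θ) (fun ω ↦ dec R u (entry ω u) * dec R v (entry ω v)) =
      decProb R p u * decProb R p v +
        θ * (p * (1 - p)) * (eps R u * eps R v * (pivProb R p u v * pivProb R p v u)) := by
  have hw := isProbWeight_tieWeight h0 h1 hθ0 hθ1
  set B : (Fin n × Fin n → Bool → Bool) → ℝ := fun ω ↦ eps R u * piv R v u (entry ω v) with hB
  set A : (Fin n × Fin n → Bool → Bool) → ℝ := fun ω ↦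
    dec R v (Function.update (entry ω v) u false) + p * B ω with hA
  have hdec : ∀ ω, dec R v (entry ω v) = A ω + (bit (entry ω v u) - p) * B ω := by
    intro ω
    have := dec_sub_dec_update R huv.symm (entry ω v) false
    simp only [hA, hB, bit_false, sub_zero] at this ⊢
    linarith
  have hBstar : ∀ ω₁ ω₂ : Fin n × Fin n → Bool → Bool, (∀ i ∉ star u, ω₁ i = ω₂ i) →
      B ω₁ = B ω₂ := by
    intro ω₁ ω₂ h
    simp only [hB, piv_congr_of_not_star R h huv.symm]
  have hAstar : ∀ ω₁ ω₂ : Fin n × Fin n → Bool → Bool, (∀ i ∉ star u, ω₁ i = ω₂ i) →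
      A ω₁ = A ω₂ := by
    intro ω₁ ω₂ h
    simp only [hA, hBstar _ _ h]
    congr 1
    refine dec_congr R v fun z _ ↦ ?_
    by_cases hz : z = u
    · subst hz; simp
    · simp [hz, entry_congr_of_not_star h huv.symm hz]
  have hrow : ∀ ω₁ ω₂ : Fin n × Fin n → Bool → Bool, (∀ i ∈ star u, ω₁ i = ω₂ i) →
      dec R u (entry ω₁ u) = dec R u (entry ω₂ u) := by
    intro ω₁ ω₂ h
    rw [entry_congr_of_star h]
  have hEA : ex (tieWeight p θ) A = decProb R p v := by
    have h3 : ex (tieWeight p θ) (fun ω ↦ (bit (entry ω v u) - p) * B ω) = 0 := by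
      rw [ex_mul_of_disjoint hw (star u) (fun ω₁ ω₂ h ↦ by rw [entry_congr_of_star' h]) hBstar,
        ex_bit_sub h0 h1 hθ0 hθ1, zero_mul]
    rw [decProb, ← ex_row h0 h1 hθ0 hθ1 v (dec R v)]
    simp only [hdec]
    rw [ex_add _ A, h3, add_zero]
  have h1' : ex (tieWeight p θ) (fun ω ↦ dec R u (entry ω u) * A ω) =
      decProb R p u * decProb R p v := by
    rw [ex_mul_of_disjoint hw (star u) hrow hAstar, hEA, ex_row h0 h1 hθ0 hθ1 u (dec R u),
      ← decProb]
  have h2' : ex (tieWeight p θ) (fun ω ↦ dec R u (entry ω u) * (bit (entry ω v u) - p) * B ω) =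
      θ * (p * (1 - p)) * (eps R u * eps R v * (pivProb R p u v * pivProb R p v u)) := by
    rw [ex_mul_centred h0 h1 hθ0 hθ1 huv (dec R u) B fun ω b c ↦ by
      simp only [hB, entry_setPair_right ω huv, piv_update]]
    congr 1
    have : ∀ ω : Fin n × Fin n → Bool → Bool,
        (dec R u (Function.update (entry ω u) v true) -
          dec R u (Function.update (entry ω u) v false)) * B ω =
        (eps R u * eps R v : ℝ) * (piv R u v (entry ω u) * piv R v u (entry ω v)) := by
      intro ω
      have := dec_sub_dec_update R huv (Function.update (entry ω u) v true) false
      rw [Function.update_idem, Function.update_self, piv_update] at this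
      rw [this, hB]
      simp
      ring
    simp only [this]
    rw [ex_mul_left, ex_mul_of_disjoint hw (star u) (fun ω₁ ω₂ h ↦ by rw [entry_congr_of_star h])
      (fun ω₁ ω₂ h ↦ piv_congr_of_not_star R h huv.symm), ex_row h0 h1 hθ0 hθ1 u (piv R u v),
      ex_row h0 h1 hθ0 hθ1 v (piv R v u), pivProb, pivProb]
  simp only [hdec, mul_add, ← mul_assoc]
  rw [ex_add, h1', h2']
  ring

end Model

/-! ### The variance -/

/-- The number of red vertices after one step, as a function of the directed bits. -/
noncomputable def count (R : Finset (Fin n)) (ω : Fin n × Fin n → Bool → Bool) : ℝ :=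
  ∑ u, dec R u (entry ω u)

/-- The signed sum over ordered pairs `(u, v)` of the probabilities that `uv` is pivotal for both
ends. -/
noncomputable def pairSum (R : Finset (Fin n)) (p : ℝ) : ℝ :=
  ∑ u, ∑ v ∈ Finset.univ.erase u, (eps R u * eps R v * (pivProb R p u v * pivProb R p v u) : ℝ)

section Model

variable {p θ : ℝ} (h0 : 0 ≤ p) (h1 : p ≤ 1) (hθ0 : 0 ≤ θ) (hθ1 : θ ≤ 1)

include h0 h1 hθ0 hθ1

theorem ex_count (R : Finset (Fin n)) :
    ex (tieWeight p θ) (count R) = ∑ u, decProb R p u := by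
  unfold count
  rw [ex_sum]
  exact Finset.sum_congr rfl fun u _ ↦ ex_row h0 h1 hθ0 hθ1 u (dec R u)

theorem ex_count_sq_sub (R : Finset (Fin n)) :
    ex (tieWeight p θ) (fun ω ↦ count R ω ^ 2) - (∑ u, decProb R p u) ^ 2 =
      ∑ u, decProb R p u * (1 - decProb R p u) + θ * (p * (1 - p) * pairSum R p) := by
  have h : ∀ ω : Fin n × Fin n → Bool → Bool, count R ω ^ 2 =
      ∑ u, (dec R u (entry ω u) +
        ∑ v ∈ Finset.univ.erase u, dec R u (entry ω u) * dec R v (entry ω v)) := by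
    intro ω
    rw [sq, count, Finset.sum_mul_sum]
    refine Finset.sum_congr rfl fun u _ ↦ ?_
    rw [← Finset.add_sum_erase _ _ (Finset.mem_univ u)]
    congr 1
    rcases dec_eq_zero_or_one R u (entry ω u) with h | h <;> simp [h]
  have h' : (∑ u, decProb R p u) ^ 2 = ∑ u, (decProb R p u * decProb R p u +
      ∑ v ∈ Finset.univ.erase u, decProb R p u * decProb R p v) := by
    rw [sq, Finset.sum_mul_sum]
    refine Finset.sum_congr rfl fun u _ ↦ ?_
    rw [← Finset.add_sum_erase _ _ (Finset.mem_univ u)]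
  simp only [h]
  rw [ex_sum, h', pairSum, Finset.mul_sum, Finset.mul_sum, ← Finset.sum_sub_distrib,
    ← Finset.sum_add_distrib]
  refine Finset.sum_congr rfl fun u _ ↦ ?_
  rw [ex_add, ex_sum, ex_row h0 h1 hθ0 hθ1 u (dec R u), ← decProb, Finset.mul_sum, Finset.mul_sum]
  rw [Finset.sum_congr rfl fun v hv ↦
      ex_dec_mul_dec h0 h1 hθ0 hθ1 R (Finset.ne_of_mem_erase hv).symm,
    Finset.sum_add_distrib]
  simp only [mul_assoc]
  ring

end Model

section Bounds

variable {p s : ℝ} (h0 : 0 ≤ p) (h1 : p ≤ 1) (hs : 0 < s) (hsn : s ^ 2 = n * (p * (1 - p)))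

include h0 h1 hs hsn

theorem abs_pointProb_sub_le' (R Z : Finset (Fin n)) (hZ : n ≤ #Z + 4) {c d : ℤ}
    (hcd : |c - d| ≤ 1) : |pointProb R p Z c - pointProb R p Z d| ≤ 4 / s ^ 2 := by
  have h : d = c ∨ d = c + 1 ∨ c = d + 1 := by grind
  rcases h with rfl | rfl | rfl
  · simp; positivity
  · exact abs_pointProb_sub_le R h0 h1 hs hsn Z hZ c
  · rw [abs_sub_comm]
    exact abs_pointProb_sub_le R h0 h1 hs hsn Z hZ d

theorem abs_pointProb_insert_sub_le (R : Finset (Fin n)) {Z : Finset (Fin n)} {z : Fin n}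
    (hz : z ∉ Z) (hZ : n ≤ #Z + 4) (c : ℤ) :
    |pointProb R p (insert z Z) c - pointProb R p Z c| ≤ 4 / s ^ 2 := by
  have h := abs_pointProb_sub_le' h0 h1 hs hsn R Z hZ (c := c - eps R z) (d := c) (by
    rcases eps_eq_or R z with h | h <;> simp [h])
  rw [pointProb_insert R h0 h1 hz, show ∀ a b : ℝ, p * a + (1 - p) * b - b = p * (a - b) by
    intros; ring, abs_mul, abs_of_nonneg h0]
  nlinarith [abs_nonneg (pointProb R p Z (c - eps R z) - pointProb R p Z c)]

omit hs hsn in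
theorem pivProb_nonneg (R : Finset (Fin n)) (u v : Fin n) : 0 ≤ pivProb R p u v :=
  ex_nonneg (isProbWeight_bern h0 h1) (piv_nonneg R u v)

theorem pivProb_le (R : Finset (Fin n)) (u v : Fin n) : pivProb R p u v ≤ 2 / s := by
  refine pointProb_le R h0 h1 hs hsn ((Finset.univ.erase u).erase v) ?_ (pivLevel R u v)
  have h1 := Finset.pred_card_le_card_erase (s := Finset.univ) (a := u)
  have h2 := Finset.pred_card_le_card_erase (s := Finset.univ.erase u) (a := v)
  rw [Finset.card_univ, Fintype.card_fin] at h1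
  omega

/-- The pivotality probabilities of all ordered pairs nearly agree. -/
theorem abs_pivProb_sub_le (R : Finset (Fin n)) {u v : Fin n} (huv : u ≠ v) :
    |pivProb R p u v - pointProb R p Finset.univ 0| ≤ 12 / s ^ 2 := by
  set Z := (Finset.univ.erase u).erase v with hZ
  have hv : insert v Z = Finset.univ.erase u := Finset.insert_erase (by simp [huv.symm])
  have hu : insert u (Finset.univ.erase u) = Finset.univ := Finset.insert_erase (by simp)
  have c1 := Finset.pred_card_le_card_erase (s := Finset.univ) (a := u)
  have c2 := Finset.pred_card_le_card_erase (s := Finset.univ.erase u) (a := v)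
  rw [Finset.card_univ, Fintype.card_fin] at c1
  have c3 := c2
  rw [← hZ] at c3
  have a1 := abs_pointProb_insert_sub_le h0 h1 hs hsn R (Finset.notMem_erase u Finset.univ)
    (by omega) 0
  have a2 := abs_pointProb_insert_sub_le h0 h1 hs hsn R
    (Finset.notMem_erase v (Finset.univ.erase u)) (by omega) 0
  have a3 := abs_pointProb_sub_le' h0 h1 hs hsn R Z (by omega) (c := pivLevel R u v) (d := 0)
    (by unfold pivLevel thr; split_ifs <;> simp)
  rw [hu] at a1
  rw [hv] at a2
  have hp : pivProb R p u v = pointProb R p Z (pivLevel R u v) := rfl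
  rw [hp]
  have h12 : 12 / s ^ 2 = 4 / s ^ 2 + 4 / s ^ 2 + 4 / s ^ 2 := by ring
  rw [h12]
  rw [abs_le] at *
  constructor <;> linarith [a1.1, a1.2, a2.1, a2.2, a3.1, a3.2]

omit h0 h1 hs hsn in
theorem abs_sum_eps (R : Finset (Fin n)) : |∑ u, (eps R u : ℝ)| = imbalance R := by
  rw [imbalance]
  congr 1
  have : ∀ u, (eps R u : ℝ) = (if u ∈ R then 1 else 0) - if u ∈ Rᶜ then 1 else 0 := by
    intro u
    by_cases h : u ∈ R <;> simp [eps, h]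
  simp [this, -Finset.mem_compl]

omit h0 h1 hs hsn in
theorem imbalance_nonneg (R : Finset (Fin n)) : 0 ≤ imbalance R := abs_nonneg _

omit h0 h1 hs hsn in
theorem imbalance_le (R : Finset (Fin n)) : imbalance R ≤ n := by
  rw [← abs_sum_eps]
  refine (Finset.abs_sum_le_sum_abs _ _).trans ?_
  have : ∀ u, |(eps R u : ℝ)| = 1 := fun u ↦ by
    rcases eps_eq_or R u with h | h <;> simp [h]
  simp [this]

omit h0 h1 in
theorem card_pos_of_sigma : (0 : ℝ) < n := by
  rcases Nat.eq_zero_or_pos n with h | h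
  · subst h
    simp at hsn
    exact absurd hsn hs.ne'
  · exact_mod_cast h

omit h0 h1 in
theorem sigma_sq_le : s ^ 2 ≤ n / 4 := by
  have := card_pos_of_sigma hs hsn
  rw [hsn]
  nlinarith [sq_nonneg (2 * p - 1)]

omit h0 h1 in
theorem sigma_le : s ≤ n := by
  have h : (1 : ℝ) ≤ n := by
    exact_mod_cast (by exact_mod_cast card_pos_of_sigma hs hsn : 0 < n)
  refine abs_le_of_sq_le_sq' ?_ (by linarith) |>.2
  nlinarith [sigma_sq_le hs hsn]

/-- The covariances cancel between monochromatic and bichromatic pairs. -/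
theorem abs_pairSum_le (R : Finset (Fin n)) :
    p * (1 - p) * |pairSum R p| ≤ 4 * imbalance R + 52 * (n / s) := by
  have hn := card_pos_of_sigma hs hsn
  have hpq : p * (1 - p) = s ^ 2 / n := by rw [hsn]; field_simp
  set κ := pointProb R p Finset.univ 0 with hκ
  have hκ0 : 0 ≤ κ := pointProb_nonneg R h0 h1 _ _
  have hκ1 : κ ≤ 2 / s := pointProb_le R h0 h1 hs hsn Finset.univ (by simp) 0
  have hterm : ∀ u, ∀ v ∈ Finset.univ.erase u,
      |(eps R u * eps R v * (pivProb R p u v * pivProb R p v u) : ℝ) - eps R u * eps R v * κ ^ 2| ≤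
        48 / s ^ 3 := by
    intro u v hv
    have huv := (Finset.ne_of_mem_erase hv).symm
    have he : |(eps R u * eps R v : ℝ)| = 1 := by
      rcases eps_eq_or R u with h | h <;> rcases eps_eq_or R v with h' | h' <;> simp [h, h']
    rw [← mul_sub, abs_mul, he, one_mul]
    have e1 := abs_pivProb_sub_le h0 h1 hs hsn R huv
    have e2 := abs_pivProb_sub_le h0 h1 hs hsn R huv.symm
    have b1 := pivProb_le h0 h1 hs hsn R u v
    have b0 := pivProb_nonneg h0 h1 R u v
    calc |pivProb R p u v * pivProb R p v u - κ ^ 2|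
        = |pivProb R p u v * (pivProb R p v u - κ) + κ * (pivProb R p u v - κ)| := by
          congr 1; ring
      _ ≤ pivProb R p u v * |pivProb R p v u - κ| + κ * |pivProb R p u v - κ| := by
          refine (abs_add_le _ _).trans ?_
          rw [abs_mul, abs_mul, abs_of_nonneg b0, abs_of_nonneg hκ0]
      _ ≤ 2 / s * (12 / s ^ 2) + 2 / s * (12 / s ^ 2) := by gcongr
      _ = 48 / s ^ 3 := by field_simp; norm_num
  have hmain : ∑ u, ∑ v ∈ Finset.univ.erase u, ((eps R u * eps R v * κ ^ 2 : ℝ)) =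
      κ ^ 2 * ((∑ u, (eps R u : ℝ)) ^ 2 - n) := by
    have h2 : (∑ u, (eps R u : ℝ)) ^ 2 - n = ∑ u, ∑ v ∈ Finset.univ.erase u,
        (eps R u * eps R v : ℝ) := by
      rw [sq, Finset.sum_mul_sum]
      have : (n : ℝ) = ∑ _u : Fin n, (1 : ℝ) := by simp
      rw [this, ← Finset.sum_sub_distrib]
      refine Finset.sum_congr rfl fun u _ ↦ ?_
      rw [← Finset.add_sum_erase _ _ (Finset.mem_univ u), eps_mul_self]
      ring
    rw [h2]
    simp only [Finset.mul_sum]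
    refine Finset.sum_congr rfl fun u _ ↦ Finset.sum_congr rfl fun v _ ↦ by ring
  have hdiff : |pairSum R p - κ ^ 2 * ((∑ u, (eps R u : ℝ)) ^ 2 - n)| ≤ n ^ 2 * (48 / s ^ 3) := by
    rw [← hmain, pairSum, ← Finset.sum_sub_distrib]
    calc _ ≤ ∑ _u : Fin n, ((n : ℝ) * (48 / s ^ 3)) := by
          refine (Finset.abs_sum_le_sum_abs _ _).trans (Finset.sum_le_sum fun u _ ↦ ?_)
          rw [← Finset.sum_sub_distrib]
          refine (Finset.abs_sum_le_sum_abs _ _).trans ?_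
          refine (Finset.sum_le_sum (hterm u)).trans ?_
          rw [Finset.sum_const, nsmul_eq_mul]
          gcongr
          simp
      _ = _ := by simp; ring
  have hsq : |(∑ u, (eps R u : ℝ)) ^ 2 - n| ≤ n * imbalance R + n := by
    rw [← sq_abs, abs_sum_eps]
    have := imbalance_le R
    have := imbalance_nonneg R
    refine (abs_sub _ _).trans ?_
    rw [abs_of_nonneg (by positivity), abs_of_nonneg hn.le]
    nlinarith
  have hκ2 : κ ^ 2 ≤ 4 / s ^ 2 := by
    calc κ ^ 2 ≤ (2 / s) ^ 2 := by gcongr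
      _ = 4 / s ^ 2 := by ring
  have htot : |pairSum R p| ≤ 4 / s ^ 2 * (n * imbalance R + n) + n ^ 2 * (48 / s ^ 3) := by
    have h3 : |κ ^ 2 * ((∑ u, (eps R u : ℝ)) ^ 2 - n)| ≤ 4 / s ^ 2 * (n * imbalance R + n) := by
      rw [abs_mul, abs_of_nonneg (by positivity)]
      gcongr
    calc |pairSum R p| = |κ ^ 2 * ((∑ u, (eps R u : ℝ)) ^ 2 - n) +
          (pairSum R p - κ ^ 2 * ((∑ u, (eps R u : ℝ)) ^ 2 - n))| := by congr 1; ring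
      _ ≤ _ := (abs_add_le _ _).trans (add_le_add h3 hdiff)
  have h1s : 1 ≤ n / s := by rw [le_div_iff₀ hs]; linarith [sigma_le hs hsn]
  calc p * (1 - p) * |pairSum R p| ≤ s ^ 2 / n *
        (4 / s ^ 2 * (n * imbalance R + n) + n ^ 2 * (48 / s ^ 3)) := by rw [hpq]; gcongr
    _ = 4 * imbalance R + 4 + 48 * (n / s) := by field_simp
    _ ≤ _ := by linarith

theorem abs_tailProb_univ_sub_le (R : Finset (Fin n)) (u : Fin n) (c : ℤ) :
    |tailProb R p (Finset.univ.erase u) c - tailProb R p Finset.univ c| ≤ 2 / s := by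
  have c1 := Finset.pred_card_le_card_erase (s := Finset.univ) (a := u)
  rw [Finset.card_univ, Fintype.card_fin] at c1
  have hb : ∀ c, pointProb R p (Finset.univ.erase u) c ≤ 2 / s := fun c ↦
    pointProb_le R h0 h1 hs hsn _ (by omega) c
  have hb0 : ∀ c, 0 ≤ pointProb R p (Finset.univ.erase u) c := fun c ↦ pointProb_nonneg R h0 h1 _ c
  have h := tailProb_insert R h0 h1 (Finset.notMem_erase u Finset.univ) c
  rw [Finset.insert_erase (Finset.mem_univ u)] at h
  rw [h]
  rcases eps_eq_or R u with he | he
  · have := tailProb_eq_add R p (Finset.univ.erase u) (c - 1)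
    rw [sub_add_cancel] at this
    rw [he, this, abs_le]
    constructor <;> nlinarith [hb (c - 1), hb0 (c - 1)]
  · have := tailProb_eq_add R p (Finset.univ.erase u) c
    rw [he, this, sub_neg_eq_add, abs_le]
    constructor <;> nlinarith [hb c, hb0 c]

/-- Up to `O(1/σ)`, every vertex turns red with the probability that the signed sum over all
vertices is non-negative, equivalently positive. -/
theorem abs_decProb_mul_sub_le (R : Finset (Fin n)) (u : Fin n) :
    |decProb R p u * (1 - decProb R p u) -
      tailProb R p Finset.univ 0 * (1 - tailProb R p Finset.univ 1)| ≤ 8 / s := by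
  have hd : decProb R p u = tailProb R p (Finset.univ.erase u) (thr R u) := rfl
  have e0 := abs_tailProb_univ_sub_le h0 h1 hs hsn R u 0
  have e1 := abs_tailProb_univ_sub_le h0 h1 hs hsn R u 1
  have hp := tailProb_eq_add R p Finset.univ 0
  have hb := pointProb_le R h0 h1 hs hsn Finset.univ (by simp) 0
  have hb0 := pointProb_nonneg R h0 h1 Finset.univ 0
  rw [zero_add] at hp
  set T0 := tailProb R p Finset.univ 0
  set T1 := tailProb R p Finset.univ 1
  have hs4 : 4 / s = 2 / s + 2 / s := by ring
  have hq : |decProb R p u - T0| ≤ 4 / s ∧ |decProb R p u - T1| ≤ 4 / s := by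
    rw [hd]
    unfold thr
    rw [hs4]
    rw [abs_le] at e0 e1
    split_ifs
    · constructor <;> rw [abs_le] <;> constructor <;> linarith [e0.1, e0.2]
    · constructor <;> rw [abs_le] <;> constructor <;> linarith [e1.1, e1.2]
  have hq0 : 0 ≤ decProb R p u := tailProb_nonneg R h0 h1 _ _
  have hq1 : decProb R p u ≤ 1 := tailProb_le_one R h0 h1 _ _
  have ht0 : 0 ≤ T0 := tailProb_nonneg R h0 h1 _ _
  have ht1 : T0 ≤ 1 := tailProb_le_one R h0 h1 _ _
  calc _ = |(decProb R p u - T0) * (1 - decProb R p u) - T0 * (decProb R p u - T1)| := by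
        congr 1; ring
    _ ≤ |decProb R p u - T0| * (1 - decProb R p u) + T0 * |decProb R p u - T1| := by
        refine (abs_sub _ _).trans ?_
        rw [abs_mul, abs_mul, abs_of_nonneg ht0, abs_of_nonneg (sub_nonneg.mpr hq1)]
    _ ≤ 4 / s * 1 + 1 * (4 / s) := by
        have := mul_le_mul hq.1 (by linarith : 1 - decProb R p u ≤ 1) (by linarith) (by positivity)
        have := mul_le_mul ht1 hq.2 (abs_nonneg _) zero_le_one
        linarith
    _ = 8 / s := by ring

theorem abs_sum_decProb_sub_le (R : Finset (Fin n)) :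
    |∑ u, decProb R p u * (1 - decProb R p u) -
      n * (tailProb R p Finset.univ 0 * (1 - tailProb R p Finset.univ 1))| ≤ 8 * (n / s) := by
  have : (n : ℝ) * (tailProb R p Finset.univ 0 * (1 - tailProb R p Finset.univ 1)) =
      ∑ _u : Fin n, tailProb R p Finset.univ 0 * (1 - tailProb R p Finset.univ 1) := by simp
  rw [this, ← Finset.sum_sub_distrib]
  refine (Finset.abs_sum_le_sum_abs _ _).trans ?_
  refine (Finset.sum_le_sum fun u _ ↦ abs_decProb_mul_sub_le h0 h1 hs hsn R u).trans ?_
  simp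
  apply le_of_eq; ring

end Bounds

/-! ### Decoupling a vertex from the decisions of the others -/

/-- The character `x ↦ exp (i τ x)`. -/
noncomputable def ch (τ x : ℝ) : ℂ := Complex.exp (Complex.I * (τ * x : ℝ))

theorem norm_ch (τ x : ℝ) : ‖ch τ x‖ = 1 := Complex.norm_exp_I_mul_ofReal _

theorem ch_add (τ x y : ℝ) : ch τ (x + y) = ch τ x * ch τ y := by
  rw [ch, ch, ch, ← Complex.exp_add]; congr 1; push_cast; ring

theorem ch_zero (τ : ℝ) : ch τ 0 = 1 := by simp [ch]

theorem ch_sum {J : Type*} (s : Finset J) (τ : ℝ) (f : J → ℝ) :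
    ch τ (∑ j ∈ s, f j) = ∏ j ∈ s, ch τ (f j) := by
  simp only [ch, ← Complex.exp_sum, ← Finset.mul_sum, ← Complex.ofReal_sum]

theorem norm_ch_sub_le (τ x y : ℝ) : ‖ch τ x - ch τ y‖ ≤ |τ| * |x - y| := by
  have h : ch τ x - ch τ y = ch τ y * (Complex.exp (Complex.I * (τ * (x - y) : ℝ)) - 1) := by
    rw [mul_sub, mul_one]
    congr 1
    rw [← ch, ← ch_add]
    congr 1; ring
  rw [h, norm_mul, norm_ch, one_mul, ← abs_mul]
  exact Real.norm_exp_I_mul_ofReal_sub_one_le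

/-- The indicator that the pair `ku` is pivotal for every `k ∈ T`. -/
noncomputable def pivots (R : Finset (Fin n)) (u : Fin n) (T : Finset (Fin n))
    (ω : Fin n × Fin n → Bool → Bool) : ℝ := ∏ k ∈ T, piv R k u (entry ω k)

theorem pivots_nonneg (R : Finset (Fin n)) (u : Fin n) (T : Finset (Fin n))
    (ω : Fin n × Fin n → Bool → Bool) : 0 ≤ pivots R u T ω :=
  Finset.prod_nonneg fun _ _ ↦ piv_nonneg _ _ _ _

theorem pivots_congr_of_not_star (R : Finset (Fin n)) {ω₁ ω₂ : Fin n × Fin n → Bool → Bool}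
    {u : Fin n} (h : ∀ i ∉ star u, ω₁ i = ω₂ i) {T : Finset (Fin n)} (hT : u ∉ T) :
    pivots R u T ω₁ = pivots R u T ω₂ :=
  Finset.prod_congr rfl fun _ hk ↦ piv_congr_of_not_star R h fun h ↦ hT (h ▸ hk)

theorem piv_mul_self (R : Finset (Fin n)) (u v : Fin n) (y : Fin n → Bool) :
    piv R u v y * piv R u v y = piv R u v y := by
  unfold piv; split_ifs <;> simp

theorem card_erase_erase (u v : Fin n) : n ≤ #((Finset.univ.erase u).erase v) + 2 := by
  have c1 := Finset.pred_card_le_card_erase (s := Finset.univ) (a := u)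
  have c2 := Finset.pred_card_le_card_erase (s := Finset.univ.erase u) (a := v)
  rw [Finset.card_univ, Fintype.card_fin] at c1
  omega

theorem ex_bern_sub {p : ℝ} (h0 : 0 ≤ p) (h1 : p ≤ 1) (w : Fin n) :
    ex (bern p) (fun y : Fin n → Bool ↦ bit (y w) - p) = 0 := by
  rw [ex_apply (isProbWeight_bern h0 h1) w (fun b ↦ bit b - p)]
  simp [bern]
  ring

theorem ex_bern_sub_mul_sub {p : ℝ} (h0 : 0 ≤ p) (h1 : p ≤ 1) (w w' : Fin n) :
    ex (bern p) (fun y : Fin n → Bool ↦ (bit (y w) - p) * (bit (y w') - p)) =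
      if w = w' then p * (1 - p) else 0 := by
  have hw := isProbWeight_bern h0 h1
  split_ifs with h
  · subst h
    rw [ex_apply hw w (fun b ↦ (bit b - p) * (bit b - p))]
    simp [bern]
    ring
  · rw [ex_mul_of_disjoint hw {w} (fun y₁ y₂ h ↦ by rw [h w rfl])
      (fun y₁ y₂ h' ↦ by rw [h' w' (Ne.symm h)]), ex_bern_sub h0 h1, zero_mul]

/-- The second moment of the difference of two independent Bernoulli vectors, given the first. -/
theorem ex_bern_diff_mul_diff {p : ℝ} (h0 : 0 ≤ p) (h1 : p ≤ 1) (w w' : Fin n) (a a' : ℝ) :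
    ex (bern p) (fun y : Fin n → Bool ↦ (a - bit (y w)) * (a' - bit (y w'))) =
      (a - p) * (a' - p) + if w = w' then p * (1 - p) else 0 := by
  have : ∀ y : Fin n → Bool, (a - bit (y w)) * (a' - bit (y w')) = (a - p) * (a' - p) +
      ((bit (y w) - p) * (bit (y w') - p) -
        ((a - p) * (bit (y w') - p) + (a' - p) * (bit (y w) - p))) := by
    intro y; ring
  simp only [this]
  rw [ex_add, ex_const (isProbWeight_bern h0 h1), ex_sub, ex_bern_sub_mul_sub h0 h1, ex_add,
    ex_mul_left, ex_mul_left, ex_bern_sub h0 h1, ex_bern_sub h0 h1]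
  simp

section Model

variable {p θ s : ℝ} (h0 : 0 ≤ p) (h1 : p ≤ 1) (hθ0 : 0 ≤ θ) (hθ1 : θ ≤ 1) (hs : 0 < s)
  (hsn : s ^ 2 = n * (p * (1 - p)))

include h0 h1 hθ0 hθ1 hs hsn

/-- Up to three vertices behave independently as far as upper bounds for the pivotality of their
pairs with `u` go: given the pairs inside a set `K` of four vertices, the pairs leaving `K` are
independent, and each signed sum over these is anticoncentrated. -/
theorem ex_pivots_le_of_subset (R : Finset (Fin n)) {u : Fin n} {K : Finset (Fin n)} (hu : u ∈ K)
    (hK : #K ≤ 4) (T : Finset (Fin n)) (hT : T ⊆ K) (huT : u ∉ T) :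
    ex (tieWeight p θ) (pivots R u T) ≤ (2 / s) ^ #T := by
  have hw := isProbWeight_tieWeight h0 h1 hθ0 hθ1
  induction T using Finset.induction_on with
  | empty =>
    unfold pivots
    simp [ex_const hw]
  | insert k T hk ih =>
    have hkK : k ∈ K := hT (Finset.mem_insert_self k T)
    have hku : k ≠ u := fun h ↦ huT (h ▸ Finset.mem_insert_self k T)
    have hTK : T ⊆ K := (Finset.subset_insert k T).trans hT
    have huT' : u ∉ T := fun h ↦ huT (Finset.mem_insert_of_mem h)
    have hsum : ∀ y : Fin n → Bool, signedSum R ((Finset.univ.erase k).erase u) y =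
        signedSum R Kᶜ y + signedSum R ((K.erase k).erase u) y := by
      intro y
      unfold signedSum
      rw [← Finset.sum_union]
      · congr 1
        ext z
        simp only [Finset.mem_erase, Finset.mem_univ, Finset.mem_union, Finset.mem_compl]
        by_cases hz : z ∈ K <;> simp [hz]
        constructor <;> rintro rfl <;> contradiction
      · refine Finset.disjoint_left.mpr fun z hz hz' ↦ ?_
        exact Finset.mem_compl.mp hz (Finset.mem_of_mem_erase (Finset.mem_of_mem_erase hz'))
    have hcard : n ≤ #Kᶜ + 4 := by
      rw [Finset.card_compl, Fintype.card_fin]; omega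
    let A : Set (Fin n × Fin n) := {i | ∃ z ∉ K, i = pairIdx k z}
    let H : (Fin n × Fin n → Bool → Bool) → (Fin n × Fin n → Bool → Bool) → ℝ := fun ω' ω ↦
      (if signedSum R Kᶜ (entry ω' k) =
        pivLevel R k u - signedSum R ((K.erase k).erase u) (entry ω k) then 1 else 0) *
        pivots R u T ω
    have hH : ∀ ω, pivots R u (insert k T) ω = H ω ω := by
      intro ω
      simp only [H]
      rw [pivots, Finset.prod_insert hk, ← pivots, piv, hsum]
      simp only [eq_sub_iff_add_eq]
    have hA : ∀ k' ∈ K, ∀ z, (k' ≠ k ∨ z ∈ K) → pairIdx k' z ∉ A := by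
      rintro k' hk' z hz ⟨z', hz', he⟩
      rcases pairIdx_eq_iff.mp he with ⟨h, h'⟩ | ⟨h, h'⟩
      · rcases hz with hz | hz
        · exact hz h
        · exact hz' (h' ▸ hz)
      · exact hz' (h ▸ hk')
    calc ex (tieWeight p θ) (pivots R u (insert k T))
        = ex (tieWeight p θ) (fun ω ↦ H ω ω) := by congr 1; ext ω; exact hH ω
      _ = ex (tieWeight p θ) (fun ω ↦ ex (tieWeight p θ) (fun ω' ↦ H ω' ω)) := by
          refine ex_swap hw A H (fun ω ω₁ ω₂ h ↦ ?_) (fun ω ω₁ ω₂ h ↦ ?_)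
          · simp only [H]
            rw [signedSum_congr R fun z hz ↦
              entry_congr (h _ ⟨z, Finset.mem_compl.mp hz, rfl⟩)]
          · simp only [H]
            congr 1
            · rw [signedSum_congr R fun z hz ↦ entry_congr (h _ (hA k hkK z (Or.inr
                (Finset.mem_of_mem_erase (Finset.mem_of_mem_erase hz)))))]
            · refine Finset.prod_congr rfl fun k' hk' ↦ ?_
              congr 1
              ext z
              exact entry_congr (h _ (hA k' (hTK hk') z (Or.inl fun h ↦ hk (h ▸ hk'))))
      _ ≤ ex (tieWeight p θ) (fun ω ↦ 2 / s * pivots R u T ω) := by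
          refine ex_mono hw fun ω ↦ ?_
          have : ex (tieWeight p θ) (fun ω' ↦ H ω' ω) = pointProb R p Kᶜ
              (pivLevel R k u - signedSum R ((K.erase k).erase u) (entry ω k)) *
                pivots R u T ω := by
            simp only [H]
            rw [pointProb, ← ex_row h0 h1 hθ0 hθ1 k]
            exact ex_smul_const _ _ _
          rw [this]
          exact mul_le_mul_of_nonneg_right (pointProb_le R h0 h1 hs hsn _ hcard _)
            (pivots_nonneg R u T ω)
      _ ≤ _ := by
          rw [ex_mul_left, Finset.card_insert_of_notMem hk, pow_succ']
          exact mul_le_mul_of_nonneg_left (ih hTK huT') (by positivity)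

theorem ex_pivots_le (R : Finset (Fin n)) {u : Fin n} (T : Finset (Fin n)) (huT : u ∉ T)
    (hT : #T ≤ 3) : ex (tieWeight p θ) (pivots R u T) ≤ (2 / s) ^ #T :=
  ex_pivots_le_of_subset h0 h1 hθ0 hθ1 hs hsn R (Finset.mem_insert_self u T)
    ((Finset.card_insert_le u T).trans (by omega)) T (Finset.subset_insert u T) huT

/-- Two centred bits each contribute a derivative of the law of the signed sum at `u`. -/
theorem abs_ex_piv_mul_centred_le (R : Finset (Fin n)) {u v w w' : Fin n} (hwu : w ≠ u)
    (hwv : w ≠ v) (hwu' : w' ≠ u) (hwv' : w' ≠ v) (hww : w ≠ w') :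
    |ex (tieWeight p θ) (fun ω ↦ piv R u v (entry ω u) *
      ((bit (entry ω w u) - p) * (bit (entry ω w' u) - p)))| ≤
      (p * (1 - p)) ^ 2 * (8 / s ^ 2) := by
  have hpq : 0 ≤ p * (1 - p) := mul_nonneg h0 (by linarith)
  set h' : (Fin n → Bool) → ℝ := fun y ↦
    piv R u v (Function.update y w true) - piv R u v (Function.update y w false) with hh'
  have e1 := ex_mul_centred h0 h1 hθ0 hθ1 hwu.symm (piv R u v)
    (fun ω ↦ bit (entry ω w' u) - p) fun ω b c ↦ by
      rw [entry_setPair_of_ne ω hwu' hww.symm]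
  have e2 := ex_mul_centred h0 h1 hθ0 hθ1 hwu'.symm h' (fun _ ↦ 1) fun _ _ _ ↦ rfl
  simp only [mul_one] at e2
  simp only [← mul_assoc]
  rw [e1]
  have e3 : ex (tieWeight p θ) (fun ω ↦ h' (entry ω u) * (bit (entry ω w' u) - p)) =
      θ * (p * (1 - p)) * ex (bern p) (fun y ↦
        h' (Function.update y w' true) - h' (Function.update y w' false)) := by
    rw [e2]
    congr 1
    exact ex_row h0 h1 hθ0 hθ1 u (fun y ↦
      h' (Function.update y w' true) - h' (Function.update y w' false))
  rw [show (fun ω : Fin n × Fin n → Bool → Bool ↦ (piv R u v (Function.update (entry ω u) w true) -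
    piv R u v (Function.update (entry ω u) w false)) * (bit (entry ω w' u) - p)) =
    fun ω ↦ h' (entry ω u) * (bit (entry ω w' u) - p) from rfl, e3]
  set Z := (((Finset.univ.erase u).erase v).erase w').erase w with hZ
  have hwZ : w ∉ Z := Finset.notMem_erase _ _
  have hwZ' : w' ∉ insert w Z := by
    rw [hZ, Finset.insert_erase (by simp [hwu, hwv, hww])]
    exact Finset.notMem_erase _ _
  have hins : insert w' (insert w Z) = (Finset.univ.erase u).erase v := by
    rw [hZ, Finset.insert_erase (by simp [hwu, hwv, hww]),
      Finset.insert_erase (by simp [hwu', hwv'])]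
  have hwZ'' : w' ∉ Z := fun h ↦ hwZ' (Finset.mem_insert_of_mem h)
  have hcard : n ≤ #Z + 4 := by
    have := card_erase_erase u v
    have c1 := Finset.card_insert_of_notMem hwZ
    have c2 := Finset.card_insert_of_notMem hwZ'
    rw [hins] at c2
    omega
  have hpt : ∀ b b' : Bool, ex (bern p) (fun y : Fin n → Bool ↦
      piv R u v (Function.update (Function.update y w' b') w b)) = pointProb R p Z
        (pivLevel R u v - (if b' then eps R w' else 0) - (if b then eps R w else 0)) := by
    intro b b'
    rw [pointProb]
    congr 1
    ext y
    unfold piv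
    rw [← hins, signedSum_insert R hwZ', signedSum_insert R hwZ, signedSum_update R hwZ,
      signedSum_update R hwZ'', Function.update_of_ne hww.symm, Function.update_self,
      Function.update_self]
    congr 1
    rw [eq_iff_iff]
    omega
  have hE : |ex (bern p) (fun y ↦
      h' (Function.update y w' true) - h' (Function.update y w' false))| ≤ 8 / s ^ 2 := by
    simp only [hh']
    rw [ex_sub, ex_sub, ex_sub, hpt, hpt, hpt, hpt]
    have hd : ∀ c : ℤ, |pointProb R p Z (c - eps R w) - pointProb R p Z c| ≤ 4 / s ^ 2 := fun c ↦
      abs_pointProb_sub_le' h0 h1 hs hsn R Z hcard (by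
        rcases eps_eq_or R w with h | h <;> simp [h])
    have d1 := hd (pivLevel R u v - eps R w')
    have d2 := hd (pivLevel R u v)
    simp only [if_true, if_false, sub_zero, Bool.false_eq_true]
    refine (abs_sub _ _).trans ((add_le_add d1 d2).trans (le_of_eq ?_))
    ring
  have hθp : θ * (p * (1 - p)) ≤ p * (1 - p) := by nlinarith
  have hθp0 : 0 ≤ θ * (p * (1 - p)) := mul_nonneg hθ0 hpq
  generalize θ * (p * (1 - p)) = c at hθp hθp0 ⊢
  rw [abs_mul, abs_mul, abs_of_nonneg hθp0, ← mul_assoc, sq]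
  gcongr

theorem ex_piv_mul_sq_le (R : Finset (Fin n)) {u v w : Fin n} (hwu : w ≠ u) (hwv : w ≠ v) :
    ex (tieWeight p θ) (fun ω ↦ piv R u v (entry ω u) *
      ((bit (entry ω w u) - p) * (bit (entry ω w u) - p) + p * (1 - p))) ≤
      p * (1 - p) * (8 / s) := by
  have hw := isProbWeight_tieWeight h0 h1 hθ0 hθ1
  have hpq : 0 ≤ p * (1 - p) := mul_nonneg h0 (by linarith)
  -- Adding up both values of the bit `uw` removes the dependence of `piv` on the pair `uw`.
  set A' : (Fin n → Bool) → ℝ := fun y ↦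
    piv R u v (Function.update y w true) + piv R u v (Function.update y w false) with hA'
  have hle : ∀ y, piv R u v y ≤ A' y := by
    intro y
    have t := piv_nonneg R u v (Function.update y w true)
    have f := piv_nonneg R u v (Function.update y w false)
    have : y = Function.update y w (y w) := (Function.update_eq_self w y).symm
    rcases Bool.eq_false_or_eq_true (y w) with h | h <;> rw [h] at this <;> rw [hA'] <;>
      dsimp only <;> rw [← this] <;> linarith
  set Z := ((Finset.univ.erase u).erase v).erase w with hZ
  have hwZ : w ∉ Z := Finset.notMem_erase _ _
  have hins : insert w Z = (Finset.univ.erase u).erase v := by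
    rw [hZ, Finset.insert_erase (by simp [hwu, hwv])]
  have hcard : n ≤ #Z + 4 := by
    have := card_erase_erase u v
    have c1 := Finset.card_insert_of_notMem hwZ
    rw [hins] at c1
    omega
  have hpt : ∀ b : Bool, ex (bern p) (fun y : Fin n → Bool ↦
      piv R u v (Function.update y w b)) ≤ 2 / s := by
    intro b
    refine le_trans (le_of_eq ?_) (pointProb_le R h0 h1 hs hsn Z hcard
      (pivLevel R u v - (if b then eps R w else 0)))
    rw [pointProb]
    congr 1
    ext y
    unfold piv
    rw [← hins, signedSum_insert R hwZ, signedSum_update R hwZ, Function.update_self]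
    congr 1
    rw [eq_iff_iff]
    omega
  calc _ ≤ ex (tieWeight p θ) (fun ω ↦ A' (entry ω u) *
        ((bit (entry ω w u) - p) * (bit (entry ω w u) - p) + p * (1 - p))) :=
        ex_mono hw fun ω ↦ mul_le_mul_of_nonneg_right (hle _)
          (add_nonneg (mul_self_nonneg _) hpq)
    _ = ex (tieWeight p θ) (fun ω ↦ 2 * (p * (1 - p)) * A' (entry ω u)) := by
        rw [ex_setPair h0 h1 hθ0 hθ1 u w]
        congr 1
        ext ω
        simp only [entry_setPair_left, entry_setPair_right ω hwu.symm, Function.update_self,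
          Fintype.sum_bool, tie, bern, smul_eq_mul, bit, hA', Function.update_idem]
        simp
        ring
    _ = 2 * (p * (1 - p)) * ex (bern p) A' := by
        rw [ex_mul_left, ex_row h0 h1 hθ0 hθ1 u A']
    _ ≤ 2 * (p * (1 - p)) * (2 / s + 2 / s) := by
        gcongr
        rw [hA', ex_add]
        exact add_le_add (hpt true) (hpt false)
    _ = _ := by ring

/-- The effect on the other decisions of resampling the bits with which they see `u` has bounded
second moment on average over the event that `uv` is pivotal for `u`. The changes have almost
uncorrelated signs: the `n` diagonal terms contribute `O(1/σ²)` times `p (1 - p)` each, and the `n²`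
others `O(1/σ⁴)` times `(p (1 - p))²` each. -/
theorem ex_piv_mul_pivots_mul_sq_le (R : Finset (Fin n)) {u v : Fin n} (huv : u ≠ v)
    {T : Finset (Fin n)} (hT : T ⊆ {v}) :
    ex (tieWeight p θ) (fun ω ↦ ex (bern p) (fun y ↦ piv R u v (entry ω u) * pivots R u T ω *
      (∑ w ∈ (Finset.univ.erase u).erase v,
        (bit (entry ω w u) - bit (y w)) * eps R u * piv R w u (entry ω w)) ^ 2)) ≤
      48 * (2 / s) ^ #T := by
  have hw := isProbWeight_tieWeight h0 h1 hθ0 hθ1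
  have hpq : 0 ≤ p * (1 - p) := mul_nonneg h0 (by linarith)
  have huT : u ∉ T := fun h ↦ huv (Finset.mem_singleton.mp (hT h))
  have hTc : #T ≤ 1 := by simpa using Finset.card_le_card hT
  set Z := (Finset.univ.erase u).erase v with hZ
  have hZu : ∀ w ∈ Z, w ≠ u := fun w h ↦ Finset.ne_of_mem_erase (Finset.mem_of_mem_erase h)
  have hZv : ∀ w ∈ Z, w ≠ v := fun w h ↦ Finset.ne_of_mem_erase h
  have hZT : ∀ w ∈ Z, w ∉ T := fun w h h' ↦ hZv w h (Finset.mem_singleton.mp (hT h'))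
  set g : Fin n → Fin n → (Fin n × Fin n → Bool → Bool) → ℝ := fun w w' ω ↦
    piv R u v (entry ω u) * ((bit (entry ω w u) - p) * (bit (entry ω w' u) - p) +
      if w = w' then p * (1 - p) else 0) with hg
  set f : Fin n → Fin n → (Fin n × Fin n → Bool → Bool) → ℝ := fun w w' ω ↦
    pivots R u T ω * (piv R w u (entry ω w) * piv R w' u (entry ω w')) with hf
  have hexp : ∀ ω : Fin n × Fin n → Bool → Bool, ex (bern p) (fun y ↦
      piv R u v (entry ω u) * pivots R u T ω * (∑ w ∈ Z,
        (bit (entry ω w u) - bit (y w)) * eps R u * piv R w u (entry ω w)) ^ 2) =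
      ∑ w ∈ Z, ∑ w' ∈ Z, g w w' ω * f w w' ω := by
    intro ω
    have : ∀ y : Fin n → Bool, piv R u v (entry ω u) * pivots R u T ω * (∑ w ∈ Z,
        (bit (entry ω w u) - bit (y w)) * eps R u * piv R w u (entry ω w)) ^ 2 =
        ∑ w ∈ Z, ∑ w' ∈ Z, (piv R u v (entry ω u) * pivots R u T ω *
          (piv R w u (entry ω w) * piv R w' u (entry ω w'))) *
          ((bit (entry ω w u) - bit (y w)) * (bit (entry ω w' u) - bit (y w'))) := by
      intro y
      rw [sq, Finset.sum_mul_sum]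
      simp only [Finset.mul_sum]
      refine Finset.sum_congr rfl fun w _ ↦ Finset.sum_congr rfl fun w' _ ↦ ?_
      linear_combination (piv R u v (entry ω u) * pivots R u T ω *
        (bit (entry ω w u) - bit (y w)) * piv R w u (entry ω w) *
        ((bit (entry ω w' u) - bit (y w')) * piv R w' u (entry ω w'))) * eps_mul_self R u
    simp only [this]
    rw [ex_sum]
    refine Finset.sum_congr rfl fun w _ ↦ ?_
    rw [ex_sum]
    refine Finset.sum_congr rfl fun w' _ ↦ ?_
    rw [ex_mul_left, ex_bern_diff_mul_diff h0 h1, hg, hf]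
    ring
  simp only [hexp]
  rw [ex_sum]
  -- All factors of `g` concern pairs that contain `u`, all factors of `f` pairs that avoid `u`.
  have hfac : ∀ w ∈ Z, ∀ w' ∈ Z, ex (tieWeight p θ) (fun ω ↦ g w w' ω * f w w' ω) =
      ex (tieWeight p θ) (g w w') * ex (tieWeight p θ) (f w w') := by
    intro w hwZ w' hwZ'
    refine ex_mul_of_disjoint hw (star u) (fun ω₁ ω₂ h ↦ ?_) (fun ω₁ ω₂ h ↦ ?_)
    · simp only [hg]
      rw [entry_congr_of_star h, entry_congr_of_star' h, entry_congr_of_star' h]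
    · simp only [hf]
      rw [pivots_congr_of_not_star R h huT, piv_congr_of_not_star R h (hZu w hwZ),
        piv_congr_of_not_star R h (hZu w' hwZ')]
  have hf0 : ∀ w w', 0 ≤ ex (tieWeight p θ) (f w w') := fun w w' ↦ ex_nonneg hw fun ω ↦
    mul_nonneg (pivots_nonneg _ _ _ _) (mul_nonneg (piv_nonneg _ _ _ _) (piv_nonneg _ _ _ _))
  have hdiag : ∀ w ∈ Z, ex (tieWeight p θ) (fun ω ↦ g w w ω * f w w ω) ≤
      p * (1 - p) * (8 / s) * (2 / s) ^ (#T + 1) := by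
    intro w hwZ
    rw [hfac w hwZ w hwZ]
    have e1 : ex (tieWeight p θ) (g w w) ≤ p * (1 - p) * (8 / s) := by
      simp only [hg, if_true]
      exact ex_piv_mul_sq_le h0 h1 hθ0 hθ1 hs hsn R (hZu w hwZ) (hZv w hwZ)
    have e2 : ex (tieWeight p θ) (f w w) ≤ (2 / s) ^ (#T + 1) := by
      have := ex_pivots_le h0 h1 hθ0 hθ1 hs hsn R (insert w T) (u := u)
        (by simp [(hZu w hwZ).symm, huT])
        (by rw [Finset.card_insert_of_notMem (hZT w hwZ)]; omega)
      rw [Finset.card_insert_of_notMem (hZT w hwZ)] at this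
      refine le_trans (le_of_eq ?_) this
      congr 1
      ext ω
      simp only [hf]
      rw [piv_mul_self, pivots, pivots, Finset.prod_insert (hZT w hwZ), mul_comm]
    exact mul_le_mul e1 e2 (hf0 w w) (by positivity)
  have hoff : ∀ w ∈ Z, ∀ w' ∈ Z, w ≠ w' → ex (tieWeight p θ) (fun ω ↦ g w w' ω * f w w' ω) ≤
      (p * (1 - p)) ^ 2 * (8 / s ^ 2) * (2 / s) ^ (#T + 2) := by
    intro w hwZ w' hwZ' hne
    rw [hfac w hwZ w' hwZ']
    have e1 : ex (tieWeight p θ) (g w w') ≤ (p * (1 - p)) ^ 2 * (8 / s ^ 2) := by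
      simp only [hg, if_neg hne, add_zero]
      exact (le_abs_self _).trans (abs_ex_piv_mul_centred_le h0 h1 hθ0 hθ1 hs hsn R (hZu w hwZ)
        (hZv w hwZ) (hZu w' hwZ') (hZv w' hwZ') hne)
    have hn1 : w ∉ insert w' T := by simp [hne, hZT w hwZ]
    have e2 : ex (tieWeight p θ) (f w w') ≤ (2 / s) ^ (#T + 2) := by
      have := ex_pivots_le h0 h1 hθ0 hθ1 hs hsn R (insert w (insert w' T)) (u := u)
        (by simp [(hZu w hwZ).symm, (hZu w' hwZ').symm, huT])
        (by
          rw [Finset.card_insert_of_notMem hn1, Finset.card_insert_of_notMem (hZT w' hwZ')]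
          omega)
      rw [Finset.card_insert_of_notMem hn1, Finset.card_insert_of_notMem (hZT w' hwZ')] at this
      refine le_trans (le_of_eq ?_) this
      congr 1
      ext ω
      simp only [hf]
      rw [pivots, pivots, Finset.prod_insert hn1, Finset.prod_insert (hZT w' hwZ')]
      ring
    exact mul_le_mul e1 e2 (hf0 w w') (by positivity)
  have hZn : (#Z : ℝ) ≤ n := by
    have := Finset.card_le_univ Z
    rw [Fintype.card_fin] at this
    exact_mod_cast this
  set a := p * (1 - p) * (8 / s) * (2 / s) ^ (#T + 1) with ha
  set b := (p * (1 - p)) ^ 2 * (8 / s ^ 2) * (2 / s) ^ (#T + 2) with hb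
  have ha0 : 0 ≤ a := by positivity
  have hb0 : 0 ≤ b := by positivity
  calc _ ≤ ∑ w ∈ Z, (a + n * b) := by
        refine Finset.sum_le_sum fun w hwZ ↦ ?_
        rw [ex_sum, ← Finset.add_sum_erase _ _ hwZ]
        refine add_le_add (hdiag w hwZ) ?_
        refine (Finset.sum_le_sum fun w' hw' ↦ hoff w hwZ w' (Finset.mem_of_mem_erase hw')
          (Finset.ne_of_mem_erase hw').symm).trans ?_
        rw [Finset.sum_const, nsmul_eq_mul]
        refine mul_le_mul_of_nonneg_right (le_trans ?_ hZn) hb0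
        exact_mod_cast Finset.card_le_card (Finset.erase_subset w Z)
    _ ≤ n * (a + n * b) := by
        rw [Finset.sum_const, nsmul_eq_mul]
        gcongr
    _ = 48 * (2 / s) ^ #T := by
        have e : n * (a + n * b) = (2 / s) ^ #T * (16 * (n * (p * (1 - p))) / s ^ 2 +
            32 * (n * (p * (1 - p))) ^ 2 / s ^ 4) := by
          rw [ha, hb, pow_succ, pow_add]; field_simp; ring
        rw [e, ← hsn]
        field_simp
        ring

end Model

section Model

variable {p θ s : ℝ} (h0 : 0 ≤ p) (h1 : p ≤ 1) (hθ0 : 0 ≤ θ) (hθ1 : θ ≤ 1) (hs : 0 < s)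
  (hsn : s ^ 2 = n * (p * (1 - p)))

/-- The number of red vertices other than `u` and `v` after one step. -/
noncomputable def restCount (R : Finset (Fin n)) (u v : Fin n)
    (ω : Fin n × Fin n → Bool → Bool) : ℝ :=
  ∑ w ∈ (Finset.univ.erase u).erase v, dec R w (entry ω w)

include h0 h1 hθ0 hθ1 hs hsn

/-- What `u` sees is nearly independent of the decisions of the others. The bits with which the
others see `u` are replaced by an independent copy, at a cost that is controlled by the second
moment of the resulting change. -/
theorem norm_ex_piv_mul_pivots_sub_le (R : Finset (Fin n)) {u v : Fin n} (huv : u ≠ v)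
    {T : Finset (Fin n)} (hT : T ⊆ {v}) (τ : ℝ) :
    ‖ex (tieWeight p θ) (fun ω ↦ ((piv R u v (entry ω u) * pivots R u T ω : ℝ) : ℂ) *
        ch τ (restCount R u v ω)) -
      pivProb R p u v * ex (tieWeight p θ) (fun ω ↦ ((pivots R u T ω : ℝ) : ℂ) *
        ch τ (restCount R u v ω))‖ ≤ |τ| * (25 * (2 / s) ^ #T / √s) := by
  have hw := isProbWeight_tieWeight h0 h1 hθ0 hθ1
  have hb := isProbWeight_bern h0 h1
  have huT : u ∉ T := fun h ↦ huv (Finset.mem_singleton.mp (hT h))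
  have hTc : #T ≤ 1 := by simpa using Finset.card_le_card hT
  set Z := (Finset.univ.erase u).erase v with hZ
  have hZu : ∀ w ∈ Z, w ≠ u := fun w h ↦ Finset.ne_of_mem_erase (Finset.mem_of_mem_erase h)
  set W' : (Fin n × Fin n → Bool → Bool) → (Fin n → Bool) → ℝ := fun ω y ↦
    ∑ w ∈ Z, dec R w (Function.update (entry ω w) u (y w)) with hW'
  set D : (Fin n × Fin n → Bool → Bool) → (Fin n → Bool) → ℝ := fun ω y ↦
    ∑ w ∈ Z, (bit (entry ω w u) - bit (y w)) * eps R u * piv R w u (entry ω w) with hD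
  have hWD : ∀ ω y, restCount R u v ω - W' ω y = D ω y := by
    intro ω y
    simp only [restCount, hW', hD, ← hZ]
    rw [← Finset.sum_sub_distrib]
    exact Finset.sum_congr rfl fun w hwZ ↦ dec_sub_dec_update R (hZu w hwZ) _ _
  have hW'star : ∀ y ω₁ ω₂, (∀ i ∉ star u, ω₁ i = ω₂ i) → W' ω₁ y = W' ω₂ y := by
    intro y ω₁ ω₂ h
    simp only [hW']
    refine Finset.sum_congr rfl fun w hwZ ↦ dec_congr R w fun z _ ↦ ?_
    by_cases hz : z = u
    · subst hz; simp
    · simp [hz, entry_congr_of_not_star h (hZu w hwZ) hz]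
  have hcopy : ∀ ω, W' ω (fun w ↦ entry ω w u) = restCount R u v ω := by
    intro ω
    simp only [hW', restCount, ← hZ]
    refine Finset.sum_congr rfl fun w _ ↦ ?_
    rw [Function.update_eq_self]
  -- The bits seen in the column of `u` have the law of `y` and are independent of the other pairs.
  have hresample : ex (tieWeight p θ) (fun ω ↦ ((pivots R u T ω : ℝ) : ℂ) *
      ch τ (restCount R u v ω)) =
      ex (tieWeight p θ) (fun ω ↦ ex (bern p) (fun y ↦ ((pivots R u T ω : ℝ) : ℂ) *
        ch τ (W' ω y))) := by
    simp only [← hcopy]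
    rw [ex_swap hw (star u) (fun ω' ω ↦ ((pivots R u T ω : ℝ) : ℂ) *
      ch τ (W' ω (fun w ↦ entry ω' w u)))]
    · congr 1
      ext ω
      exact ex_col h0 h1 hθ0 hθ1 u (fun y ↦ ((pivots R u T ω : ℝ) : ℂ) * ch τ (W' ω y))
    · intro ω ω₁ ω₂ h
      simp only [entry_congr_of_star' h]
    · intro ω ω₁ ω₂ h
      simp only [pivots_congr_of_not_star R h huT, hW'star _ _ _ h]
  have hind : (pivProb R p u v : ℂ) * ex (tieWeight p θ) (fun ω ↦ ((pivots R u T ω : ℝ) : ℂ) *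
      ch τ (restCount R u v ω)) =
      ex (tieWeight p θ) (fun ω ↦ ex (bern p) (fun y ↦
        ((piv R u v (entry ω u) * pivots R u T ω : ℝ) : ℂ) * ch τ (W' ω y))) := by
    have hp : (pivProb R p u v : ℂ) =
        ex (tieWeight p θ) (fun ω ↦ ((piv R u v (entry ω u) : ℝ) : ℂ)) := by
      rw [ex_ofReal, ex_row h0 h1 hθ0 hθ1 u (piv R u v), pivProb]
    rw [hresample, hp, ← ex_mul_of_disjoint hw (star u)]
    · congr 1
      ext ω
      rw [← ex_mul_left]
      congr 1
      ext y
      push_cast; ring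
    · intro ω₁ ω₂ h
      rw [entry_congr_of_star h]
    · intro ω₁ ω₂ h
      simp only [pivots_congr_of_not_star R h huT, hW'star _ _ _ h]
  have hleft : ex (tieWeight p θ) (fun ω ↦ ((piv R u v (entry ω u) * pivots R u T ω : ℝ) : ℂ) *
      ch τ (restCount R u v ω)) =
      ex (tieWeight p θ) (fun ω ↦ ex (bern p) (fun _ : Fin n → Bool ↦
        ((piv R u v (entry ω u) * pivots R u T ω : ℝ) : ℂ) * ch τ (restCount R u v ω))) := by
    congr 1
    ext ω
    rw [ex_const hb]
  have hq : 0 < √s := Real.sqrt_pos.mpr hs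
  have hqs : √s * √s = s := Real.mul_self_sqrt hs.le
  have hAY : ex (tieWeight p θ) (fun ω ↦ piv R u v (entry ω u) * pivots R u T ω) ≤
      (2 / s) ^ (#T + 1) := by
    rw [ex_mul_of_disjoint hw (star u) (fun ω₁ ω₂ h ↦ by rw [entry_congr_of_star h])
      (fun ω₁ ω₂ h ↦ pivots_congr_of_not_star R h huT), ex_row h0 h1 hθ0 hθ1 u (piv R u v),
      ← pivProb, pow_succ']
    exact mul_le_mul (pivProb_le h0 h1 hs hsn R u v)
      (ex_pivots_le h0 h1 hθ0 hθ1 hs hsn R T huT (by omega))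
      (ex_nonneg hw (pivots_nonneg R u T)) (by positivity)
  rw [hind, hleft, ← ex_sub]
  calc _ ≤ ex (tieWeight p θ) (fun ω ↦ ex (bern p) (fun y ↦
        |τ| * (√s / 2 * (piv R u v (entry ω u) * pivots R u T ω) +
          1 / (2 * √s) * (piv R u v (entry ω u) * pivots R u T ω * D ω y ^ 2)))) := by
        refine (norm_ex_le hw _).trans (ex_mono hw fun ω ↦ ?_)
        rw [← ex_sub]
        refine (norm_ex_le hb _).trans (ex_mono hb fun y ↦ ?_)
        have hAY0 : 0 ≤ piv R u v (entry ω u) * pivots R u T ω :=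
          mul_nonneg (piv_nonneg _ _ _ _) (pivots_nonneg _ _ _ _)
        rw [← mul_sub, norm_mul, Complex.norm_real, Real.norm_of_nonneg hAY0]
        have h2 := norm_ch_sub_le τ (restCount R u v ω) (W' ω y)
        rw [hWD] at h2
        -- The weight `√s` balances the probability that `uv` is pivotal, of order `1 / s`, against
        -- the second moment.
        have h3 : |D ω y| ≤ √s / 2 + 1 / (2 * √s) * D ω y ^ 2 := by
          have : √s / 2 + 1 / (2 * √s) * D ω y ^ 2 - |D ω y| =
              (√s - |D ω y|) ^ 2 / (2 * √s) := by
            rw [← sq_abs (D ω y)]; field_simp; ring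
          have : 0 ≤ (√s - |D ω y|) ^ 2 / (2 * √s) := by positivity
          linarith
        calc _ ≤ piv R u v (entry ω u) * pivots R u T ω *
              (|τ| * (√s / 2 + 1 / (2 * √s) * D ω y ^ 2)) :=
              mul_le_mul_of_nonneg_left
                (h2.trans (mul_le_mul_of_nonneg_left h3 (abs_nonneg _))) hAY0
          _ = _ := by ring
    _ = |τ| * (√s / 2 * ex (tieWeight p θ) (fun ω ↦ piv R u v (entry ω u) * pivots R u T ω) +
          1 / (2 * √s) * ex (tieWeight p θ) (fun ω ↦ ex (bern p) (fun y ↦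
            piv R u v (entry ω u) * pivots R u T ω * D ω y ^ 2))) := by
        simp only [ex_mul_left, ex_add, ex_const hb]
    _ ≤ |τ| * (√s / 2 * (2 / s) ^ (#T + 1) + 1 / (2 * √s) * (48 * (2 / s) ^ #T)) := by
        gcongr
        exact ex_piv_mul_pivots_mul_sq_le h0 h1 hθ0 hθ1 hs hsn R huv hT
    _ = |τ| * (25 * (2 / s) ^ #T / √s) := by
        have hs' : s = √s ^ 2 := (Real.sq_sqrt hs.le).symm
        rw [pow_succ]
        generalize √s = q at *
        subst hs'
        field_simp
        ring

/-- The event that the pair `uv` is pivotal for both ends is nearly independent of the number of red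
vertices. -/
theorem norm_ex_piv_mul_piv_sub_le (hs1 : 1 ≤ s) (R : Finset (Fin n)) {u v : Fin n} (huv : u ≠ v)
    (τ : ℝ) :
    ‖ex (tieWeight p θ) (fun ω ↦ ((piv R u v (entry ω u) * piv R v u (entry ω v) : ℝ) : ℂ) *
        ch τ (restCount R u v ω)) -
      (pivProb R p u v * pivProb R p v u : ℝ) *
        ex (tieWeight p θ) (fun ω ↦ ch τ (count R ω))‖ ≤ |τ| * (108 / (s * √s)) := by
  have hw := isProbWeight_tieWeight h0 h1 hθ0 hθ1
  have hq : 0 < √s := Real.sqrt_pos.mpr hs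
  have hq1 : √s ≤ s := by
    rw [Real.sqrt_le_left hs.le]; nlinarith
  have e1 := norm_ex_piv_mul_pivots_sub_le h0 h1 hθ0 hθ1 hs hsn R huv
    (Finset.Subset.refl {v}) τ
  have e2 := norm_ex_piv_mul_pivots_sub_le h0 h1 hθ0 hθ1 hs hsn R huv.symm
    (Finset.empty_subset {u}) τ
  have hsymm : ∀ ω, restCount R v u ω = restCount R u v ω := fun ω ↦ by
    rw [restCount, restCount, Finset.erase_right_comm]
  simp only [pivots, Finset.prod_singleton, Finset.card_singleton, pow_one, Finset.prod_empty,
    Finset.card_empty, pow_zero, mul_one, hsymm, Complex.ofReal_one, one_mul] at e1 e2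
  have e3 : ‖ex (tieWeight p θ) (fun ω ↦ ch τ (restCount R u v ω)) -
      ex (tieWeight p θ) (fun ω ↦ ch τ (count R ω))‖ ≤ |τ| * 2 := by
    rw [← ex_sub, ← ex_const (ι := Fin n × Fin n) hw (|τ| * 2)]
    refine (norm_ex_le hw _).trans (ex_mono hw fun ω ↦ (norm_ch_sub_le _ _ _).trans ?_)
    refine mul_le_mul_of_nonneg_left ?_ (abs_nonneg _)
    rw [count, restCount, ← Finset.add_sum_erase _ _ (Finset.mem_univ u),
      ← Finset.add_sum_erase (Finset.univ.erase u) _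
        (Finset.mem_erase.mpr ⟨huv.symm, Finset.mem_univ v⟩)]
    rcases dec_eq_zero_or_one R u (entry ω u) with h | h <;>
      rcases dec_eq_zero_or_one R v (entry ω v) with h' | h' <;> rw [h, h', abs_le] <;>
        constructor <;> linarith
  set X := ex (tieWeight p θ) (fun ω ↦ ((piv R u v (entry ω u) * piv R v u (entry ω v) : ℝ) : ℂ) *
        ch τ (restCount R u v ω))
  set Y := ex (tieWeight p θ) (fun ω ↦ ((piv R v u (entry ω v) : ℝ) : ℂ) *
        ch τ (restCount R u v ω))
  set F := ex (tieWeight p θ) (fun ω ↦ ch τ (restCount R u v ω))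
  set F' := ex (tieWeight p θ) (fun ω ↦ ch τ (count R ω))
  have b1 := pivProb_le h0 h1 hs hsn R u v
  have b2 := pivProb_le h0 h1 hs hsn R v u
  have c1 := pivProb_nonneg h0 h1 R u v
  have c2 := pivProb_nonneg h0 h1 R v u
  have hsplit : X - (pivProb R p u v * pivProb R p v u : ℝ) * F' = (X - pivProb R p u v * Y) +
      pivProb R p u v * (Y - pivProb R p v u * F) +
      (pivProb R p u v * pivProb R p v u : ℝ) * (F - F') := by push_cast; ring
  rw [hsplit]
  refine (norm_add₃_le).trans ?_
  rw [norm_mul, norm_mul, Complex.norm_real, Complex.norm_real, Real.norm_of_nonneg c1,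
    Real.norm_of_nonneg (mul_nonneg c1 c2)]
  calc _ ≤ |τ| * (25 * (2 / s) / √s) + 2 / s * (|τ| * (25 / √s)) +
          (2 / s * (2 / s)) * (|τ| * 2) := by
        gcongr
    _ = |τ| * (100 / (s * √s) + 8 / (s * s)) := by field_simp; ring
    _ ≤ |τ| * (100 / (s * √s) + 8 / (s * √s)) := by gcongr
    _ = _ := by ring

end Model

/-! ### The interpolation -/

theorem norm_ch_one_sub_one_le (τ : ℝ) : ‖ch τ 1 - 1‖ ≤ |τ| := by
  have := norm_ch_sub_le τ 1 0
  simpa [ch_zero] using this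

theorem ch_dec (R : Finset (Fin n)) (u : Fin n) (τ : ℝ) (y : Fin n → Bool) :
    ch τ (dec R u y) = 1 + (ch τ 1 - 1) * (dec R u y : ℝ) := by
  rcases dec_eq_zero_or_one R u y with h | h <;> simp [h, ch_zero]

theorem ch_dec_sub (R : Finset (Fin n)) {u v : Fin n} (huv : u ≠ v) (τ : ℝ) (y : Fin n → Bool) :
    ch τ (dec R u (Function.update y v true)) - ch τ (dec R u (Function.update y v false)) =
      (ch τ 1 - 1) * (eps R v * piv R u v y : ℝ) := by
  have := dec_sub_dec_update R huv (Function.update y v true) false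
  rw [Function.update_idem, Function.update_self, piv_update] at this
  simp only [bit_true, bit_false, sub_zero, one_mul] at this
  rw [ch_dec, ch_dec, ← this]
  push_cast
  ring

/-- The derivative of `tieWeight` in `θ`: tying the two bits of a pair adds correlation. -/
noncomputable def tieDeriv (p : ℝ) (b c : Bool) : ℝ := if b = c then p * (1 - p) else -(p * (1 - p))

theorem hasDerivAt_tieWeight (p θ : ℝ) (a : Bool → Bool) :
    HasDerivAt (fun θ ↦ tieWeight p θ a) (tieDeriv p (a false) (a true)) θ := by
  have h : ∀ θ, tieWeight p θ a = tieDeriv p (a false) (a true) * θ +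
      bern p (a false) * bern p (a true) := by
    intro θ
    unfold tieWeight tie tieDeriv
    cases a false <;> cases a true <;> simp [bern] <;> ring
  simp only [h]
  simpa using ((hasDerivAt_id θ).const_mul (tieDeriv p (a false) (a true))).add_const
    (bern p (a false) * bern p (a true))

/-- The characteristic function of the number of red vertices in the interpolated model. -/
noncomputable def countCharFun (R : Finset (Fin n)) (p τ θ : ℝ) : ℂ :=
  ex (tieWeight p θ) fun ω ↦ ch τ (count R ω)

theorem count_eq_add_restCount (R : Finset (Fin n)) {u v : Fin n} (huv : u ≠ v)
    (ω : Fin n × Fin n → Bool → Bool) :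
    count R ω = dec R u (entry ω u) + (dec R v (entry ω v) + restCount R u v ω) := by
  rw [count, restCount, ← Finset.add_sum_erase _ _ (Finset.mem_univ u),
    ← Finset.add_sum_erase (Finset.univ.erase u) _
      (Finset.mem_erase.mpr ⟨huv.symm, Finset.mem_univ v⟩)]

theorem restCount_setPair (R : Finset (Fin n)) (u v : Fin n) (ω : Fin n × Fin n → Bool → Bool)
    (b c : Bool) : restCount R u v (setPair ω u v b c) = restCount R u v ω :=
  Finset.sum_congr rfl fun w hw ↦ by
    rw [entry_setPair_of_ne ω (Finset.ne_of_mem_erase (Finset.mem_of_mem_erase hw))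
      (Finset.ne_of_mem_erase hw)]

theorem count_update_of_not_lt (R : Finset (Fin n)) {i : Fin n × Fin n} (hi : ¬ i.1 < i.2)
    (ω : Fin n × Fin n → Bool → Bool) (a : Bool → Bool) :
    count R (Function.update ω i a) = count R ω := by
  refine Finset.sum_congr rfl fun u _ ↦ dec_congr R u fun z hz ↦ entry_congr ?_
  refine Function.update_of_ne (fun h ↦ hi ?_) _ _
  rw [← h]
  simp only [pairIdx]
  exact min_lt_max.mpr hz.symm

/-- The derivative in `θ` of the characteristic function is a signed sum over the pairs, each
counted once: tying the two bits of a pair matters only if the pair is pivotal for both ends. -/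
theorem hasDerivAt_countCharFun (R : Finset (Fin n)) {p θ : ℝ} (h0 : 0 ≤ p) (h1 : p ≤ 1)
    (hθ0 : 0 ≤ θ) (hθ1 : θ ≤ 1) (τ : ℝ) :
    HasDerivAt (countCharFun R p τ) (∑ i : Fin n × Fin n, if i.1 < i.2 then
      (p * (1 - p) : ℝ) * (ch τ 1 - 1) ^ 2 * ((eps R i.1 * eps R i.2 : ℝ) *
        ex (tieWeight p θ) (fun ω ↦
          ((piv R i.1 i.2 (entry ω i.1) * piv R i.2 i.1 (entry ω i.2) : ℝ) : ℂ) *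
            ch τ (restCount R i.1 i.2 ω))) else 0) θ := by
  have hw := isProbWeight_tieWeight h0 h1 hθ0 hθ1
  have hder : HasDerivAt (countCharFun R p τ) (∑ ω : Fin n × Fin n → Bool → Bool,
      (∑ i, (∏ j ∈ Finset.univ.erase i, tieWeight p θ (ω j)) • tieDeriv p (ω i false) (ω i true)) •
        ch τ (count R ω)) θ := by
    unfold countCharFun ex
    refine HasDerivAt.fun_sum fun ω _ ↦ HasDerivAt.smul_const ?_ _
    exact HasDerivAt.fun_finsetProd fun i _ ↦ hasDerivAt_tieWeight p θ (ω i)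
  convert hder using 1
  simp only [Finset.sum_smul]
  rw [Finset.sum_comm]
  refine Finset.sum_congr rfl fun i _ ↦ ?_
  simp only [smul_eq_mul]
  rw [← ex_sum_update hw (fun a ↦ tieDeriv p (a false) (a true)) i (fun ω ↦ ch τ (count R ω))]
  obtain ⟨u, v⟩ := i
  dsimp only
  split_ifs with hlt
  · have huv := hlt.ne
    have hidx : (u, v) = pairIdx u v := by
      simp [pairIdx, min_eq_left hlt.le, max_eq_right hlt.le]
    rw [← ex_mul_left, ← ex_mul_left]
    congr 1
    ext ω
    rw [hidx, sum_tieWeight_update (tieDeriv p)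
      (fun b c ↦ by cases b <;> cases c <;> rfl) u v (fun ω ↦ ch τ (count R ω))]
    simp only [count_eq_add_restCount R huv, restCount_setPair, entry_setPair_left,
      entry_setPair_right ω huv, ch_add, Fintype.sum_bool, tieDeriv]
    have a1 := ch_dec_sub R huv τ (entry ω u)
    have a2 := ch_dec_sub R huv.symm τ (entry ω v)
    have : ∀ (k : ℝ) (x1 x0 y1 y0 r : ℂ), k • (x1 * (y1 * r)) + (-k) • (x1 * (y0 * r)) +
        ((-k) • (x0 * (y1 * r)) + k • (x0 * (y0 * r))) = k * ((x1 - x0) * (y1 - y0)) * r := by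
      intro k x1 x0 y1 y0 r
      simp only [Complex.real_smul]
      push_cast
      ring
    simp only [if_true, Bool.false_eq_true, if_false, Bool.true_eq_false]
    rw [this, a1, a2]
    push_cast
    ring
  · symm
    simp only [count_update_of_not_lt R (i := (u, v)) hlt, ← Finset.sum_smul]
    have : ∑ a : Bool → Bool, tieDeriv p (a false) (a true) = 0 := by
      rw [sum_boolArrow false]
      simp [tieDeriv]
    simp only [this, zero_smul]
    exact ex_const hw 0

theorem sum_lt_eq_half (R : Finset (Fin n)) (p : ℝ) :
    ∑ i : Fin n × Fin n, (if i.1 < i.2 then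
      (eps R i.1 * eps R i.2 * (pivProb R p i.1 i.2 * pivProb R p i.2 i.1) : ℝ) else 0) =
      pairSum R p / 2 := by
  set f : Fin n → Fin n → ℝ := fun u v ↦
    eps R u * eps R v * (pivProb R p u v * pivProb R p v u) with hf
  have hsymm : ∀ u v, f u v = f v u := fun u v ↦ by simp only [hf]; ring
  have h1 : pairSum R p =
      ∑ u, ∑ v, ((if u < v then f u v else 0) + if v < u then f u v else 0) := by
    unfold pairSum
    refine Finset.sum_congr rfl fun u _ ↦ ?_
    rw [← Finset.add_sum_erase _ (fun v ↦ (if u < v then f u v else 0) + if v < u then f u v else 0)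
      (Finset.mem_univ u)]
    simp only [lt_irrefl, if_false, add_zero, zero_add]
    refine Finset.sum_congr rfl fun v hv ↦ ?_
    rcases lt_or_gt_of_ne (Finset.ne_of_mem_erase hv) with h | h <;> simp [h, h.not_gt, hf]
  have h2 : ∑ u, ∑ v, (if v < u then f u v else 0) = ∑ u, ∑ v, if u < v then f u v else 0 := by
    rw [Finset.sum_comm]
    refine Finset.sum_congr rfl fun u _ ↦ Finset.sum_congr rfl fun v _ ↦ ?_
    rw [hsymm]
  rw [Fintype.sum_prod_type]
  simp only [Finset.sum_add_distrib] at h1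
  rw [h2] at h1
  rw [h1]
  simp only [hf]
  ring

/-- Passing from independent neighbourhoods to the random graph hardly changes the characteristic
function of the number of red vertices. -/
theorem norm_countCharFun_sub_le (R : Finset (Fin n)) {p s : ℝ} (h0 : 0 ≤ p) (h1 : p ≤ 1)
    (hs1 : 1 ≤ s) (hsn : s ^ 2 = n * (p * (1 - p))) (τ : ℝ) :
    ‖countCharFun R p τ 1 - countCharFun R p τ 0‖ ≤
      26 * τ ^ 2 * (imbalance R + n / s) + 108 * |τ| ^ 3 * (n * √s) := by
  have hs : 0 < s := by linarith
  have hn := card_pos_of_sigma hs hsn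
  have hq : 0 < √s := Real.sqrt_pos.mpr hs
  have hpq : p * (1 - p) = s ^ 2 / n := by rw [hsn]; field_simp
  have hpq0 : 0 ≤ p * (1 - p) := mul_nonneg h0 (by linarith)
  set B := 26 * τ ^ 2 * (imbalance R + n / s) + 108 * |τ| ^ 3 * (n * √s) with hB
  have key := (convex_Icc (0 : ℝ) 1).norm_image_sub_le_of_norm_hasDerivWithin_le
    (f := countCharFun R p τ) (C := B) (fun θ hθ ↦
      (hasDerivAt_countCharFun R h0 h1 hθ.1 hθ.2 τ).hasDerivWithinAt) (fun θ hθ ↦ ?_)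
    (Set.left_mem_Icc.mpr zero_le_one) (Set.right_mem_Icc.mpr zero_le_one)
  · simpa using key
  obtain ⟨hθ0, hθ1⟩ := hθ
  have hw := isProbWeight_tieWeight h0 h1 hθ0 hθ1
  set F := ex (tieWeight p θ) (fun ω ↦ ch τ (count R ω)) with hF
  have hF1 : ‖F‖ ≤ 1 := by
    refine (norm_ex_le hw _).trans ?_
    simp only [norm_ch]
    rw [ex_const hw]
  set X : Fin n × Fin n → ℂ := fun i ↦ ex (tieWeight p θ) (fun ω ↦
    ((piv R i.1 i.2 (entry ω i.1) * piv R i.2 i.1 (entry ω i.2) : ℝ) : ℂ) *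
      ch τ (restCount R i.1 i.2 ω)) with hX
  have hsplit : (∑ i : Fin n × Fin n, if i.1 < i.2 then
      (p * (1 - p) : ℝ) * (ch τ 1 - 1) ^ 2 * ((eps R i.1 * eps R i.2 : ℝ) * X i) else 0) =
      (p * (1 - p) : ℝ) * (ch τ 1 - 1) ^ 2 * (((pairSum R p / 2 : ℝ) : ℂ) * F +
        ∑ i : Fin n × Fin n, if i.1 < i.2 then (eps R i.1 * eps R i.2 : ℝ) *
          (X i - (pivProb R p i.1 i.2 * pivProb R p i.2 i.1 : ℝ) * F) else 0) := by
    rw [← sum_lt_eq_half, Complex.ofReal_sum, Finset.sum_mul, ← Finset.sum_add_distrib,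
      Finset.mul_sum]
    refine Finset.sum_congr rfl fun i _ ↦ ?_
    split_ifs
    · push_cast; ring
    · simp
  have herr : ‖∑ i : Fin n × Fin n, if i.1 < i.2 then ((eps R i.1 * eps R i.2 : ℝ) : ℂ) *
      (X i - (pivProb R p i.1 i.2 * pivProb R p i.2 i.1 : ℝ) * F) else 0‖ ≤
      n ^ 2 * (|τ| * (108 / (s * √s))) := by
    calc _ ≤ ∑ _i : Fin n × Fin n, |τ| * (108 / (s * √s)) := by
          refine (norm_sum_le _ _).trans (Finset.sum_le_sum fun i _ ↦ ?_)
          split_ifs with hlt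
          · have he : |(eps R i.1 * eps R i.2 : ℝ)| = 1 := by
              rcases eps_eq_or R i.1 with h | h <;> rcases eps_eq_or R i.2 with h' | h' <;>
                simp [h, h']
            rw [norm_mul, Complex.norm_real, Real.norm_eq_abs, he, one_mul]
            exact norm_ex_piv_mul_piv_sub_le h0 h1 hθ0 hθ1 hs hsn hs1 R hlt.ne τ
          · rw [norm_zero]; positivity
      _ = _ := by
          rw [Finset.sum_const, Finset.card_univ, Fintype.card_prod, Fintype.card_fin,
            nsmul_eq_mul]
          push_cast
          ring
  have hch2 : ‖(ch τ 1 - 1) ^ 2‖ ≤ τ ^ 2 := by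
    rw [norm_pow, ← sq_abs τ]
    gcongr
    exact norm_ch_one_sub_one_le τ
  have hmain : ‖((pairSum R p / 2 : ℝ) : ℂ) * F‖ ≤ |pairSum R p| / 2 := by
    rw [norm_mul, Complex.norm_real, Real.norm_eq_abs, abs_div, abs_two]
    exact mul_le_of_le_one_right (by positivity) hF1
  rw [hsplit, norm_mul, norm_mul, Complex.norm_real, Real.norm_of_nonneg hpq0]
  have hps := abs_pairSum_le h0 h1 hs hsn R
  have hi := imbalance_nonneg R
  calc _ ≤ p * (1 - p) * τ ^ 2 * (|pairSum R p| / 2 + n ^ 2 * (|τ| * (108 / (s * √s)))) := by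
        refine mul_le_mul (mul_le_mul_of_nonneg_left hch2 hpq0)
          ((norm_add_le _ _).trans (add_le_add hmain herr)) (norm_nonneg _) (by positivity)
    _ = τ ^ 2 / 2 * (p * (1 - p) * |pairSum R p|) +
          p * (1 - p) * τ ^ 2 * (n ^ 2 * (|τ| * (108 / (s * √s)))) := by ring
    _ ≤ τ ^ 2 / 2 * (4 * imbalance R + 52 * (n / s)) +
          p * (1 - p) * τ ^ 2 * (n ^ 2 * (|τ| * (108 / (s * √s)))) := by gcongr
    _ = τ ^ 2 / 2 * (4 * imbalance R + 52 * (n / s)) + 108 * |τ| ^ 3 * (n * √s) := by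
        congr 1
        rw [hpq, ← sq_abs τ]
        have hs' : s = √s ^ 2 := (Real.sq_sqrt hs.le).symm
        generalize √s = q at *
        subst hs'
        field_simp
    _ ≤ _ := by
        rw [hB]
        have : 0 ≤ τ ^ 2 * imbalance R := by positivity
        linarith

/-! ### Gaussian limits of characteristic functions -/

/-- The characteristic function of a centred Bernoulli variable with parameter `q`. -/
noncomputable def centredBernCharFun (x q : ℝ) : ℂ :=
  (q : ℂ) * ch x (1 - q) + (1 - q : ℝ) * ch x (-q)

theorem norm_centredBernCharFun_le_one (x : ℝ) {q : ℝ} (h0 : 0 ≤ q) (h1 : q ≤ 1) :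
    ‖centredBernCharFun x q‖ ≤ 1 := by
  refine (norm_add_le _ _).trans (le_of_eq ?_)
  rw [norm_mul, norm_mul, norm_ch, norm_ch, Complex.norm_real, Complex.norm_real,
    Real.norm_of_nonneg h0, Real.norm_of_nonneg (sub_nonneg.mpr h1)]
  ring

theorem norm_ch_sub_taylor_le {x y : ℝ} (h : |x * y| ≤ 1) :
    ‖ch x y - (1 + Complex.I * (x * y : ℝ) - ((x * y) ^ 2 / 2 : ℝ))‖ ≤ |x * y| ^ 3 := by
  have hn : ‖Complex.I * (x * y : ℝ)‖ = |x * y| := by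
    rw [norm_mul, Complex.norm_I, one_mul, Complex.norm_real, Real.norm_eq_abs]
  have hb := Complex.exp_bound (x := Complex.I * (x * y : ℝ)) (by rwa [hn]) (n := 3) (by norm_num)
  rw [hn] at hb
  have hs : ∑ m ∈ Finset.range 3, (Complex.I * (x * y : ℝ)) ^ m / (m.factorial : ℂ) =
      1 + Complex.I * (x * y : ℝ) - ((x * y) ^ 2 / 2 : ℝ) := by
    simp only [Finset.sum_range_succ, Finset.sum_range_zero, Nat.factorial, mul_pow, Complex.I_sq]
    push_cast
    ring
  rw [hs] at hb
  refine hb.trans (mul_le_of_le_one_right (by positivity) ?_)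
  norm_num [Nat.factorial]

theorem norm_centredBernCharFun_sub_le {x q : ℝ} (hx : |x| ≤ 1) (h0 : 0 ≤ q) (h1 : q ≤ 1) :
    ‖centredBernCharFun x q - Real.exp (-x ^ 2 * (q * (1 - q)) / 2)‖ ≤
      2 * |x| ^ 3 * (q * (1 - q)) := by
  have h1' : 0 ≤ 1 - q := by linarith
  have hv : q * (1 - q) ≤ 1 := by nlinarith
  have hv0 : 0 ≤ q * (1 - q) := mul_nonneg h0 h1'
  have a1 : |x * (1 - q)| ≤ |x| := by
    rw [abs_mul, abs_of_nonneg h1']; exact mul_le_of_le_one_right (abs_nonneg _) (by linarith)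
  have a2 : |x * -q| ≤ |x| := by
    rw [abs_mul, abs_neg, abs_of_nonneg h0]; exact mul_le_of_le_one_right (abs_nonneg _) h1
  have t1 := norm_ch_sub_taylor_le (a1.trans hx)
  have t2 := norm_ch_sub_taylor_le (a2.trans hx)
  set y := x ^ 2 * (q * (1 - q)) / 2 with hy
  have hx2 : x ^ 2 ≤ 1 := by rw [← sq_abs]; exact pow_le_one₀ (abs_nonneg _) hx
  have hy0 : 0 ≤ y := by positivity
  have hy1 : y ≤ 1 := by
    have : x ^ 2 * (q * (1 - q)) ≤ 1 := mul_le_one₀ hx2 hv0 hv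
    rw [hy]; linarith
  have t3 := Real.norm_exp_sub_one_sub_id_le (x := -y) (by rwa [norm_neg, Real.norm_of_nonneg hy0])
  have hexp : Real.exp (-x ^ 2 * (q * (1 - q)) / 2) = Real.exp (-y) := by
    congr 1; rw [hy]; ring
  rw [hexp]
  set A := ch x (1 - q) - (1 + Complex.I * (x * (1 - q) : ℝ) - ((x * (1 - q)) ^ 2 / 2 : ℝ)) with hA
  set B := ch x (-q) - (1 + Complex.I * (x * -q : ℝ) - ((x * -q) ^ 2 / 2 : ℝ)) with hB
  have hsplit : centredBernCharFun x q - Real.exp (-y) =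
      (q : ℂ) * A + (1 - q : ℝ) * B + -((Real.exp (-y) - 1 - -y : ℝ) : ℂ) := by
    rw [hA, hB, centredBernCharFun, hy]
    push_cast
    ring
  rw [hsplit]
  refine norm_add₃_le.trans ?_
  rw [norm_mul, norm_mul, Complex.norm_real, Complex.norm_real, Real.norm_of_nonneg h0,
    Real.norm_of_nonneg h1', norm_neg, Complex.norm_real]
  have e3 : ‖-y‖ ^ 2 ≤ |x| ^ 3 * (q * (1 - q)) * (1 / 4) := by
    rw [norm_neg, Real.norm_of_nonneg hy0, hy]
    have h4 : |x| ^ 4 ≤ |x| ^ 3 := pow_le_pow_of_le_one (abs_nonneg _) hx (by norm_num)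
    have hvv : (q * (1 - q)) ^ 2 ≤ q * (1 - q) := pow_le_of_le_one hv0 hv (by norm_num)
    have : (x ^ 2 * (q * (1 - q)) / 2) ^ 2 = |x| ^ 4 * (q * (1 - q)) ^ 2 * (1 / 4) := by
      rw [← sq_abs x]; ring
    rw [this]
    gcongr
  have c3 := t3.trans e3
  have hpos : 0 ≤ |x| ^ 3 * (q * (1 - q)) := by positivity
  -- The third absolute moment is at most the variance.
  have e1' : q * |x * (1 - q)| ^ 3 + (1 - q) * |x * -q| ^ 3 ≤ |x| ^ 3 * (q * (1 - q)) := by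
    rw [abs_mul, abs_mul, abs_neg, abs_of_nonneg h0, abs_of_nonneg h1', mul_pow, mul_pow]
    have : q * (1 - q) ^ 3 + (1 - q) * q ^ 3 ≤ q * (1 - q) := by
      have : q * (1 - q) ^ 3 + (1 - q) * q ^ 3 = q * (1 - q) * (1 - 2 * (q * (1 - q))) := by ring
      rw [this]
      exact mul_le_of_le_one_right hv0 (by linarith)
    calc _ = |x| ^ 3 * (q * (1 - q) ^ 3 + (1 - q) * q ^ 3) := by ring
      _ ≤ _ := by gcongr
  have d1 := mul_le_mul_of_nonneg_left t1 h0
  have d2 := mul_le_mul_of_nonneg_left t2 h1'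
  linarith

theorem norm_prod_sub_prod_le {J : Type*} (s : Finset J) (f g : J → ℂ) (hf : ∀ j ∈ s, ‖f j‖ ≤ 1)
    (hg : ∀ j ∈ s, ‖g j‖ ≤ 1) : ‖∏ j ∈ s, f j - ∏ j ∈ s, g j‖ ≤ ∑ j ∈ s, ‖f j - g j‖ := by
  classical
  induction s using Finset.induction_on with
  | empty => simp
  | insert j s hj ih =>
    have hf' : ∀ i ∈ s, ‖f i‖ ≤ 1 := fun i hi ↦ hf i (Finset.mem_insert_of_mem hi)
    have hg' : ∀ i ∈ s, ‖g i‖ ≤ 1 := fun i hi ↦ hg i (Finset.mem_insert_of_mem hi)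
    rw [Finset.prod_insert hj, Finset.prod_insert hj, Finset.sum_insert hj]
    have hs : f j * ∏ i ∈ s, f i - g j * ∏ i ∈ s, g i =
        (f j - g j) * ∏ i ∈ s, f i + g j * (∏ i ∈ s, f i - ∏ i ∈ s, g i) := by ring
    rw [hs]
    refine (norm_add_le _ _).trans (add_le_add ?_ ?_)
    · rw [norm_mul, norm_prod]
      exact mul_le_of_le_one_right (norm_nonneg _)
        (Finset.prod_le_one (fun _ _ ↦ norm_nonneg _) hf')
    · rw [norm_mul]
      exact (mul_le_of_le_one_left (norm_nonneg _) (hg j (Finset.mem_insert_self j s))).trans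
        (ih hf' hg')

/-- A quantitative central limit theorem for sums of independent centred Bernoulli variables with
signs. -/
theorem norm_prod_centredBernCharFun_sub_le {J : Type*} (s : Finset J) {τ : ℝ} (hτ : |τ| ≤ 1)
    (x q : J → ℝ) (hx : ∀ j ∈ s, |x j| = |τ|) (h0 : ∀ j ∈ s, 0 ≤ q j) (h1 : ∀ j ∈ s, q j ≤ 1) :
    ‖∏ j ∈ s, centredBernCharFun (x j) (q j) -
      Real.exp (-τ ^ 2 * (∑ j ∈ s, q j * (1 - q j)) / 2)‖ ≤
      2 * |τ| ^ 3 * ∑ j ∈ s, q j * (1 - q j) := by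
  have hexp : (Real.exp (-τ ^ 2 * (∑ j ∈ s, q j * (1 - q j)) / 2) : ℂ) =
      ∏ j ∈ s, (Real.exp (-(x j) ^ 2 * (q j * (1 - q j)) / 2) : ℂ) := by
    rw [← Complex.ofReal_prod, ← Real.exp_sum, Finset.mul_sum, Finset.sum_div]
    congr 2
    refine Finset.sum_congr rfl fun j hj ↦ ?_
    rw [← sq_abs (x j), hx j hj, sq_abs]
  rw [hexp]
  refine (norm_prod_sub_prod_le s _ _
    (fun j hj ↦ norm_centredBernCharFun_le_one _ (h0 j hj) (h1 j hj))
    fun j hj ↦ ?_).trans ?_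
  · rw [Complex.norm_real, Real.norm_of_nonneg (Real.exp_pos _).le, Real.exp_le_one_iff]
    have := mul_nonneg (sq_nonneg (x j)) (mul_nonneg (h0 j hj) (sub_nonneg.mpr (h1 j hj)))
    linarith
  · rw [Finset.mul_sum]
    refine Finset.sum_le_sum fun j hj ↦ ?_
    rw [← hx j hj]
    exact norm_centredBernCharFun_sub_le (by rw [hx j hj]; exact hτ) (h0 j hj) (h1 j hj)

theorem ex_curry {ι κ β E : Type*} [Fintype ι] [DecidableEq ι] [Fintype κ] [DecidableEq κ]
    [Fintype β] [AddCommGroup E] [Module ℝ E] (w : β → ℝ) (g : (ι → κ → β) → E) :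
    ex (fun a : κ → β ↦ ∏ k, w (a k)) g = ex w (fun x : ι × κ → β ↦ g fun i k ↦ x (i, k)) := by
  refine Fintype.sum_equiv (Equiv.curry ι κ β).symm _ _ fun ω ↦ ?_
  rw [Fintype.prod_prod_type]
  rfl

/-- At `θ = 0` the decisions of the vertices are independent. -/
theorem countCharFun_zero (R : Finset (Fin n)) {p : ℝ} (h0 : 0 ≤ p) (h1 : p ≤ 1) (τ : ℝ) :
    countCharFun R p τ 0 = ∏ u, ex (bern p) (fun y ↦ ch τ (dec R u y)) := by
  have hb := isProbWeight_bern h0 h1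
  have hw : tieWeight p 0 = fun a : Bool → Bool ↦ ∏ b, bern p (a b) := by
    ext a
    simp [tieWeight, tie, mul_comm]
  rw [countCharFun, hw, ex_curry (bern p)]
  have hinj : Function.Injective
      (fun x : Fin n × Fin n ↦ (pairIdx x.1 x.2, decide (x.2 < x.1))) := by
    rintro ⟨u, v⟩ ⟨x, y⟩ h
    simp only [Prod.mk.injEq, decide_eq_decide] at h
    obtain ⟨h, h'⟩ := h
    rcases pairIdx_eq_iff.mp h with ⟨rfl, rfl⟩ | ⟨rfl, rfl⟩
    · rfl
    · have : u = v := by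
        rcases lt_trichotomy u v with h | h | h
        · exact absurd (h'.mpr h) h.not_gt
        · exact h
        · exact absurd (h'.mp h) h.not_gt
      rw [this]
  have hmap := ex_map hb (w' := bern p) hinj (fun _ b ↦ b)
    (fun _ b ↦ by simp)
    (fun z : Fin n × Fin n → Bool ↦ ch τ (∑ u, dec R u fun v ↦ z (u, v)))
  have hcount : (fun x : (Fin n × Fin n) × Bool → Bool ↦ ch τ (count R fun i b ↦ x (i, b))) =
      fun x ↦ ch τ (∑ u, dec R u fun v ↦ x (pairIdx u v, decide (v < u))) := rfl
  rw [hcount, hmap, ← ex_curry (bern p) (fun z : Fin n → Fin n → Bool ↦ ch τ (∑ u, dec R u (z u)))]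
  simp only [ch_sum]
  exact ex_prod (fun a : Fin n → Bool ↦ ∏ k, bern p (a k)) (fun u a ↦ ch τ (dec R u a))

theorem decProb_nonneg (R : Finset (Fin n)) {p : ℝ} (h0 : 0 ≤ p) (h1 : p ≤ 1) (u : Fin n) :
    0 ≤ decProb R p u := tailProb_nonneg R h0 h1 _ _

theorem decProb_le_one (R : Finset (Fin n)) {p : ℝ} (h0 : 0 ≤ p) (h1 : p ≤ 1) (u : Fin n) :
    decProb R p u ≤ 1 := tailProb_le_one R h0 h1 _ _

/-- The characteristic function of the centred number of red vertices is close to a Gaussian one. -/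
theorem norm_ex_ch_count_sub_le (R : Finset (Fin n)) {p s : ℝ} (h0 : 0 ≤ p) (h1 : p ≤ 1)
    (hs1 : 1 ≤ s) (hsn : s ^ 2 = n * (p * (1 - p))) {τ : ℝ} (hτ : |τ| ≤ 1) :
    ‖ex (tieWeight p 1) (fun ω ↦ ch τ (count R ω - ∑ u, decProb R p u)) -
      Real.exp (-τ ^ 2 * (∑ u, decProb R p u * (1 - decProb R p u)) / 2)‖ ≤
      2 * |τ| ^ 3 * (∑ u, decProb R p u * (1 - decProb R p u)) +
        (26 * τ ^ 2 * (imbalance R + n / s) + 108 * |τ| ^ 3 * (n * √s)) := by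
  have hb := isProbWeight_bern h0 h1
  set m := ∑ u, decProb R p u with hm
  have hshift : ex (tieWeight p 1) (fun ω ↦ ch τ (count R ω - m)) =
      ch τ (-m) * countCharFun R p τ 1 := by
    rw [countCharFun, ← ex_mul_left]
    congr 1
    ext ω
    rw [← ch_add]; congr 1; ring
  have hzero : ch τ (-m) * countCharFun R p τ 0 =
      ∏ u, centredBernCharFun τ (decProb R p u) := by
    rw [countCharFun_zero R h0 h1, hm, ← Finset.sum_neg_distrib, ch_sum, ← Finset.prod_mul_distrib]
    refine Finset.prod_congr rfl fun u _ ↦ ?_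
    simp only [ch_dec R]
    rw [ex_add, ex_const hb, ex_mul_left, ex_ofReal, ← decProb, centredBernCharFun,
      sub_eq_add_neg 1 (decProb R p u), ch_add]
    push_cast
    ring
  have e1 := norm_prod_centredBernCharFun_sub_le Finset.univ hτ (fun _ : Fin n ↦ τ) (decProb R p)
    (fun _ _ ↦ rfl) (fun u _ ↦ decProb_nonneg R h0 h1 u) (fun u _ ↦ decProb_le_one R h0 h1 u)
  have e2 := norm_countCharFun_sub_le R h0 h1 hs1 hsn τ
  rw [← hzero] at e1
  rw [hshift]
  set g : ℂ := (Real.exp (-τ ^ 2 * (∑ u, decProb R p u * (1 - decProb R p u)) / 2) : ℂ) with hg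
  have : ch τ (-m) * countCharFun R p τ 1 - g = (ch τ (-m) * countCharFun R p τ 0 - g) +
      ch τ (-m) * (countCharFun R p τ 1 - countCharFun R p τ 0) := by ring
  rw [this]
  refine (norm_add_le _ _).trans (add_le_add e1 ?_)
  rwa [norm_mul, norm_ch, one_mul]

theorem signedSum_sub_eq (R : Finset (Fin n)) (p : ℝ) (y : Fin n → Bool) :
    (signedSum R Finset.univ y : ℝ) - p * ∑ z, (eps R z : ℝ) =
      ∑ z, eps R z * (bit (y z) - p) := by
  rw [signedSum, Int.cast_sum, Finset.mul_sum, ← Finset.sum_sub_distrib]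
  refine Finset.sum_congr rfl fun z _ ↦ ?_
  cases y z <;> simp <;> ring

/-- The characteristic function of the centred signed sum over all vertices is close to a Gaussian
one. -/
theorem norm_ex_ch_signedSum_sub_le (R : Finset (Fin n)) {p : ℝ} (h0 : 0 ≤ p) (h1 : p ≤ 1) {τ : ℝ}
    (hτ : |τ| ≤ 1) :
    ‖ex (bern p) (fun y ↦ ch τ (signedSum R Finset.univ y - p * ∑ z, (eps R z : ℝ))) -
      Real.exp (-τ ^ 2 * (n * (p * (1 - p))) / 2)‖ ≤ 2 * |τ| ^ 3 * (n * (p * (1 - p))) := by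
  have e1 := norm_prod_centredBernCharFun_sub_le Finset.univ hτ (fun z : Fin n ↦ τ * eps R z)
    (fun _ ↦ p) (fun z _ ↦ by
      rcases eps_eq_or R z with h | h <;> simp [h]) (fun _ _ ↦ h0) (fun _ _ ↦ h1)
  simp only [Finset.sum_const, Finset.card_univ, Fintype.card_fin, nsmul_eq_mul] at e1
  convert e1 using 3
  have h : ∀ y : Fin n → Bool, ch τ (signedSum R Finset.univ y - p * ∑ z, (eps R z : ℝ)) =
      ∏ z, ch (τ * eps R z) (bit (y z) - p) := by
    intro y
    rw [signedSum_sub_eq, ch_sum]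
    refine Finset.prod_congr rfl fun z _ ↦ ?_
    simp only [ch, mul_assoc]
  simp only [h]
  rw [ex_prod (bern p) (fun z b ↦ ch (τ * eps R z) (bit b - p))]
  refine Finset.prod_congr rfl fun z _ ↦ ?_
  simp [bern, centredBernCharFun]

/-- The law of a random variable on a finite product space. -/
noncomputable def exLaw {ι α : Type*} [Fintype ι] [DecidableEq ι] [Fintype α] (w : α → ℝ)
    (X : (ι → α) → ℝ) : Measure ℝ :=
  ∑ ω : ι → α, ENNReal.ofReal (∏ i, w (ω i)) • Measure.dirac (X ω)

section Law

variable {ι α : Type*} [Fintype ι] [DecidableEq ι] [Fintype α] {w : α → ℝ} (hw : IsProbWeight w)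
  (X : (ι → α) → ℝ)

include hw

theorem isProbabilityMeasure_exLaw : IsProbabilityMeasure (exLaw w X) := by
  constructor
  rw [exLaw, Measure.finsetSum_apply]
  simp only [Measure.smul_apply, measure_univ, smul_eq_mul, mul_one]
  rw [← ENNReal.ofReal_sum_of_nonneg fun _ _ ↦ Finset.prod_nonneg fun _ _ ↦ hw.nonneg _,
    sum_prod_weight hw, ENNReal.ofReal_one]

theorem integral_exLaw {E : Type*} [NormedAddCommGroup E] [NormedSpace ℝ E] [CompleteSpace E]
    (f : ℝ → E) : ∫ x, f x ∂(exLaw w X) = ex w (fun ω ↦ f (X ω)) := by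
  rw [exLaw, integral_finsetSum_measure fun _ _ ↦
    (integrable_dirac (by simp)).smul_measure ENNReal.ofReal_ne_top]
  refine Finset.sum_congr rfl fun ω _ ↦ ?_
  rw [integral_smul_measure, integral_dirac,
    ENNReal.toReal_ofReal (Finset.prod_nonneg fun _ _ ↦ hw.nonneg _)]

theorem charFun_exLaw (t : ℝ) : charFun (exLaw w X) t = ex w (fun ω ↦ ch t (X ω)) := by
  rw [charFun_apply_real, integral_exLaw hw]
  congr 1
  ext ω
  rw [ch]
  congr 1
  push_cast
  ring

theorem exLaw_real_Icc (a b : ℝ) :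
    (exLaw w X).real (Set.Icc a b) = ex w (fun ω ↦ (Set.Icc a b).indicator 1 (X ω)) := by
  have := isProbabilityMeasure_exLaw hw X
  rw [← integral_exLaw hw X (fun x ↦ (Set.Icc a b).indicator (1 : ℝ → ℝ) x),
    integral_indicator_one measurableSet_Icc]

end Law

theorem gaussianReal_real_Icc {a b : ℝ} (hab : a ≤ b) :
    (gaussianReal 0 1).real (Set.Icc a b) =
      (√(2 * Real.pi))⁻¹ * ∫ x in a..b, Real.exp (-x ^ 2 / 2) := by
  rw [measureReal_def, gaussianReal_apply_eq_integral 0 one_ne_zero, ENNReal.toReal_ofReal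
    (setIntegral_nonneg measurableSet_Icc fun x _ ↦ gaussianPDFReal_nonneg 0 1 x),
    integral_Icc_eq_integral_Ioc, intervalIntegral.integral_of_le hab, ← integral_const_mul]
  simp [gaussianPDFReal]

/-- Lévy's continuity theorem for random variables on finite product spaces. -/
theorem tendsto_ex_indicator_Icc {ι α : ℕ → Type} [∀ k, Fintype (ι k)] [∀ k, DecidableEq (ι k)]
    [∀ k, Fintype (α k)] {w : ∀ k, α k → ℝ} (hw : ∀ k, IsProbWeight (w k))
    (X : ∀ k, (ι k → α k) → ℝ)
    (h : ∀ t : ℝ, Tendsto (fun k ↦ ex (w k) (fun ω ↦ ch t (X k ω))) atTop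
      (𝓝 (Real.exp (-t ^ 2 / 2) : ℂ))) {a b : ℝ} (hab : a ≤ b) :
    Tendsto (fun k ↦ ex (w k) (fun ω ↦ (Set.Icc a b).indicator (1 : ℝ → ℝ) (X k ω))) atTop
      (𝓝 ((√(2 * Real.pi))⁻¹ * ∫ x in a..b, Real.exp (-x ^ 2 / 2))) := by
  let P : ℕ → ProbabilityMeasure ℝ := fun k ↦
    ⟨exLaw (w k) (X k), isProbabilityMeasure_exLaw (hw k) (X k)⟩
  let P₀ : ProbabilityMeasure ℝ := ⟨gaussianReal 0 1, inferInstance⟩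
  have hP : Tendsto P atTop (𝓝 P₀) := by
    refine ProbabilityMeasure.tendsto_iff_tendsto_charFun.mpr fun t ↦ ?_
    have h1 : charFun (P₀ : Measure ℝ) t = (Real.exp (-t ^ 2 / 2) : ℂ) := by
      change charFun (gaussianReal 0 1) t = _
      rw [charFun_gaussianReal]
      push_cast
      congr 1
      simp
      ring
    rw [h1]
    refine (h t).congr fun k ↦ ?_
    exact (charFun_exLaw (hw k) (X k) t).symm
  have hfr : (P₀ : Measure ℝ) (frontier (Set.Icc a b)) = 0 := by
    have : NullSingletonClass (gaussianReal 0 1) := nullSingletonClass_gaussianReal one_ne_zero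
    change gaussianReal 0 1 (frontier (Set.Icc a b)) = 0
    rw [frontier_Icc hab]
    exact (Set.toFinite _).measure_zero _
  have := ProbabilityMeasure.tendsto_measure_of_null_frontier_of_tendsto' hP hfr
  have h2 := (ENNReal.tendsto_toReal (measure_ne_top (P₀ : Measure ℝ) (Set.Icc a b))).comp this
  rw [← gaussianReal_real_Icc hab]
  refine h2.congr fun k ↦ ?_
  exact exLaw_real_Icc (hw k) (X k) a b

/-! ### The random graph and the binomial laws as finite product spaces -/

theorem signedSum_eq_card_sub_card (R : Finset (Fin n)) (y : Fin n → Bool) :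
    signedSum R Finset.univ y = (#{z ∈ R | y z = true} : ℤ) - #{z ∈ Rᶜ | y z = true} := by
  have h : ∀ Z : Finset (Fin n), (#{z ∈ Z | y z = true} : ℤ) =
      ∑ z, if z ∈ Z then (if y z then 1 else 0) else 0 := by
    intro Z
    rw [Finset.card_filter]
    push_cast
    rw [Finset.sum_ite_mem, Finset.univ_inter]
  rw [h, h, ← Finset.sum_sub_distrib, signedSum]
  refine Finset.sum_congr rfl fun z _ ↦ ?_
  by_cases hR : z ∈ R <;> cases y z <;> simp [eps, hR]

theorem numRed_eq_sum_dec (R : Finset (Fin n)) (G : SimpleGraph (Fin n)) (y : Fin n → Fin n → Bool)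
    (hy : ∀ u z, z ≠ u → (y u z = true ↔ G.Adj u z)) : numRed R G = ∑ u, dec R u (y u) := by
  classical
  rw [numRed, redAfterStep, Finset.card_filter]
  push_cast
  refine Finset.sum_congr rfl fun u _ ↦ ?_
  rw [dec]
  have h1 : signedSum R (Finset.univ.erase u) (y u) =
      signedSum R Finset.univ (fun z ↦ decide (G.Adj u z)) := by
    unfold signedSum
    rw [← Finset.add_sum_erase Finset.univ _ (Finset.mem_univ u)]
    simp only [SimpleGraph.irrefl, decide_false, Bool.false_eq_true, if_false, zero_add]
    refine Finset.sum_congr rfl fun z hz ↦ ?_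
    have := hy u z (Finset.ne_of_mem_erase hz)
    by_cases h : G.Adj u z <;> simp [this, h]
  have h2 : ∀ S : Finset (Fin n), degreeInto G u S = #{z ∈ S | decide (G.Adj u z) = true} := by
    intro S
    rw [degreeInto]
    congr 1
    ext z
    simp
  rw [h1, signedSum_eq_card_sub_card, ← h2, ← h2, thr]
  congr 1
  rw [eq_iff_iff]
  by_cases hR : u ∈ R <;> simp only [hR, if_true, if_false, and_true, and_false, or_false] <;> omega

instance : MeasurableSingletonClass (SimpleGraph (Fin n)) where
  measurableSet_singleton G := by
    have : ({G} : Set (SimpleGraph (Fin n))) = SimpleGraph.edgeSet ⁻¹' {G.edgeSet} := by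
      ext G'
      simp
    rw [this]
    exact SimpleGraph.measurable_edgeSet (MeasurableSet.singleton _)

/-- The potential edges of a graph on `Fin n`. -/
abbrev PotentialEdge (n : ℕ) : Type := {e : Sym2 (Fin n) // ¬ e.IsDiag}

/-- Graphs are the same as indicator functions on the potential edges. -/
noncomputable def graphEquiv (n : ℕ) : SimpleGraph (Fin n) ≃ (PotentialEdge n → Bool) where
  toFun G := open Classical in fun e ↦ decide (e.1 ∈ G.edgeSet)
  invFun c := SimpleGraph.fromEdgeSet {e | ∃ h : ¬ e.IsDiag, c ⟨e, h⟩ = true}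
  left_inv G := by
    ext u v
    simp only [SimpleGraph.fromEdgeSet_adj, Set.mem_ofPred_eq, Sym2.mk_isDiag_iff,
      decide_eq_true_eq, SimpleGraph.mem_edgeSet, exists_prop]
    exact ⟨fun h ↦ h.1.2, fun h ↦ ⟨⟨h.ne, h⟩, h.ne⟩⟩
  right_inv c := by
    ext ⟨e, he⟩
    induction e using Sym2.ind with
    | _ u v =>
      have huv : u ≠ v := he
      simp [huv]

theorem prod_bern {κ : Type*} [Fintype κ] (p : ℝ) (c : κ → Bool) :
    ∏ e, bern p (c e) = p ^ #{e | c e = true} * (1 - p) ^ (Fintype.card κ - #{e | c e = true}) := by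
  unfold bern
  rw [Finset.prod_ite, Finset.prod_const, Finset.prod_const]
  congr 2
  rw [← Finset.card_univ, ← Finset.card_filter_add_card_filter_not (s := Finset.univ)
    (fun e ↦ c e = true), Nat.add_sub_cancel_left]

theorem gnp_real_singleton (p : unitInterval) (G : SimpleGraph (Fin n)) :
    (gnp n p).real {G} = ∏ e, bern p (graphEquiv n G e) := by
  classical
  rw [prod_bern, measureReal_def, SimpleGraph.binomialRandom_singleton]
  have hcard : #{e | graphEquiv n G e = true} = G.edgeSet.ncard := by
    rw [← Set.ncard_coe_finset]
    refine Set.ncard_congr (fun e _ ↦ e.1) ?_ ?_ ?_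
    · intro e he
      simpa [graphEquiv] using he
    · intro e e' _ _ h
      exact Subtype.ext h
    · intro e he
      exact ⟨⟨e, G.not_isDiag_of_mem_edgeSet he⟩, by simpa [graphEquiv] using he, rfl⟩
  rw [hcard, Sym2.card_subtype_not_diag, Fintype.card_fin, Nat.card_eq_fintype_card,
    Fintype.card_fin]
  simp

theorem integral_gnp (p : unitInterval) (f : SimpleGraph (Fin n) → ℝ) :
    ∫ G, f G ∂(gnp n p) = ex (bern p) (fun c ↦ f ((graphEquiv n).symm c)) := by
  classical
  rw [integral_fintype (Integrable.of_finite), ex]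
  refine Fintype.sum_equiv (graphEquiv n) _ _ fun G ↦ ?_
  rw [gnp_real_singleton, Equiv.symm_apply_apply]

theorem tieWeight_one_ne_zero {p : ℝ} {a : Bool → Bool} (h : tieWeight p 1 a ≠ 0) :
    a false = a true := by
  by_contra hne
  exact h (by simp [tieWeight, tie, hne])

/-- At `θ = 1` the interpolated model is the random graph. -/
theorem integral_gnp_numRed (R : Finset (Fin n)) (p : unitInterval) (F : ℝ → ℝ) :
    ∫ G, F (numRed R G) ∂(gnp n p) = ex (tieWeight p 1) (fun ω ↦ F (count R ω)) := by
  classical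
  have hw := isProbWeight_tieWeight p.2.1 p.2.2 zero_le_one le_rfl
  let row : (PotentialEdge n → Bool) → Fin n → Fin n → Bool := fun c u z ↦
    if h : u ≠ z then c ⟨s(u, z), by simpa using h⟩ else false
  let φ : PotentialEdge n → Fin n × Fin n := fun e ↦ Sym2.lift ⟨pairIdx, pairIdx_comm⟩ e.1
  have hφ : Function.Injective φ := by
    rintro ⟨e, he⟩ ⟨e', he'⟩ h
    induction e using Sym2.ind with
    | _ u v =>
      induction e' using Sym2.ind with
      | _ x y =>
        simp only [φ, Sym2.lift_mk] at h
        simp only [Subtype.mk.injEq, Sym2.eq_iff]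
        exact pairIdx_eq_iff.mp h
  have hmap := ex_map hw (w' := bern p) hφ (fun _ a ↦ a false)
    (fun _ b ↦ sum_tieWeight_ite false b) (fun c ↦ F (∑ u, dec R u (row c u)))
  rw [integral_gnp]
  have h1 : ∀ c, numRed R ((graphEquiv n).symm c) = ∑ u, dec R u (row c u) := by
    intro c
    refine numRed_eq_sum_dec R _ _ fun u z hzu ↦ ?_
    simp [row, graphEquiv, hzu.symm]
  simp only [h1]
  rw [← hmap]
  refine ex_congr_support fun ω hω ↦ ?_
  congr 1
  refine Finset.sum_congr rfl fun u _ ↦ dec_congr R u fun z hzu ↦ ?_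
  simp only [row, φ, dif_pos hzu.symm, Sym2.lift_mk, entry]
  have := tieWeight_one_ne_zero (hω (pairIdx u z))
  cases decide (z < u) <;> simp [this]

theorem meanRed_eq (R : Finset (Fin n)) (p : unitInterval) : meanRed R p = ∑ u, decProb R p u := by
  rw [meanRed, integral_gnp_numRed R p (fun x ↦ x)]
  exact ex_count p.2.1 p.2.2 zero_le_one le_rfl R

theorem varRed_eq (R : Finset (Fin n)) (p : unitInterval) :
    varRed R p = ∑ u, decProb R p u * (1 - decProb R p u) + p * (1 - p) * pairSum R p := by
  have hX : MemLp (numRed R) 2 (gnp n p) := MemLp.of_discrete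
  have h := ex_count_sq_sub p.2.1 p.2.2 zero_le_one (le_refl (1 : ℝ)) R
  rw [varRed, variance_eq_sub hX]
  simp only [Pi.pow_apply]
  rw [integral_gnp_numRed R p (fun x ↦ x ^ 2), integral_gnp_numRed R p (fun x ↦ x)]
  rw [show ex (tieWeight p 1) (fun ω ↦ count R ω) = ∑ u, decProb R p u from
    ex_count p.2.1 p.2.2 zero_le_one le_rfl R, h, one_mul]

theorem gnp_real_eq (R : Finset (Fin n)) (p : unitInterval) (m s a b : ℝ) :
    (gnp n p).real {G | (numRed R G - m) / s ∈ Set.Icc a b} =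
      ex (tieWeight p 1) (fun ω ↦ (Set.Icc a b).indicator (1 : ℝ → ℝ) ((count R ω - m) / s)) := by
  rw [← integral_gnp_numRed R p (fun x ↦ (Set.Icc a b).indicator (1 : ℝ → ℝ) ((x - m) / s)),
    ← integral_indicator_one (Set.toFinite _).measurableSet]
  rfl

theorem ex_card_eq_integral_binomial (p : unitInterval) (Z : Finset (Fin n)) (φ : ℕ → ℝ) :
    ex (bern p) (fun y : Fin n → Bool ↦ φ #{z ∈ Z | y z = true}) = ∫ k, φ k ∂(binomial #Z p) := by
  have hb := isProbWeight_bern p.2.1 p.2.2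
  have hmap := ex_map hb (w' := bern p) (φ := fun z : Z ↦ z.1) Subtype.val_injective (fun _ b ↦ b)
    (fun _ b ↦ by simp) (fun c : Z → Bool ↦ φ #{z | c z = true})
  have hcard : ∀ y : Fin n → Bool, #{z : Z | y z.1 = true} = #{z ∈ Z | y z = true} := by
    intro y
    rw [Finset.card_filter, Finset.card_filter]
    exact Finset.sum_coe_sort Z (fun z ↦ if y z = true then 1 else 0)
  simp only [hcard] at hmap
  rw [hmap, integral_binomial, ex]
  have h1 : ∀ c : Z → Bool, (∏ i, bern p (c i)) • φ #{z | c z = true} =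
      (fun k ↦ (p : ℝ) ^ k * (1 - p) ^ (#Z - k) * φ k) #{z | c z = true} := by
    intro c
    rw [prod_bern, Fintype.card_coe, smul_eq_mul]
  rw [Finset.sum_congr rfl fun c _ ↦ h1 c]
  have h2 := Finset.sum_powerset_apply_card (fun k ↦ (p : ℝ) ^ k * (1 - p) ^ (#Z - k) * φ k)
    (x := (Finset.univ : Finset Z))
  rw [Finset.card_univ, Fintype.card_coe] at h2
  have h3 : ∑ c : Z → Bool, (fun k ↦ (p : ℝ) ^ k * (1 - p) ^ (#Z - k) * φ k) #{z | c z = true} =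
      ∑ m ∈ (Finset.univ : Finset Z).powerset, (p : ℝ) ^ #m * (1 - p) ^ (#Z - #m) * φ #m := by
    refine Finset.sum_bij' (fun c _ ↦ Finset.univ.filter fun z ↦ c z = true)
      (fun m _ z ↦ decide (z ∈ m)) (by simp) (by simp) (by simp) (fun m _ ↦ ?_) (by simp)
    ext z
    simp
  rw [h3, h2]
  have h4 : Finset.Iic #Z = Finset.range (#Z + 1) := by
    ext k; simp
  rw [h4]
  refine Finset.sum_congr rfl fun k _ ↦ ?_
  rw [nsmul_eq_mul, smul_eq_mul]
  ring

theorem binomial_prod_real_eq (R : Finset (Fin n)) (p : unitInterval) (S : Set (ℕ × ℕ)) :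
    ((binomial #R p).prod (binomial #Rᶜ p)).real S = ex (bern p) (fun y : Fin n → Bool ↦
      S.indicator (1 : ℕ × ℕ → ℝ) (#{z ∈ R | y z = true}, #{z ∈ Rᶜ | y z = true})) := by
  have hb := isProbWeight_bern p.2.1 p.2.2
  have hS : MeasurableSet S := S.to_countable.measurableSet
  rw [← integral_indicator_one hS, integral_prod (S.indicator (1 : ℕ × ℕ → ℝ))
    ((integrable_const (1 : ℝ)).indicator hS)]
  simp only [← ex_card_eq_integral_binomial]
  rw [ex_swap hb (↑Rᶜ : Set (Fin n)) (fun y' y : Fin n → Bool ↦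
    S.indicator (1 : ℕ × ℕ → ℝ) (#{z ∈ R | y z = true}, #{z ∈ Rᶜ | y' z = true}))]
  · intro y y₁ y₂ h
    have : (Finset.filter (fun z ↦ y₁ z = true) Rᶜ) = Finset.filter (fun z ↦ y₂ z = true) Rᶜ :=
      Finset.filter_congr fun z hz ↦ by rw [h z (Finset.mem_coe.mpr hz)]
    simp only [this]
  · intro y y₁ y₂ h
    have : (Finset.filter (fun z ↦ y₁ z = true) R) = Finset.filter (fun z ↦ y₂ z = true) R :=
      Finset.filter_congr fun z hz ↦ by
        rw [h z fun hz' ↦ Finset.mem_compl.mp (Finset.mem_coe.mp hz') hz]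
    simp only [this]

theorem one_sub_tailProb_one (R : Finset (Fin n)) {p : ℝ} (h0 : 0 ≤ p) (h1 : p ≤ 1) :
    1 - tailProb R p Finset.univ 1 =
      ex (bern p) (fun y ↦ if signedSum R Finset.univ y ≤ 0 then (1 : ℝ) else 0) := by
  rw [tailProb]
  conv_lhs => enter [1]; rw [← ex_const (ι := Fin n) (isProbWeight_bern h0 h1) (1 : ℝ)]
  rw [← ex_sub]
  congr 1
  ext y
  split_ifs <;> first | omega | norm_num

theorem mu_eq (R : Finset (Fin n)) (p : unitInterval) :
    mu R p = tailProb R p Finset.univ 0 * (1 - tailProb R p Finset.univ 1) := by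
  rw [mu, one_sub_tailProb_one R p.2.1 p.2.2, tailProb, binomial_prod_real_eq,
    binomial_prod_real_eq]
  congr 2 <;>
  · ext y
    rw [signedSum_eq_card_sub_card, Set.indicator_apply]
    simp only [Set.mem_ofPred_eq, Pi.one_apply]
    congr 1
    rw [eq_iff_iff]
    omega

/-! ### Bounds for `μ` -/

theorem mu_le_one (R : Finset (Fin n)) (p : unitInterval) : mu R p ≤ 1 := by
  rw [mu_eq]
  have h0 := p.2.1
  have h1 := p.2.2
  have a := tailProb_nonneg R h0 h1 Finset.univ 1
  exact mul_le_one₀ (tailProb_le_one R h0 h1 _ _)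
    (sub_nonneg.mpr (tailProb_le_one R h0 h1 Finset.univ 1)) (by linarith)

/-- Both factors of `μ` are positive: with positive probability both binomial variables vanish. -/
theorem mu_pos (R : Finset (Fin n)) {p : unitInterval} (hp : (p : ℝ) < 1) : 0 < mu R p := by
  have h0 := p.2.1
  have h1 := p.2.2
  have hw : 0 < ∏ _i : Fin n, bern (p : ℝ) false :=
    Finset.prod_pos fun _ _ ↦ by simp [bern, hp]
  have hb := isProbWeight_bern h0 h1
  have hS : signedSum R Finset.univ (fun _ ↦ false) = 0 := by simp [signedSum]
  have key : ∀ f : (Fin n → Bool) → ℝ, (∀ y, 0 ≤ f y) → f (fun _ ↦ false) = 1 →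
      0 < ex (bern (p : ℝ)) f := by
    intro f hf hf1
    refine Finset.sum_pos' (fun y _ ↦ mul_nonneg (Finset.prod_nonneg fun _ _ ↦ hb.nonneg _) (hf y))
      ⟨fun _ ↦ false, Finset.mem_univ _, ?_⟩
    rw [hf1, smul_eq_mul, mul_one]
    exact hw
  rw [mu_eq, one_sub_tailProb_one R h0 h1]
  refine mul_pos (key _ (fun y ↦ by split_ifs <;> simp) (by simp [hS]))
    (key _ (fun y ↦ by split_ifs <;> simp) (by simp [hS]))

theorem ex_signedSum_sub_sq (R : Finset (Fin n)) {p : ℝ} (h0 : 0 ≤ p) (h1 : p ≤ 1) :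
    ex (bern p) (fun y ↦ ((signedSum R Finset.univ y : ℝ) - p * ∑ z, (eps R z : ℝ)) ^ 2) =
      n * (p * (1 - p)) := by
  have h : ∀ y : Fin n → Bool, ((signedSum R Finset.univ y : ℝ) - p * ∑ z, (eps R z : ℝ)) ^ 2 =
      ∑ z, ∑ z', (eps R z * eps R z' : ℝ) * ((bit (y z) - p) * (bit (y z') - p)) := by
    intro y
    rw [signedSum_sub_eq, sq, Finset.sum_mul_sum]
    exact Finset.sum_congr rfl fun z _ ↦ Finset.sum_congr rfl fun z' _ ↦ by ring
  simp only [h]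
  rw [ex_sum]
  have h2 : ∀ z, ex (bern p) (fun y : Fin n → Bool ↦
      ∑ z', (eps R z * eps R z' : ℝ) * ((bit (y z) - p) * (bit (y z') - p))) = p * (1 - p) := by
    intro z
    rw [ex_sum]
    simp only [ex_mul_left, ex_bern_sub_mul_sub h0 h1]
    simp [eps_mul_self]
  simp [h2]

/-- Chebyshev's inequality bounds the imbalance in terms of `μ`. -/
theorem imbalance_sq_mul_mu_le (R : Finset (Fin n)) (p : unitInterval) :
    (p * imbalance R) ^ 2 * mu R p ≤ n * (p * (1 - p)) := by
  have h0 := p.2.1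
  have h1 := p.2.2
  have hb := isProbWeight_bern h0 h1
  set M : ℝ := p * ∑ z, (eps R z : ℝ) with hM
  have hMi : (p * imbalance R) ^ 2 = M ^ 2 := by
    rw [← abs_sum_eps, mul_pow, sq_abs, hM, mul_pow]
  rw [hMi, ← ex_signedSum_sub_sq R h0 h1]
  have hT0 := tailProb_nonneg R h0 h1 Finset.univ 0
  have hT0' := tailProb_le_one R h0 h1 Finset.univ 0
  have hT1 := tailProb_nonneg R h0 h1 Finset.univ 1
  have hT1' := tailProb_le_one R h0 h1 Finset.univ 1
  rcases le_total 0 M with hpos | hneg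
  · have hmu : mu R p ≤ 1 - tailProb R p Finset.univ 1 := by
      rw [mu_eq]; exact mul_le_of_le_one_left (by linarith) hT0'
    refine (mul_le_mul_of_nonneg_left hmu (sq_nonneg M)).trans ?_
    rw [one_sub_tailProb_one R h0 h1, ← ex_mul_left]
    refine ex_mono hb fun y ↦ ?_
    split_ifs with h
    · have : (signedSum R Finset.univ y : ℝ) ≤ 0 := by exact_mod_cast h
      nlinarith
    · nlinarith
  · have hmu : mu R p ≤ tailProb R p Finset.univ 0 := by
      rw [mu_eq]; exact mul_le_of_le_one_right hT0 (by linarith)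
    refine (mul_le_mul_of_nonneg_left hmu (sq_nonneg M)).trans ?_
    rw [tailProb, ← ex_mul_left]
    refine ex_mono hb fun y ↦ ?_
    split_ifs with h
    · have : (0 : ℝ) ≤ signedSum R Finset.univ y := by exact_mod_cast h
      nlinarith
    · nlinarith

theorem sigma_sq (n : ℕ) (p : unitInterval) : sigma n p ^ 2 = n * ((p : ℝ) * (1 - p)) := by
  have h0 := p.2.1
  have h1 : 0 ≤ 1 - (p : ℝ) := sub_nonneg.mpr p.2.2
  rw [sigma, Real.sq_sqrt (by positivity), mul_assoc]

theorem abs_varRed_sub_le (R : Finset (Fin n)) (p : unitInterval) (hs : 0 < sigma n p) :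
    |varRed R p - n * mu R p| ≤ 60 * (imbalance R + n / sigma n p) := by
  have h0 := p.2.1
  have h1 := p.2.2
  have e1 := abs_sum_decProb_sub_le h0 h1 hs (sigma_sq n p) R
  have e2 := abs_pairSum_le h0 h1 hs (sigma_sq n p) R
  have hi := imbalance_nonneg R
  have hpq : 0 ≤ (p : ℝ) * (1 - p) := mul_nonneg h0 (sub_nonneg.mpr h1)
  rw [← mu_eq] at e1
  rw [varRed_eq, add_sub_right_comm]
  refine (abs_add_le _ _).trans ?_
  rw [abs_mul, abs_of_nonneg hpq]
  linarith

/-! ### Asymptotics -/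

/-- The growth rates that follow from `μ ≥ σ ^ (-1/6)` and Chebyshev's inequality; here `N = n`,
`m = μ` and `D = Δ`. -/
theorem rates {N s m D : ℝ} (hs1 : 1 ≤ s) (hm0 : 0 < m) (hm1 : m ≤ 1) (hm6 : 1 ≤ s * m ^ 6)
    (hN : 4 * s ^ 2 ≤ N) (hD : D ^ 2 * s ^ 2 * m ≤ N ^ 2) :
    N / s ≤ N * m / √s ∧ D ≤ N * m / √s ∧ s ≤ N * m ∧ N * √s * √(√s) ≤ √(N * m) ^ 3 := by
  have hs : 0 < s := by linarith
  have hN0 : 0 < N := by nlinarith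
  have hq : 0 < √s := Real.sqrt_pos.mpr hs
  have hqs : √s ^ 2 = s := Real.sq_sqrt hs.le
  have hq1 : 1 ≤ √s := Real.one_le_sqrt.mpr hs1
  have h3 : √s ≤ s * m ^ 3 := by
    rw [Real.sqrt_le_left (by positivity)]
    calc s = s * 1 := (mul_one s).symm
      _ ≤ s * (s * m ^ 6) := by gcongr
      _ = (s * m ^ 3) ^ 2 := by ring
  have h31 : s * m ^ 3 ≤ s * m := by
    gcongr
    exact pow_le_of_le_one hm0.le hm1 (by norm_num)
  refine ⟨?_, ?_, ?_, ?_⟩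
  · rw [div_le_div_iff₀ hs hq]
    calc N * √s ≤ N * (s * m) := by gcongr; exact h3.trans h31
      _ = N * m * s := by ring
  · rw [le_div_iff₀ hq]
    refine abs_le_of_sq_le_sq' ?_ (by positivity) |>.2
    rw [mul_pow, hqs]
    have hsm : 0 < s * m := by positivity
    refine le_of_mul_le_mul_right ?_ hsm
    calc D ^ 2 * s * (s * m) = D ^ 2 * s ^ 2 * m := by ring
      _ ≤ N ^ 2 * 1 := by rw [mul_one]; exact hD
      _ ≤ N ^ 2 * (s * m ^ 3) := by gcongr; linarith
      _ = (N * m) ^ 2 * (s * m) := by ring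
  · have : s * 1 ≤ s * (s * m) := by gcongr; linarith
    nlinarith
  · refine abs_le_of_sq_le_sq' ?_ (by positivity) |>.2
    have e1 : (√(N * m) ^ 3) ^ 2 = (N * m) ^ 3 := by
      rw [← pow_mul, mul_comm 3 2, pow_mul, Real.sq_sqrt (by positivity)]
    rw [e1, mul_pow, mul_pow, hqs, Real.sq_sqrt hq.le]
    calc N ^ 2 * s * √s ≤ N ^ 2 * s * (s * m ^ 3) := by gcongr
      _ = N ^ 2 * m ^ 3 * s ^ 2 := by ring
      _ ≤ N ^ 2 * m ^ 3 * N := by gcongr; nlinarith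
      _ = (N * m) ^ 3 := by ring

section Sequence

variable {n : ℕ → ℕ} {p : ℕ → unitInterval} {R : ∀ k, Finset (Fin (n k))}
  (hσ : Tendsto (fun k ↦ sigma (n k) (p k)) atTop atTop)

include hσ

theorem eventually_mu_pos : ∀ᶠ k in atTop, 0 < mu (R k) (p k) := by
  filter_upwards [hσ.eventually_gt_atTop 0] with k hk
  refine mu_pos _ (lt_of_le_of_ne (p k).2.2 fun h ↦ hk.ne' ?_)
  simp [sigma, h]

/-- If `log (1/μ) = o(log σ)` then all error terms are negligible. -/
theorem eventually_rates
    (hμ : (fun k ↦ Real.log (1 / mu (R k) (p k))) =o[atTop]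
      (fun k ↦ Real.log (sigma (n k) (p k)))) :
    ∀ᶠ k in atTop, 1 ≤ sigma (n k) (p k) ∧ 0 < mu (R k) (p k) ∧
      n k / sigma (n k) (p k) ≤ n k * mu (R k) (p k) / √(sigma (n k) (p k)) ∧
      imbalance (R k) ≤ n k * mu (R k) (p k) / √(sigma (n k) (p k)) ∧
      sigma (n k) (p k) ≤ n k * mu (R k) (p k) ∧
      n k * √(sigma (n k) (p k)) * √(√(sigma (n k) (p k))) ≤ √(n k * mu (R k) (p k)) ^ 3 := by
  filter_upwards [hσ.eventually_ge_atTop 1, eventually_mu_pos (R := R) hσ,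
    hμ.bound (show (0 : ℝ) < 1 / 6 by norm_num)] with k hs1 hm0 hlog
  have hs : 0 < sigma (n k) (p k) := by linarith
  have hsq := sigma_sq (n k) (p k)
  refine ⟨hs1, hm0, rates hs1 hm0 (mu_le_one _ _) ?_ ?_ ?_⟩
  · rw [Real.norm_eq_abs, Real.norm_eq_abs, abs_of_nonneg (Real.log_nonneg hs1)] at hlog
    have h1 := (le_abs_self _).trans hlog
    rw [one_div, Real.log_inv] at h1
    have h2 : 0 ≤ Real.log (sigma (n k) (p k) * mu (R k) (p k) ^ 6) := by
      rw [Real.log_mul hs.ne' (by positivity), Real.log_pow]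
      push_cast
      linarith
    exact (Real.log_nonneg_iff (by positivity)).mp h2
  · linarith [sigma_sq_le hs hsq]
  · have hc := imbalance_sq_mul_mu_le (R k) (p k)
    rw [← hsq] at hc
    have hp0 := (p k).2.1
    have hp1 := (p k).2.2
    set s := sigma (n k) (p k)
    set q : ℝ := ((p k : unitInterval) : ℝ)
    have hle : s ^ 2 ≤ n k * q := by
      rw [hsq]
      have : q * (1 - q) ≤ q := mul_le_of_le_one_right hp0 (by linarith)
      gcongr
    have hs2 : 0 < s ^ 2 := by positivity
    refine le_of_mul_le_mul_right ?_ hs2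
    calc imbalance (R k) ^ 2 * s ^ 2 * mu (R k) (p k) * s ^ 2
        = imbalance (R k) ^ 2 * mu (R k) (p k) * (s ^ 2) ^ 2 := by ring
      _ ≤ imbalance (R k) ^ 2 * mu (R k) (p k) * (n k * q) ^ 2 := by gcongr
      _ = (n k) ^ 2 * ((q * imbalance (R k)) ^ 2 * mu (R k) (p k)) := by ring
      _ ≤ (n k) ^ 2 * s ^ 2 := by gcongr

theorem varRed_isEquivalent
    (hμ : (fun k ↦ Real.log (1 / mu (R k) (p k))) =o[atTop]
      (fun k ↦ Real.log (sigma (n k) (p k)))) :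
    (fun k ↦ varRed (R k) (p k)) ~[atTop] (fun k ↦ (n k : ℝ) * mu (R k) (p k)) := by
  refine IsLittleO.of_bound fun c hc ↦ ?_
  have hsq : Tendsto (fun k ↦ √(sigma (n k) (p k))) atTop atTop :=
    Real.tendsto_sqrt_atTop.comp hσ
  filter_upwards [eventually_rates hσ hμ, hsq.eventually_ge_atTop (120 / c)] with k hk hkc
  obtain ⟨hs1, hm0, r1, r2, -, -⟩ := hk
  have hs : 0 < sigma (n k) (p k) := by linarith
  have hq : 0 < √(sigma (n k) (p k)) := Real.sqrt_pos.mpr hs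
  rw [Pi.sub_apply, Real.norm_eq_abs, Real.norm_of_nonneg (by positivity)]
  rw [div_le_iff₀ hc] at hkc
  have hNm : 0 ≤ (n k : ℝ) * mu (R k) (p k) := by positivity
  calc |varRed (R k) (p k) - n k * mu (R k) (p k)|
      ≤ 60 * (imbalance (R k) + n k / sigma (n k) (p k)) := abs_varRed_sub_le _ _ hs
    _ ≤ 120 * (n k * mu (R k) (p k) / √(sigma (n k) (p k))) := by linarith
    _ ≤ c * (n k * mu (R k) (p k)) := by
        rw [mul_div_assoc', div_le_iff₀ hq]
        nlinarith

theorem tendsto_ex_ch_count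
    (hμ : (fun k ↦ Real.log (1 / mu (R k) (p k))) =o[atTop]
      (fun k ↦ Real.log (sigma (n k) (p k)))) (t : ℝ) :
    Tendsto (fun k ↦ ex (tieWeight (p k) 1) (fun ω ↦ ch t ((count (R k) ω - meanRed (R k) (p k)) /
      √((n k : ℝ) * mu (R k) (p k))))) atTop (𝓝 (Real.exp (-t ^ 2 / 2) : ℂ)) := by
  have hsq : Tendsto (fun k ↦ √(sigma (n k) (p k))) atTop atTop :=
    Real.tendsto_sqrt_atTop.comp hσ
  have hsq2 : Tendsto (fun k ↦ √(√(sigma (n k) (p k)))) atTop atTop :=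
    Real.tendsto_sqrt_atTop.comp hsq
  set V : ℕ → ℝ := fun k ↦
    ∑ u, decProb (R k) (p k) u * (1 - decProb (R k) (p k) u) with hV
  set N : ℕ → ℝ := fun k ↦ (n k : ℝ) * mu (R k) (p k) with hN
  -- The normalised variance of the independent model tends to one.
  have hVN : Tendsto (fun k ↦ V k / N k) atTop (𝓝 1) := by
    rw [tendsto_iff_norm_sub_tendsto_zero]
    refine squeeze_zero' (Eventually.of_forall fun _ ↦ norm_nonneg _) ?_
      ((tendsto_const_nhds (x := (8 : ℝ))).div_atTop hsq)
    filter_upwards [eventually_rates hσ hμ] with k hk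
    obtain ⟨hs1, hm0, r1, -, r3, -⟩ := hk
    have hs : 0 < sigma (n k) (p k) := by linarith
    have hNk : 0 < N k := by linarith
    have e := abs_sum_decProb_sub_le (p k).2.1 (p k).2.2 hs (sigma_sq (n k) (p k)) (R k)
    rw [← mu_eq] at e
    rw [Real.norm_eq_abs, div_sub_one hNk.ne', abs_div, abs_of_pos hNk, div_le_iff₀ hNk]
    calc |V k - N k| ≤ 8 * (n k / sigma (n k) (p k)) := e
      _ ≤ 8 * (N k / √(sigma (n k) (p k))) := by gcongr
      _ = 8 / √(sigma (n k) (p k)) * N k := by ring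
  have hgauss : Tendsto (fun k ↦ (Real.exp (-t ^ 2 * (V k / N k) / 2) : ℂ)) atTop
      (𝓝 (Real.exp (-t ^ 2 / 2) : ℂ)) := by
    have h := ((hVN.const_mul (-t ^ 2)).div_const 2)
    rw [mul_one] at h
    exact (Complex.continuous_ofReal.tendsto _).comp ((Real.continuous_exp.tendsto _).comp h)
  have hdiff : Tendsto (fun k ↦ ex (tieWeight (p k) 1) (fun ω ↦
      ch t ((count (R k) ω - meanRed (R k) (p k)) / √(N k))) -
        (Real.exp (-t ^ 2 * (V k / N k) / 2) : ℂ)) atTop (𝓝 0) := by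
    rw [tendsto_zero_iff_norm_tendsto_zero]
    refine squeeze_zero' (Eventually.of_forall fun _ ↦ norm_nonneg _) ?_
      ((tendsto_const_nhds (x := 52 * t ^ 2 + 126 * |t| ^ 3)).div_atTop hsq2)
    filter_upwards [eventually_rates hσ hμ, hsq.eventually_ge_atTop |t|] with k hk hkt
    obtain ⟨hs1, hm0, r1, r2, r3, r4⟩ := hk
    set s := sigma (n k) (p k) with hsdef
    have hs : 0 < s := by linarith
    have hNk : 0 < N k := by linarith
    have hq1 : 1 ≤ √s := Real.one_le_sqrt.mpr hs1
    have hq : 0 < √s := by linarith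
    have hr : 0 < √(√s) := Real.sqrt_pos.mpr hq
    have hrq : √(√s) ≤ √s := by
      rw [Real.sqrt_le_left hq.le]; nlinarith
    have hsN : √s ≤ √(N k) := Real.sqrt_le_sqrt r3
    have hS : 0 < √(N k) := by linarith
    have hSN : √(N k) ^ 2 = N k := Real.sq_sqrt hNk.le
    set τ := t / √(N k) with hτdef
    have hτabs : |τ| = |t| / √(N k) := by rw [hτdef, abs_div, abs_of_pos hS]
    have hτ : |τ| ≤ 1 := by
      rw [hτabs, div_le_one hS]; linarith
    have hτ2 : τ ^ 2 = t ^ 2 / N k := by rw [hτdef, div_pow, hSN]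
    have key := norm_ex_ch_count_sub_le (R k) (p k).2.1 (p k).2.2 hs1 (sigma_sq (n k) (p k)) hτ
    have hch : ∀ x, ch t (x / √(N k)) = ch τ x := by
      intro x
      rw [ch, ch]; congr 3; rw [hτdef]; ring
    simp only [hch]
    have hg : -t ^ 2 * (V k / N k) / 2 = -τ ^ 2 * V k / 2 := by rw [hτ2]; ring
    rw [hg, meanRed_eq]
    refine key.trans ?_
    have e := abs_sum_decProb_sub_le (p k).2.1 (p k).2.2 hs (sigma_sq (n k) (p k)) (R k)
    rw [← mu_eq] at e
    have hNq : N k / √s ≤ N k := div_le_self hNk.le hq1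
    have hV9 : V k ≤ 9 * N k := by
      have := (le_abs_self _).trans e
      have : V k - N k ≤ 8 * (n k / s) := this
      linarith
    have hr1 : 1 / √(N k) ≤ 1 / √(√s) := one_div_le_one_div_of_le hr (hrq.trans hsN)
    have t1 : 2 * |τ| ^ 3 * V k ≤ 18 * |t| ^ 3 / √(√s) := by
      calc 2 * |τ| ^ 3 * V k ≤ 2 * |τ| ^ 3 * (9 * N k) := by gcongr
        _ = 18 * |t| ^ 3 * (1 / √(N k)) := by
            rw [hτabs, div_pow, pow_succ √(N k) 2, hSN]; field_simp; ring
        _ ≤ 18 * |t| ^ 3 * (1 / √(√s)) := by gcongr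
        _ = _ := by ring
    have t2 : 26 * τ ^ 2 * (imbalance (R k) + n k / s) ≤ 52 * t ^ 2 / √(√s) := by
      calc 26 * τ ^ 2 * (imbalance (R k) + n k / s)
          ≤ 26 * τ ^ 2 * (N k / √s + N k / √s) := by gcongr
        _ = 52 * t ^ 2 / √s := by rw [hτ2]; field_simp; ring
        _ ≤ _ := by gcongr
    have t3 : 108 * |τ| ^ 3 * (n k * √s) ≤ 108 * |t| ^ 3 / √(√s) := by
      rw [hτabs, div_pow, le_div_iff₀ hr]
      calc 108 * (|t| ^ 3 / √(N k) ^ 3) * (n k * √s) * √(√s)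
          = 108 * |t| ^ 3 * ((n k * √s * √(√s)) / √(N k) ^ 3) := by ring
        _ ≤ 108 * |t| ^ 3 * 1 := by
            gcongr
            exact (div_le_one (by positivity)).mpr r4
        _ = _ := by ring
    calc _ ≤ 18 * |t| ^ 3 / √(√s) + (52 * t ^ 2 / √(√s) + 108 * |t| ^ 3 / √(√s)) :=
          add_le_add t1 (add_le_add t2 t3)
      _ = _ := by ring
  have h := hdiff.add hgauss
  simp only [sub_add_cancel, zero_add] at h
  exact h

theorem centralLimitLaw_of_isLittleO
    (hμ : (fun k ↦ Real.log (1 / mu (R k) (p k))) =o[atTop]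
      (fun k ↦ Real.log (sigma (n k) (p k)))) : CentralLimitLaw n p R := by
  intro a b hab
  refine ⟨?_, ?_⟩
  · simp only [gnp_real_eq]
    exact tendsto_ex_indicator_Icc (ι := fun k ↦ Fin (n k) × Fin (n k)) (α := fun _ ↦ Bool → Bool)
      (w := fun k ↦ tieWeight (p k) 1)
      (fun k ↦ isProbWeight_tieWeight (p k).2.1 (p k).2.2 zero_le_one le_rfl)
      (fun k ω ↦ (count (R k) ω - meanRed (R k) (p k)) / √((n k : ℝ) * mu (R k) (p k)))
      (tendsto_ex_ch_count hσ hμ) hab.le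
  · have hint : Integrable (fun x : ℝ ↦ Real.exp (-x ^ 2 / 2)) := by
      convert integrable_exp_neg_mul_sq (show (0 : ℝ) < 1 / 2 by norm_num) using 2
      ring_nf
    rw [stdNormalCDF, stdNormalCDF, ← mul_sub,
      intervalIntegral.integral_Iic_sub_Iic hint.integrableOn hint.integrableOn]

/-- The central limit theorem for the signed sum over all vertices. -/
theorem tendsto_ex_ch_signedSum (R : ∀ k, Finset (Fin (n k))) (t : ℝ) :
    Tendsto (fun k ↦ ex (bern (p k)) (fun y ↦
      ch t ((signedSum (R k) Finset.univ y - p k * ∑ z, (eps (R k) z : ℝ)) / sigma (n k) (p k))))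
      atTop (𝓝 (Real.exp (-t ^ 2 / 2) : ℂ)) := by
  rw [tendsto_iff_norm_sub_tendsto_zero]
  refine squeeze_zero' (Eventually.of_forall fun _ ↦ norm_nonneg _) ?_
    ((tendsto_const_nhds (x := 2 * |t| ^ 3)).div_atTop hσ)
  filter_upwards [hσ.eventually_ge_atTop 1, hσ.eventually_ge_atTop |t|] with k hs1 hst
  have hsq := sigma_sq (n k) (p k)
  set s := sigma (n k) (p k)
  have hs : 0 < s := by linarith
  have hτabs : |t / s| = |t| / s := by rw [abs_div, abs_of_pos hs]
  have key := norm_ex_ch_signedSum_sub_le (R k) (p k).2.1 (p k).2.2 (τ := t / s)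
    (by rw [hτabs, div_le_one hs]; exact hst)
  have hch : ∀ x, ch t (x / s) = ch (t / s) x := by
    intro x
    rw [ch, ch]; congr 3; ring
  rw [← hsq, hτabs] at key
  have e1 : -(t / s) ^ 2 * s ^ 2 / 2 = -t ^ 2 / 2 := by field_simp
  have e2 : 2 * (|t| / s) ^ 3 * s ^ 2 = 2 * |t| ^ 3 / s := by field_simp
  rw [e1, e2] at key
  simpa only [hch] using key

/-- If the imbalance is within a bounded number of standard deviations, then `μ` is bounded below,
by the central limit theorem for the signed sum. -/
theorem exists_le_mu
    (hΔ : (fun k ↦ imbalance (R k) * (p k : ℝ)) =O[atTop] (fun k ↦ sigma (n k) (p k))) :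
    ∃ δ > 0, ∀ᶠ k in atTop, δ ≤ mu (R k) (p k) := by
  obtain ⟨K, hK⟩ := hΔ.bound
  let X : ∀ k, (Fin (n k) → Bool) → ℝ := fun k y ↦
    (signedSum (R k) Finset.univ y - p k * ∑ z, (eps (R k) z : ℝ)) / sigma (n k) (p k)
  have hb : ∀ k, IsProbWeight (bern (p k)) := fun k ↦ isProbWeight_bern (p k).2.1 (p k).2.2
  have hlim : ∀ a : ℝ, Tendsto (fun k ↦ ex (bern (p k)) (fun y ↦
      (Set.Icc a (a + 1)).indicator (1 : ℝ → ℝ) (X k y))) atTop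
      (𝓝 ((√(2 * Real.pi))⁻¹ * ∫ x in a..(a + 1), Real.exp (-x ^ 2 / 2))) := fun a ↦
    tendsto_ex_indicator_Icc (ι := fun k ↦ Fin (n k)) (α := fun _ ↦ Bool)
      (w := fun k ↦ bern (p k)) hb X (tendsto_ex_ch_signedSum hσ R) (by linarith)
  have hpos : ∀ a : ℝ, 0 < (√(2 * Real.pi))⁻¹ * ∫ x in a..(a + 1), Real.exp (-x ^ 2 / 2) := by
    intro a
    refine mul_pos (inv_pos.mpr (Real.sqrt_pos.mpr (by positivity))) ?_
    exact intervalIntegral.intervalIntegral_pos_of_pos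
      ((by fun_prop : Continuous fun x : ℝ ↦ Real.exp (-x ^ 2 / 2)).intervalIntegrable _ _)
      (fun x ↦ Real.exp_pos _) (by linarith)
  -- The mean `M` of the signed sum is at most `K σ` in absolute value. So the signed sum is
  -- non-negative if its normalisation lies in `[K, K + 1]`, non-positive if in `[-K - 1, -K]`.
  set c₁ := (√(2 * Real.pi))⁻¹ * ∫ x in K..(K + 1), Real.exp (-x ^ 2 / 2) with hc₁
  set c₂ := (√(2 * Real.pi))⁻¹ * ∫ x in (-K - 1)..(-K - 1 + 1), Real.exp (-x ^ 2 / 2) with hc₂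
  have p1 : 0 < c₁ := hpos K
  have p2 : 0 < c₂ := hpos (-K - 1)
  refine ⟨c₁ / 2 * (c₂ / 2), by positivity, ?_⟩
  filter_upwards [hK, hσ.eventually_gt_atTop 0, (hlim K).eventually_const_le (half_lt_self p1),
    (hlim (-K - 1)).eventually_const_le (half_lt_self p2)] with k hKk hs h1 h2
  have h0' := (p k).2.1
  have h1' := (p k).2.2
  set M : ℝ := p k * ∑ z, (eps (R k) z : ℝ) with hM
  have hMK : |M| ≤ K * sigma (n k) (p k) := by
    rw [hM, abs_mul, abs_sum_eps, abs_of_nonneg h0', mul_comm]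
    rw [Real.norm_eq_abs, Real.norm_of_nonneg hs.le] at hKk
    exact (le_abs_self _).trans hKk
  rw [abs_le] at hMK
  rw [mu_eq, one_sub_tailProb_one _ h0' h1']
  have b1 : c₁ / 2 ≤ tailProb (R k) (p k) Finset.univ 0 := by
    refine h1.trans (ex_mono (hb k) fun y ↦ ?_)
    by_cases hy : X k y ∈ Set.Icc K (K + 1)
    · have hy1 := hy.1
      simp only [X] at hy1
      rw [le_div_iff₀ hs] at hy1
      have : (0 : ℝ) ≤ signedSum (R k) Finset.univ y := by linarith
      rw [if_pos (by exact_mod_cast this), Set.indicator_of_mem hy, Pi.one_apply]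
    · rw [Set.indicator_of_notMem hy]; split_ifs <;> simp
  have b2 : c₂ / 2 ≤ ex (bern (p k)) (fun y ↦
      if signedSum (R k) Finset.univ y ≤ 0 then (1 : ℝ) else 0) := by
    refine h2.trans (ex_mono (hb k) fun y ↦ ?_)
    by_cases hy : X k y ∈ Set.Icc (-K - 1) (-K - 1 + 1)
    · have hy1 := hy.2
      simp only [X] at hy1
      rw [div_le_iff₀ hs] at hy1
      have : (signedSum (R k) Finset.univ y : ℝ) ≤ 0 := by linarith
      rw [if_pos (by exact_mod_cast this), Set.indicator_of_mem hy, Pi.one_apply]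
    · rw [Set.indicator_of_notMem hy]; split_ifs <;> simp
  exact mul_le_mul b1 b2 (by positivity) (tailProb_nonneg _ h0' h1' _ _)

theorem log_mu_isLittleO
    (hΔ : (fun k ↦ imbalance (R k) * (p k : ℝ)) =O[atTop] (fun k ↦ sigma (n k) (p k))) :
    (fun k ↦ Real.log (1 / mu (R k) (p k))) =o[atTop] (fun k ↦ Real.log (sigma (n k) (p k))) := by
  obtain ⟨δ, hδ, hmu⟩ := exists_le_mu hσ hΔ
  have hO : (fun k ↦ Real.log (1 / mu (R k) (p k))) =O[atTop]
      (fun _ : ℕ ↦ Real.log (1 / δ)) := by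
    refine IsBigO.of_bound 1 ?_
    filter_upwards [hmu] with k hk
    have hm : 0 < mu (R k) (p k) := by linarith
    have h1 : 0 ≤ Real.log (1 / mu (R k) (p k)) :=
      Real.log_nonneg ((one_le_div hm).mpr (mu_le_one _ _))
    have h2 : Real.log (1 / mu (R k) (p k)) ≤ Real.log (1 / δ) :=
      Real.log_le_log (by positivity) (one_div_le_one_div_of_le hδ hk)
    rw [one_mul, Real.norm_of_nonneg h1, Real.norm_of_nonneg (h1.trans h2)]
    exact h2
  refine hO.trans_isLittleO (isLittleO_const_left.mpr (Or.inr ?_))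
  exact tendsto_norm_atTop_atTop.comp (Real.tendsto_log_atTop.comp hσ)

end Sequence

end MajorityDynamics

theorem mainTheorem1 :
    -- (i) the variance estimate, with one absolute constant for all parameters
    (∃ C : ℝ, 0 < C ∧ ∀ (n : ℕ) (R : Finset (Fin n)) (p : unitInterval), 0 < p → p < 1 →
      |MajorityDynamics.varRed R p - (n : ℝ) * MajorityDynamics.mu R p| ≤
        C * (MajorityDynamics.imbalance R + (n : ℝ) / MajorityDynamics.sigma n p)) ∧
    -- (ii) and its special case, along any sequence of instances with `σ → ∞`
    (∀ (n : ℕ → ℕ) (p : ℕ → unitInterval) (R : ∀ k, Finset (Fin (n k))),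
      Tendsto (fun k ↦ MajorityDynamics.sigma (n k) (p k)) atTop atTop →
      ((fun k ↦ Real.log (1 / MajorityDynamics.mu (R k) (p k))) =o[atTop]
          (fun k ↦ Real.log (MajorityDynamics.sigma (n k) (p k))) →
        (fun k ↦ MajorityDynamics.varRed (R k) (p k)) ~[atTop]
            (fun k ↦ (n k : ℝ) * MajorityDynamics.mu (R k) (p k)) ∧
          MajorityDynamics.CentralLimitLaw n p R) ∧
      ((fun k ↦ MajorityDynamics.imbalance (R k) * (p k : ℝ)) =O[atTop]
          (fun k ↦ MajorityDynamics.sigma (n k) (p k)) →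
        (fun k ↦ Real.log (1 / MajorityDynamics.mu (R k) (p k))) =o[atTop]
            (fun k ↦ Real.log (MajorityDynamics.sigma (n k) (p k))) ∧
        (fun k ↦ MajorityDynamics.varRed (R k) (p k)) ~[atTop]
            (fun k ↦ (n k : ℝ) * MajorityDynamics.mu (R k) (p k)) ∧
          MajorityDynamics.CentralLimitLaw n p R)) := by
  refine ⟨⟨60, by norm_num, fun n R p hp0 hp1 ↦ ?_⟩, fun n p R hσ ↦ ⟨fun hμ ↦ ?_, fun hΔ ↦ ?_⟩⟩
  · -- Without vertices `σ = 0` and all terms vanish.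
    rcases Nat.eq_zero_or_pos n with rfl | hn
    · have hR := MajorityDynamics.imbalance_nonneg R
      simpa [MajorityDynamics.varRed_eq, MajorityDynamics.pairSum] using hR
    · refine MajorityDynamics.abs_varRed_sub_le R p (Real.sqrt_pos.mpr ?_)
      have h0 : (0 : ℝ) < p := hp0
      have h1 : (p : ℝ) < 1 := hp1
      have h1' : 0 < 1 - (p : ℝ) := sub_pos.mpr h1
      positivity
  · exact ⟨MajorityDynamics.varRed_isEquivalent hσ hμ,
      MajorityDynamics.centralLimitLaw_of_isLittleO hσ hμ⟩
  · have hμ := MajorityDynamics.log_mu_isLittleO hσ hΔ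
    exact ⟨hμ, MajorityDynamics.varRed_isEquivalent hσ hμ,
      MajorityDynamics.centralLimitLaw_of_isLittleO hσ hμ⟩
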